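/- Throughout, a face of a polytope may be empty ($\dim\emptyset=-1$) or the whole polytope, $\mathcal V(P)$ is the vertex set of $P$, $f_i(P)$ is the number of $i$-dimensional faces of $P$, and two polytopes are combinatorially equivalent if their face lattices are isomorphic. Let $P\subset\mathbb R^n$ be an $n$-dimensional polytope with a special $k$-simplex $\Sigma$, i.e. $\Sigma$ is a $k$-simplex spanned by $k+1$ vertices of $P$ and every facet of $P$ contains exactly $k$ of these vertices. Let $V$ be the linear subspace parallel to $\operatorname{aff}\Sigma$, let the basis polytope $Q\subset\mathbb R^n/V$ be the image of $P$ under the quotient map, and let $\mathcal A$ be the affine hull of the union of all faces of $P$ that contain no vertex of $\Sigma$. Choose a linear complement $W$ of $V$ in $\mathbb R^n$ and a point $p$ in the relative interior of $\mathcal A\cap\Sigma$. Let the vertex projection $\phi$ be the projection of $\mathbb R^n$ onto $p+W$ along $V$ (it places a copy of $Q$ in $p+W$), and put $$P'=\operatorname{conv}\bigl(\phi(\mathcal V(P)\setminus\mathcal V(\Sigma))\cup\mathcal V(\Sigma)\bigr).$$ $P$ is called meek if $\dim Q=\dim\mathcal A$, and wild if $\dim Q<\dim\mathcal A$ and $P$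 is not combinatorially equivalent to the polytope $P'$ (for any choice of $W$ and $p$). Suppose that $P$ is wild. Then, for every choice of $W$ and $p$ as above, $P'$ is an $n$-dimensional polytope, $\Sigma$ is a special simplex of $P'$, $P'$ is meek and has the same basis polytope $Q$ as $P$, and $$f_0(P)=f_0(P'),\qquad f_i(P)<f_i(P')\ \text{ for } i\in\{n-2,n-1\},\qquad f_i(P)\le f_i(P')\ \text{ for all other } i .$$ Moreover, let $\Sigma\oplus Q$ be the direct sum $\{(\lambda_1v,\lambda_2w): v\in T,\ w\in Q-q,\ \lambda_1,\lambda_2\ge 0,\ \lambda_1+\lambda_2\le 1\}$, where $T\subset\mathbb R^k$ is any $k$-simplex with the origin in its interior and $q$ is any interior point of $Q$. Then $$f_0(P')=f_0(\Sigma\oplus Q),\qquad f_i(P')\le f_i(\Sigma\oplus Q)\ \text{ for all } i,$$ and the $f$-vector of $\Sigma\oplus Q$ is given explicitly by $$f_j(\Sigma\oplus Q)=\sum_{\substack{-1\le r\le \dim Q-1,\ -1\le l\le k-1\\ r+l=j-1}} f_r(Q)\binom{k+1}{l+1}\qquad(0\le j\le n-1).$$ -/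

import Mathlib

noncomputable section

namespace SpecialSimplex

/-- Euclidean space `ℝⁿ`. -/
abbrev EucSp (n : ℕ) : Type := EuclideanSpace ℝ (Fin n)

section Polytopes

variable {E : Type*} [AddCommGroup E] [Module ℝ E]

/-- A polytope: the convex hull of finitely many points. -/
def IsPolytope (P : Set E) : Prop :=
  ∃ s : Set E, s.Finite ∧ P = convexHull ℝ s

open Classical in
/-- The dimension of (the affine hull of) a set, with `dim ∅ = -1`. -/
def dim (F : Set E) : ℤ :=
  if F = ∅ then -1 else (Module.finrank ℝ (vectorSpan ℝ F) : ℤ)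

/-- The vertex set `V(P)` of a polytope. -/
def vertices (P : Set E) : Set E := P.extremePoints ℝ

variable [TopologicalSpace E]

/-- The faces of a polytope `P`, the empty face and `P` itself included: the sets of the points of
`P` at which a linear functional attains its maximum over `P`, and `∅`. -/
def faces (P : Set E) : Set (Set E) := {F | IsExposed ℝ P F}

/-- The facets of `P`: the faces of codimension one. -/
def facets (P : Set E) : Set (Set E) := {F | F ∈ faces P ∧ dim F = dim P - 1}

/-- The entry `f_i(P)` of the `f`-vector: the number of `i`-dimensional faces of `P`. -/
def fVec (P : Set E) (i : ℤ) : ℕ := {F | F ∈ faces P ∧ dim F = i}.ncard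

/-- Two polytopes are combinatorially equivalent if their face lattices (ordered by inclusion)
are isomorphic. -/
def CombEquiv (P P' : Set E) : Prop :=
  Nonempty ({F // F ∈ faces P} ≃o {F // F ∈ faces P'})

end Polytopes

/-- The direct sum `P₁ ⊕ P₂` of two polytopes. -/
def directSum {E₁ E₂ : Type*} [AddCommGroup E₁] [Module ℝ E₁] [AddCommGroup E₂] [Module ℝ E₂]
    (P₁ : Set E₁) (P₂ : Set E₂) : Set (E₁ × E₂) :=
  {z | ∃ v ∈ P₁, ∃ w ∈ P₂, ∃ a b : ℝ, 0 ≤ a ∧ 0 ≤ b ∧ a + b ≤ 1 ∧ z = (a • v, b • w)}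

variable {n k : ℕ}

/-- The vertex set `V(Σ)` of a simplex `Σ`. -/
def simplexVertices (σ : Affine.Simplex ℝ (EucSp n) k) : Set (EucSp n) := Set.range σ.points

/-- The simplex `Σ` as a convex body. -/
def simplexBody (σ : Affine.Simplex ℝ (EucSp n) k) : Set (EucSp n) :=
  convexHull ℝ (simplexVertices σ)

/-- The linear subspace parallel to the affine hull of `Σ`. -/
def simplexDir (σ : Affine.Simplex ℝ (EucSp n) k) : Submodule ℝ (EucSp n) :=
  vectorSpan ℝ (simplexVertices σ)

/-- `Σ` is a special `k`-simplex of `P`: it is spanned by `k + 1` vertices of `P`, and every facet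
of `P` contains exactly `k` of these. -/
def IsSpecialSimplex (P : Set (EucSp n)) (σ : Affine.Simplex ℝ (EucSp n) k) : Prop :=
  simplexVertices σ ⊆ vertices P ∧ ∀ F ∈ facets P, (simplexVertices σ ∩ F).ncard = k

/-- The basis polytope `Q`: the image of `P` under the linear projection whose kernel is the
linear subspace parallel to the affine hull of `Σ`. -/
def basisPolytope (P : Set (EucSp n)) (σ : Affine.Simplex ℝ (EucSp n) k) :
    Set (EucSp n ⧸ simplexDir σ) :=
  (simplexDir σ).mkQ '' P

/-- The subcomplex `F(P) \ V(Σ)` of all faces of `P` that contain no vertex of `Σ`. -/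
def residualComplex (P : Set (EucSp n)) (σ : Affine.Simplex ℝ (EucSp n) k) :
    Set (Set (EucSp n)) :=
  {F | F ∈ faces P ∧ Disjoint F (simplexVertices σ)}

/-- The affine basis space of `F(P) \ V(Σ)`: the affine hull of the union of its faces. -/
def residualSpan (P : Set (EucSp n)) (σ : Affine.Simplex ℝ (EucSp n) k) :
    AffineSubspace ℝ (EucSp n) :=
  affineSpan ℝ (⋃₀ residualComplex P σ)

/-- `P` is meek (with respect to `Σ`): `Q` has the dimension of the affine basis space of
`F(P) \ V(Σ)`. -/
def IsMeek (P : Set (EucSp n)) (σ : Affine.Simplex ℝ (EucSp n) k) : Prop :=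
  dim (basisPolytope P σ) = dim (residualSpan P σ : Set (EucSp n))

/-- A way of placing a copy of the basis polytope `Q` in `ℝⁿ`: the copy lies in the affine
subspace `p + W`, where the linear subspace `W` is complementary to the direction of `Σ` and `p`,
the point where the copy meets `Σ`, is a relative interior point of the intersection of `Σ` with
the affine basis space of `F(P) \ V(Σ)`. -/
structure Placement (P : Set (EucSp n)) (σ : Affine.Simplex ℝ (EucSp n) k) where
  /-- The direction of the affine subspace that carries the copy of `Q`. -/
  W : Submodule ℝ (EucSp n)
  isCompl : IsCompl W (simplexDir σ)
  /-- The point in which that affine subspace meets `Σ`. -/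
  p : EucSp n
  mem : p ∈ intrinsicInterior ℝ ((residualSpan P σ : Set (EucSp n)) ∩ simplexBody σ)

/-- The vertex projection `φ` on the vertices outside `Σ`: the affine projection of `ℝⁿ` onto
`p + W` along the direction of `Σ`. -/
def vertexProjection {P : Set (EucSp n)} {σ : Affine.Simplex ℝ (EucSp n) k}
    (c : Placement P σ) (v : EucSp n) : EucSp n :=
  c.p + c.W.projection (simplexDir σ) c.isCompl (v - c.p)

/-- The polytope `P' = conv (φ(V(P) \ V(Σ)) ∪ V(Σ))`. -/
def projectedPolytope {P : Set (EucSp n)} {σ : Affine.Simplex ℝ (EucSp n) k}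
    (c : Placement P σ) : Set (EucSp n) :=
  convexHull ℝ (vertexProjection c '' (vertices P \ simplexVertices σ) ∪ simplexVertices σ)

/-- `P` is wild (with respect to `Σ`): the dimension of `Q` is smaller than that of the affine
basis space of `F(P) \ V(Σ)`, and `P` is not combinatorially equivalent to the meek polytope
`conv (V(Q) ∪ V(Σ))` (`Q` being placed in `ℝⁿ`). -/
def IsWild (P : Set (EucSp n)) (σ : Affine.Simplex ℝ (EucSp n) k) : Prop :=
  dim (basisPolytope P σ) < dim (residualSpan P σ : Set (EucSp n)) ∧
    ∀ c : Placement P σ, ¬ CombEquiv P (projectedPolytope c)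

end SpecialSimplex

end

open SpecialSimplex

/-!
In the coordinates `ℝⁿ ≅ {c | ∑ i, c i = 1} × Y`, where `Y = ℝⁿ ⧸ V` and `c` is the family of
barycentric coordinates with respect to the vertices of `Σ`, a polytope with special simplex `Σ` is
`{(c, y) | ∀ i, max_j g i j y ≤ c i}` for finite families `g i` of linear functionals, because each
facet misses exactly one vertex of `Σ`. A nonempty face is determined by the set `I` of the
coordinates that attain their bound together with a cone of the common refinement of the normal fans
of the `g i`, `i ∈ I`. Hence the `f`-vector is a sum over `I` of numbers of cones.

If `r` are the barycentric coordinates of `p`, then `P'` arises by replacing every `max_j g i j` by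
`r i * ∑ l, max_j g l j`, and the direct sum `Σ ⊕ Q` by replacing it by a multiple of the same
function with positive coefficients. The new fan of `I` is the common refinement of all the normal
fans as soon as `r` does not vanish on `I`, and `g i` is constant where `r i = 0`, so the numbers of
cones can only grow. If no number belonging to a singleton `I` grows in codimensions `0` and `1`,
then each normal fan involved is already the common refinement, and `P` and `P'` are combinatorially
equivalent: this is why the numbers of facets and ridges of a wild polytope grow.
-/

noncomputable section

namespace SpecialSimplex

open Set Filter Topology Module

section AffineFunctions

theorem affineMap_add_smul {R E F : Type*} [Ring R] [AddCommGroup E] [Module R E]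
    [AddCommGroup F] [Module R F] (f : E →ᵃ[R] F) (x w : E) (t : R) :
    f (x + t • w) = f x + t • f.linear w := by
  simpa only [vadd_eq_add, map_smul, add_comm] using f.map_vadd x (t • w)

theorem affineMap_linear_sub {R E F : Type*} [Ring R] [AddCommGroup E] [Module R E]
    [AddCommGroup F] [Module R F] (f : E →ᵃ[R] F) (x y : E) :
    f.linear (x - y) = f x - f y :=
  f.linearMap_vsub x y

theorem affineMap_smul {R E F : Type*} [Ring R] [AddCommGroup E] [Module R E]
    [AddCommGroup F] [Module R F] (f : E →ᵃ[R] F) (a : R) (x : E) :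
    f (a • x) = a • f x + (1 - a) • f 0 := by
  have h := affineMap_add_smul f 0 x a
  rw [zero_add, ← sub_zero x, affineMap_linear_sub, sub_zero] at h
  rw [h, smul_sub, sub_smul, one_smul]
  abel

theorem affineMap_sum_smul {R E F ι : Type*} [Ring R] [AddCommGroup E] [Module R E]
    [AddCommGroup F] [Module R F] [Fintype ι] (f : E →ᵃ[R] F) {w : ι → R} (hw : ∑ i, w i = 1)
    (z : ι → E) : f (∑ i, w i • z i) = ∑ i, w i • f (z i) := by
  rw [← Finset.univ.affineCombination_eq_linear_combination z w hw,
    Finset.univ.map_affineCombination z w hw,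
    Finset.univ.affineCombination_eq_linear_combination _ w hw]
  rfl

theorem eventually_pos_add_mul {c : ℝ} (hc : 0 < c) (d : ℝ) :
    ∀ᶠ t in 𝓝[>] (0 : ℝ), 0 < c + t * d := by
  have hcont : Continuous fun t : ℝ => c + t * d := by fun_prop
  have hpos : ∀ᶠ t in 𝓝 (0 : ℝ), 0 < c + t * d :=
    (hcont.tendsto 0).eventually (lt_mem_nhds (by simpa using hc))
  exact hpos.filter_mono nhdsWithin_le_nhds

end AffineFunctions

section Dimension

variable {E : Type*} [AddCommGroup E] [Module ℝ E]

theorem dim_of_nonempty {F : Set E} (hF : F.Nonempty) :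
    dim F = (finrank ℝ (vectorSpan ℝ F) : ℤ) :=
  if_neg hF.ne_empty

theorem dim_empty : dim (∅ : Set E) = -1 :=
  if_pos rfl

theorem dim_eq_neg_one_iff {F : Set E} : dim F = -1 ↔ F = ∅ := by
  rcases F.eq_empty_or_nonempty with rfl | hF
  · simp [dim_empty]
  · rw [dim_of_nonempty hF]
    simp only [hF.ne_empty, iff_false]
    omega

theorem neg_one_le_dim (F : Set E) : -1 ≤ dim F := by
  rcases F.eq_empty_or_nonempty with rfl | hF
  · rw [dim_empty]
  · rw [dim_of_nonempty hF]
    omega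

variable [TopologicalSpace E]

theorem empty_mem_faces (P : Set E) : ∅ ∈ faces P :=
  isExposed_empty

theorem fVec_neg_one (P : Set E) : fVec P (-1) = 1 := by
  rw [fVec, Set.ncard_eq_one]
  refine ⟨∅, Set.ext fun F => ?_⟩
  simp only [dim_eq_neg_one_iff, mem_ofPred_eq, mem_singleton_iff, and_iff_right_iff_imp]
  rintro rfl
  exact empty_mem_faces P

theorem fVec_eq_zero_of_lt_neg_one (P : Set E) {d : ℤ} (hd : d < -1) : fVec P d = 0 := by
  have h : {F | F ∈ faces P ∧ dim F = d} = ∅ :=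
    eq_empty_of_forall_notMem fun F hF => (neg_one_le_dim F).not_gt (hF.2 ▸ hd)
  rw [fVec, h, Set.ncard_empty]

end Dimension

section Polyhedra

variable {E : Type*} [AddCommGroup E] [Module ℝ E] {K : Type*}

/-- The polyhedron cut out by the constraints `0 ≤ a k x`. -/
def polyhedron (a : K → E →ᵃ[ℝ] ℝ) : Set E := {x | ∀ k, 0 ≤ a k x}

/-- The constraints that are tight at `x`. -/
def activeSet (a : K → E →ᵃ[ℝ] ℝ) (x : E) : Set K := {k | a k x = 0}

/-- The face of `polyhedron a` on which all constraints in `A` are tight. -/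
def polyhedronFace (a : K → E →ᵃ[ℝ] ℝ) (A : Set K) : Set E :=
  {x | x ∈ polyhedron a ∧ A ⊆ activeSet a x}

/-- The directions along which all constraints in `A` are constant. For the active set `A` of a
point, this is the direction of the affine hull of `polyhedronFace a A`. -/
def linealitySpace (a : K → E →ᵃ[ℝ] ℝ) (A : Set K) : Submodule ℝ E :=
  ⨅ k ∈ A, LinearMap.ker (a k).linear

variable {a : K → E →ᵃ[ℝ] ℝ}

theorem mem_linealitySpace {A : Set K} {w : E} :
    w ∈ linealitySpace a A ↔ ∀ k ∈ A, (a k).linear w = 0 := by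
  simp only [linealitySpace, Submodule.mem_iInf, LinearMap.mem_ker]

theorem eventually_mem_polyhedron [Finite K] {x w : E} (hx : x ∈ polyhedron a)
    (hw : ∀ k ∈ activeSet a x, 0 ≤ (a k).linear w) :
    ∀ᶠ t in 𝓝[>] (0 : ℝ), x + t • w ∈ polyhedron a := by
  refine eventually_all.2 fun k => ?_
  simp only [affineMap_add_smul, smul_eq_mul]
  rcases (hx k).eq_or_lt with hk | hk
  · filter_upwards [self_mem_nhdsWithin] with t ht
    rw [← hk, zero_add]
    exact mul_nonneg (le_of_lt ht) (hw k hk.symm)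
  · exact (eventually_pos_add_mul hk _).mono fun _ => le_of_lt

theorem exists_pos_add_smul_mem_polyhedron [Finite K] {x w : E} (hx : x ∈ polyhedron a)
    (hw : ∀ k ∈ activeSet a x, 0 ≤ (a k).linear w) :
    ∃ t : ℝ, 0 < t ∧ x + t • w ∈ polyhedron a :=
  ((eventually_mem_nhdsWithin).and (eventually_mem_polyhedron hx hw)).exists

theorem convex_polyhedron (a : K → E →ᵃ[ℝ] ℝ) : Convex ℝ (polyhedron a) := by
  intro x hx y hy s t hs ht hst k
  rw [Convex.combo_affine_apply hst]
  exact add_nonneg (mul_nonneg hs (hx k)) (mul_nonneg ht (hy k))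

theorem mem_polyhedronFace_activeSet {x : E} (hx : x ∈ polyhedron a) :
    x ∈ polyhedronFace a (activeSet a x) :=
  ⟨hx, subset_rfl⟩

theorem polyhedronFace_activeSet_subset_iff {x z : E} (hx : x ∈ polyhedron a) :
    polyhedronFace a (activeSet a x) ⊆ polyhedronFace a (activeSet a z) ↔
      activeSet a z ⊆ activeSet a x :=
  ⟨fun h => (h (mem_polyhedronFace_activeSet hx)).2, fun h _ hy => ⟨hy.1, h.trans hy.2⟩⟩

theorem vectorSpan_polyhedronFace_activeSet [Finite K] {x : E} (hx : x ∈ polyhedron a) :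
    vectorSpan ℝ (polyhedronFace a (activeSet a x)) = linealitySpace a (activeSet a x) := by
  refine le_antisymm ?_ fun w hw => ?_
  · rw [vectorSpan_def, Submodule.span_le]
    rintro _ ⟨y, hy, z, hz, rfl⟩
    refine mem_linealitySpace.2 fun k hk => ?_
    change (a k).linear (y - z) = 0
    rw [affineMap_linear_sub, show a k y = 0 from hy.2 hk,
      show a k z = 0 from hz.2 hk, sub_zero]
  · rw [mem_linealitySpace] at hw
    obtain ⟨t, ht, hmem⟩ := exists_pos_add_smul_mem_polyhedron hx fun k hk => (hw k hk).ge
    have hface : x + t • w ∈ polyhedronFace a (activeSet a x) := by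
      refine ⟨hmem, fun k hk => ?_⟩
      change a k _ = 0
      rw [affineMap_add_smul, hw k hk, show a k x = 0 from hk, smul_zero, add_zero]
    have hdiff := vsub_mem_vectorSpan ℝ hface (mem_polyhedronFace_activeSet hx)
    rw [vsub_eq_sub, add_sub_cancel_left] at hdiff
    exact (Submodule.smul_mem_iff _ ht.ne').1 hdiff

theorem dim_polyhedronFace_activeSet [Finite K] {x : E} (hx : x ∈ polyhedron a) :
    dim (polyhedronFace a (activeSet a x)) =
      (finrank ℝ (linealitySpace a (activeSet a x)) : ℤ) := by
  rw [dim_of_nonempty ⟨x, mem_polyhedronFace_activeSet hx⟩,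
    vectorSpan_polyhedronFace_activeSet hx]

theorem activeSet_midpoint {x z : E} (hx : x ∈ polyhedron a) (hz : z ∈ polyhedron a) :
    activeSet a (midpoint ℝ x z) = activeSet a x ∩ activeSet a z := by
  ext k
  have hmid : a k (midpoint ℝ x z) = (a k x + a k z) / 2 := by
    rw [(a k).map_midpoint, midpoint_eq_smul_add, smul_eq_mul, invOf_eq_inv, inv_mul_eq_div]
  change a k (midpoint ℝ x z) = 0 ↔ a k x = 0 ∧ a k z = 0
  rw [hmid, div_eq_zero_iff, or_iff_left two_ne_zero, add_eq_zero_iff_of_nonneg (hx k) (hz k)]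

variable [TopologicalSpace E]

theorem exists_eq_polyhedronFace_activeSet [Finite K] {F : Set E}
    (hF : F ∈ faces (polyhedron a)) (hne : F.Nonempty) :
    ∃ x ∈ polyhedron a, F = polyhedronFace a (activeSet a x) := by
  have hF : IsExposed ℝ (polyhedron a) F := hF
  have hext : IsExtreme ℝ (polyhedron a) F := hF.isExtreme
  have hconv : Convex ℝ F := hF.convex (convex_polyhedron a)
  obtain ⟨_, ⟨x, hxF, rfl⟩, hmin⟩ :=
    (Set.toFinite (activeSet a '' F)).exists_minimal (hne.image _)
  have hx := hF.subset hxF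
  refine ⟨x, hx, Subset.antisymm (fun z hz => ⟨hF.subset hz, ?_⟩) fun z hz => ?_⟩
  · have hmid := activeSet_midpoint hx (hF.subset hz)
    exact (hmin ⟨_, hconv.midpoint_mem hxF hz, rfl⟩ (hmid ▸ inter_subset_left)).trans
      (hmid ▸ inter_subset_right)
  · -- The segment from `z` to `x` can be extended beyond `x`, and `F` is extreme.
    obtain ⟨t, ht, hmem⟩ := exists_pos_add_smul_mem_polyhedron (w := x - z) hx fun k hk => by
      rw [affineMap_linear_sub, show a k x = 0 from hk, show a k z = 0 from hz.2 hk, sub_zero]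
    refine hext.left_mem_of_mem_openSegment hz.1 hmem hxF
      ⟨t / (1 + t), 1 / (1 + t), by positivity, by positivity, by field_simp; ring, ?_⟩
    match_scalars <;> field_simp
    ring

end Polyhedra

theorem nonempty_orderIso_of_biTotal {α β : Type*} [PartialOrder α] [PartialOrder β]
    {R : α → β → Prop} (hR : Relator.BiTotal R)
    (hle : ∀ {a b a' b'}, R a b → R a' b' → (a ≤ a' ↔ b ≤ b')) : Nonempty (α ≃o β) := by
  choose φ hφ using hR.1
  have hφle : ∀ a a', φ a ≤ φ a' ↔ a ≤ a' := fun a a' => (hle (hφ a) (hφ a')).symm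
  refine ⟨RelIso.ofSurjective (OrderEmbedding.ofMapLEIff φ hφle) fun b => ?_⟩
  obtain ⟨a, ha⟩ := hR.2 b
  exact ⟨a, le_antisymm ((hle (hφ a) ha).1 le_rfl) ((hle ha (hφ a)).1 le_rfl)⟩

section PolyhedronFaces

variable {E : Type*} [AddCommGroup E] [Module ℝ E] [TopologicalSpace E]
  [IsTopologicalAddGroup E] [ContinuousSMul ℝ E] [T2Space E] [FiniteDimensional ℝ E]
  {K : Type*} [Finite K] {a : K → E →ᵃ[ℝ] ℝ}

theorem setOf_eq_zero_mem_faces {P : Set E} {f : E →ᵃ[ℝ] ℝ} (hf : ∀ x ∈ P, 0 ≤ f x) :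
    {x | x ∈ P ∧ f x = 0} ∈ faces P := by
  rintro ⟨x₀, hx₀, hfx₀⟩
  refine ⟨-f.linear.toContinuousLinearMap, ?_⟩
  ext x
  refine and_congr_right fun hx => ?_
  have hle : ∀ y, -f.linear y ≤ -f.linear x ↔ f x ≤ f y := fun y => by
    rw [neg_le_neg_iff, ← sub_nonneg, ← map_sub, affineMap_linear_sub, sub_nonneg]
  change f x = 0 ↔ ∀ y ∈ P, -f.linear y ≤ -f.linear x
  simp only [hle]
  exact ⟨fun h y hy => h ▸ hf y hy, fun h => le_antisymm (hfx₀ ▸ h x₀ hx₀) (hf x hx)⟩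

theorem polyhedronFace_mem_faces (a : K → E →ᵃ[ℝ] ℝ) (A : Set K) :
    polyhedronFace a A ∈ faces (polyhedron a) := by
  induction A, A.toFinite using Set.Finite.induction_on with
  | empty =>
    have h : polyhedronFace a ∅ = polyhedron a := by simp [polyhedronFace]
    exact h ▸ IsExposed.refl (polyhedron a)
  | @insert k A _ _ ih =>
    have h : polyhedronFace a (insert k A) =
        {x | x ∈ polyhedron a ∧ a k x = 0} ∩ polyhedronFace a A := by
      ext x
      simp only [polyhedronFace, insert_subset_iff, mem_ofPred_eq, mem_inter_iff, activeSet]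
      tauto
    exact h ▸ (show IsExposed ℝ (polyhedron a) _ from
      setOf_eq_zero_mem_faces fun x hx => hx k).inter ih

theorem fVec_polyhedron (a : K → E →ᵃ[ℝ] ℝ) {d : ℤ} (hd : 0 ≤ d) :
    fVec (polyhedron a) d =
      {A | ∃ x ∈ polyhedron a,
        activeSet a x = A ∧ (finrank ℝ (linealitySpace a A) : ℤ) = d}.ncard := by
  symm
  refine Set.ncard_congr (fun A _ => polyhedronFace a A) ?_ ?_ ?_
  · rintro _ ⟨x, hx, rfl, hxd⟩
    exact ⟨polyhedronFace_mem_faces a _, (dim_polyhedronFace_activeSet hx).trans hxd⟩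
  · rintro _ _ ⟨x, hx, rfl, -⟩ ⟨z, hz, rfl, -⟩ h
    exact Subset.antisymm ((polyhedronFace_activeSet_subset_iff hz).1 h.ge)
      ((polyhedronFace_activeSet_subset_iff hx).1 h.le)
  · rintro F ⟨hF, hFd⟩
    have hne : F.Nonempty := nonempty_iff_ne_empty.2 fun h => by
      have := dim_eq_neg_one_iff.2 h
      omega
    obtain ⟨x, hx, rfl⟩ := exists_eq_polyhedronFace_activeSet hF hne
    exact ⟨_, ⟨x, hx, rfl, by rw [← dim_polyhedronFace_activeSet hx, hFd]⟩, rfl⟩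

theorem combEquiv_polyhedron {K' : Type*} [Finite K'] {a' : K' → E →ᵃ[ℝ] ℝ}
    (R : polyhedron a → polyhedron a' → Prop) (hR : Relator.BiTotal R)
    (hle : ∀ {x x' z z'}, R x x' → R z z' →
      (activeSet a x ⊆ activeSet a z ↔ activeSet a' x' ⊆ activeSet a' z')) :
    CombEquiv (polyhedron a) (polyhedron a') := by
  refine nonempty_orderIso_of_biTotal (R := fun F F' => (F.1 = ∅ ∧ F'.1 = ∅) ∨ ∃ x x', R x x' ∧
    F.1 = polyhedronFace a (activeSet a x) ∧ F'.1 = polyhedronFace a' (activeSet a' x'))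
    ⟨?_, ?_⟩ ?_
  · rintro ⟨F, hF⟩
    rcases F.eq_empty_or_nonempty with rfl | hne
    · exact ⟨⟨∅, empty_mem_faces _⟩, Or.inl ⟨rfl, rfl⟩⟩
    · obtain ⟨x, hx, rfl⟩ := exists_eq_polyhedronFace_activeSet hF hne
      obtain ⟨x', hxx'⟩ := hR.1 ⟨x, hx⟩
      exact ⟨⟨_, polyhedronFace_mem_faces a' _⟩, Or.inr ⟨_, x', hxx', rfl, rfl⟩⟩
  · rintro ⟨F, hF⟩
    rcases F.eq_empty_or_nonempty with rfl | hne
    · exact ⟨⟨∅, empty_mem_faces _⟩, Or.inl ⟨rfl, rfl⟩⟩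
    · obtain ⟨x', hx', rfl⟩ := exists_eq_polyhedronFace_activeSet hF hne
      obtain ⟨x, hxx'⟩ := hR.2 ⟨x', hx'⟩
      exact ⟨⟨_, polyhedronFace_mem_faces a _⟩, Or.inr ⟨x, _, hxx', rfl, rfl⟩⟩
  · rintro ⟨F, hF⟩ ⟨F', hF'⟩ ⟨G, hG⟩ ⟨G', hG'⟩ hFF hGG
    rw [Subtype.mk_le_mk, Subtype.mk_le_mk]
    rcases hFF with ⟨rfl, rfl⟩ | ⟨x, x', hxx', rfl, rfl⟩
    · simp
    have hne := (nonempty_of_mem (mem_polyhedronFace_activeSet x.2)).ne_empty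
    have hne' := (nonempty_of_mem (mem_polyhedronFace_activeSet x'.2)).ne_empty
    rcases hGG with ⟨rfl, rfl⟩ | ⟨z, z', hzz', rfl, rfl⟩
    · exact iff_of_false (fun h => hne (subset_eq_empty h rfl))
        fun h => hne' (subset_eq_empty h rfl)
    · exact (polyhedronFace_activeSet_subset_iff x.2).trans
        ((hle hzz' hxx').trans (polyhedronFace_activeSet_subset_iff x'.2).symm)

end PolyhedronFaces

section Maximizers

variable {Y J : Type*} [AddCommGroup Y] [Module ℝ Y]

/-- The members of a family of linear functionals whose value at `y` is maximal. -/
def maximizers (f : J → Y →ₗ[ℝ] ℝ) (y : Y) : Set J := {j | ∀ j', f j' y ≤ f j y}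

/-- The maximizers at `y` whose value at `w` is maximal among the maximizers at `y`: these remain
maximal when `y` is moved slightly in the direction `w`. -/
def directionalMaximizers (f : J → Y →ₗ[ℝ] ℝ) (y w : Y) : Set J :=
  {j | j ∈ maximizers f y ∧ ∀ j' ∈ maximizers f y, f j' w ≤ f j w}

variable {f : J → Y →ₗ[ℝ] ℝ}

theorem eq_of_mem_maximizers {y : Y} {j j' : J} (hj : j ∈ maximizers f y)
    (hj' : j' ∈ maximizers f y) : f j y = f j' y :=
  le_antisymm (hj' j) (hj j')

theorem mem_maximizers_of_le {y : Y} {j j' : J} (hj : j ∈ maximizers f y)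
    (h : f j y ≤ f j' y) : j' ∈ maximizers f y :=
  fun l => (hj l).trans h

theorem maximizers_nonempty [Finite J] [Nonempty J] (f : J → Y →ₗ[ℝ] ℝ) (y : Y) :
    (maximizers f y).Nonempty :=
  Finite.exists_max fun j => f j y

theorem directionalMaximizers_nonempty [Finite J] [Nonempty J] (f : J → Y →ₗ[ℝ] ℝ) (y w : Y) :
    (directionalMaximizers f y w).Nonempty :=
  Set.exists_max_image _ (fun j => f j w) (Set.toFinite _) (maximizers_nonempty f y)

theorem maximizers_smul {t : ℝ} (ht : 0 < t) (y : Y) :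
    maximizers f (t • y) = maximizers f y := by
  ext j
  refine forall_congr' fun j' => ?_
  simp only [map_smul, smul_eq_mul]
  exact mul_le_mul_iff_right₀ ht

theorem eventually_maximizers_add [Finite J] (f : J → Y →ₗ[ℝ] ℝ) (y w : Y) :
    ∀ᶠ t in 𝓝[>] (0 : ℝ), maximizers f (y + t • w) = directionalMaximizers f y w := by
  have hlt : ∀ j j', ∀ᶠ t in 𝓝[>] (0 : ℝ), f j' y < f j y →
      f j' (y + t • w) < f j (y + t • w) := by
    intro j j'
    by_cases h : f j' y < f j y
    · filter_upwards [eventually_pos_add_mul (sub_pos.2 h) (f j w - f j' w)] with t ht _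
      simp only [map_add, map_smul, smul_eq_mul]
      linarith
    · exact Eventually.of_forall fun t h' => absurd h' h
  filter_upwards [eventually_all.2 fun j => eventually_all.2 (hlt j), self_mem_nhdsWithin]
    with t ht (h0 : 0 < t)
  have hval : ∀ j, f j (y + t • w) = f j y + t * f j w := fun j => by simp
  ext j
  constructor
  · intro hj
    have hjy : j ∈ maximizers f y := fun j' => not_lt.1 fun h => (ht j' j h).not_ge (hj j')
    refine ⟨hjy, fun j' hj' => ?_⟩
    have hjj' := hj j'
    rw [hval, hval, eq_of_mem_maximizers hjy hj'] at hjj'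
    exact le_of_mul_le_mul_left (by linarith) h0
  · rintro ⟨hjy, hjw⟩ j'
    by_cases hj' : j' ∈ maximizers f y
    · rw [hval, hval, eq_of_mem_maximizers hjy hj']
      have := mul_le_mul_of_nonneg_left (hjw j' hj') h0.le
      linarith
    · exact (ht j j' (lt_of_not_ge fun h => hj' (mem_maximizers_of_le hjy h))).le

theorem directionalMaximizers_eq_maximizers {y w : Y}
    (h : ∀ j ∈ maximizers f y, ∀ j' ∈ maximizers f y, f j w = f j' w) :
    directionalMaximizers f y w = maximizers f y :=
  Subset.antisymm (fun _ hj => hj.1) fun j hj => ⟨hj, fun j' hj' => (h j' hj' j hj).le⟩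

theorem maximizers_eq_of_mem_segment [Finite J] [Nonempty J] {a b z : Y}
    (h : maximizers f a = maximizers f b) (hz : z ∈ segment ℝ a b) :
    maximizers f z = maximizers f a := by
  obtain ⟨s, t, hs, ht, hst, rfl⟩ := hz
  obtain ⟨p, hpa⟩ := maximizers_nonempty f a
  have hpb : p ∈ maximizers f b := h ▸ hpa
  simp only [maximizers, map_add, map_smul, smul_eq_mul]
  refine Subset.antisymm (fun j hj => ?_) fun j hj j' => ?_
  · have hjp : s * f p a + t * f p b ≤ s * f j a + t * f j b := hj p
    rcases hs.eq_or_lt with rfl | hs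
    · obtain rfl : t = 1 := by linarith
      rw [← maximizers, h]
      exact mem_maximizers_of_le hpb (by linarith)
    · have hjb := mul_le_mul_of_nonneg_left (hpb j) ht
      exact mem_maximizers_of_le hpa (le_of_mul_le_mul_left (by linarith) hs)
  · have hjb : j ∈ maximizers f b := h ▸ hj
    exact add_le_add (mul_le_mul_of_nonneg_left (hj j') hs)
      (mul_le_mul_of_nonneg_left (hjb j') ht)

theorem eq_of_subsingleton_maximizers_segment [Finite J] {x y : Y}
    (h : ∀ z ∈ segment ℝ x y, (f '' maximizers f z).Subsingleton) {m m' : J}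
    (hm : m ∈ maximizers f x) (hm' : m' ∈ maximizers f y) : f m = f m' := by
  by_contra! hne
  have : Nonempty J := ⟨m⟩
  let C (p : J) : Set ℝ := {t | p ∈ maximizers f (AffineMap.lineMap x y t)}
  have hC (p : J) : IsClosed (C p) := by
    have hCp : C p = ⋂ q, {t | (1 - t) * f q x + t * f q y ≤ (1 - t) * f p x + t * f p y} := by
      ext t
      simp [C, maximizers, AffineMap.lineMap_apply_module]
    exact hCp ▸ isClosed_iInter fun q => isClosed_le (by fun_prop) (by fun_prop)
  obtain ⟨t, ht, hU, hV⟩ := isPreconnected_closed_iff.1 (isPreconnected_Icc (a := (0 : ℝ)) (b := 1))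
    (⋃ p ∈ {p | f p = f m}, C p) (⋃ p ∈ {p | f p ≠ f m}, C p)
    ((Set.toFinite _).isClosed_biUnion fun p _ => hC p)
    ((Set.toFinite _).isClosed_biUnion fun p _ => hC p)
    (fun t _ => by
      obtain ⟨p, hp⟩ := maximizers_nonempty f (AffineMap.lineMap x y t)
      by_cases hpm : f p = f m
      · exact Or.inl (mem_biUnion (x := p) hpm hp)
      · exact Or.inr (mem_biUnion (x := p) hpm hp))
    ⟨0, left_mem_Icc.2 zero_le_one, mem_biUnion (x := m) rfl (by simpa [C] using hm)⟩
    ⟨1, right_mem_Icc.2 zero_le_one, mem_biUnion (x := m') hne.symm (by simpa [C] using hm')⟩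
  obtain ⟨p, hpm, hp⟩ := mem_iUnion₂.1 hU
  obtain ⟨q, hqm, hq⟩ := mem_iUnion₂.1 hV
  have hz : AffineMap.lineMap x y t ∈ segment ℝ x y :=
    segment_eq_image_lineMap ℝ x y ▸ mem_image_of_mem _ ht
  exact hqm ((h _ hz ⟨q, hq, rfl⟩ ⟨p, hp, rfl⟩).trans hpm)

/-- The functionals maximal at `w`, `w'` and `-w` coincide, so one functional attains both the
maximum and the minimum at `w`. -/
theorem eq_of_subsingleton_maximizers_segment_neg [Finite J] [Nonempty J] {w w' : Y}
    (h : ∀ z ∈ segment ℝ w w', (f '' maximizers f z).Subsingleton)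
    (h' : ∀ z ∈ segment ℝ w' (-w), (f '' maximizers f z).Subsingleton) (m m' : J) :
    f m w = f m' w := by
  obtain ⟨p, hp⟩ := maximizers_nonempty f w
  obtain ⟨q, hq⟩ := maximizers_nonempty f w'
  obtain ⟨r, hr⟩ := maximizers_nonempty f (-w)
  have hpr : f p = f r := (eq_of_subsingleton_maximizers_segment h hp hq).trans
    (eq_of_subsingleton_maximizers_segment h' hq hr)
  have hval : ∀ j, f j w = f p w := fun j => by
    have hle := hp j
    have hge := hr j
    rw [← hpr, map_neg, map_neg] at hge
    linarith
  rw [hval m, hval m']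

theorem exists_eventually_forall_eq_zero_of_apply_eq_zero {α : Type*} [Finite α]
    (φ : α → Y →ₗ[ℝ] ℝ) (w₀ : Y) :
    ∃ w₁, ∀ᶠ t in 𝓝[>] (0 : ℝ), ∀ a, φ a (w₀ + t • w₁) = 0 → φ a = 0 := by
  obtain ⟨w₁, hw₁⟩ := Module.Dual.exists_forall_ne_zero_of_forall_exists
    (fun a : {a // φ a ≠ 0} => φ a) fun a => DFunLike.ne_iff.1 a.2
  refine ⟨w₁, eventually_all.2 fun a => ?_⟩
  by_cases ha : φ a = 0
  · exact Eventually.of_forall fun _ _ => ha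
  simp only [map_add, map_smul, smul_eq_mul, ha, imp_false]
  rcases lt_trichotomy (φ a w₀) 0 with h | h | h
  · filter_upwards [eventually_pos_add_mul (neg_pos.2 h) (-φ a w₁)] with t ht
    linarith
  · filter_upwards [self_mem_nhdsWithin] with t ht
    rw [h, zero_add]
    exact mul_ne_zero (ne_of_gt ht) (hw₁ ⟨a, ha⟩)
  · filter_upwards [eventually_pos_add_mul h (φ a w₁)] with t ht
    exact ht.ne'

end Maximizers

section Hyperplanes

variable {K Y : Type*} [Field K] [AddCommGroup Y] [Module K Y] {L : Submodule K Y} {w w' : Y}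

theorem finrank_add_one_of_sup_span_singleton_eq_top [FiniteDimensional K Y]
    (hL : L ≠ ⊤) (h : L ⊔ Submodule.span K {w} = ⊤) : finrank K L + 1 = finrank K Y := by
  have hle := Submodule.finrank_add_le_finrank_add_finrank L (Submodule.span K {w})
  have hspan : finrank K (Submodule.span K {w}) ≤ 1 := by
    simpa using finrank_span_le_card (R := K) {w}
  have hlt := Submodule.finrank_lt hL
  rw [h, finrank_top] at hle
  omega

theorem smul_add_smul_notMem (hw : w ∉ L) (hw' : w' ∉ L ⊔ Submodule.span K {w}) {c d : K}
    (hcd : c ≠ 0 ∨ d ≠ 0) : c • w + d • w' ∉ L := by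
  intro hmem
  by_cases hd : d = 0
  · rw [hd, zero_smul, add_zero, Submodule.smul_mem_iff _ (by tauto)] at hmem
    exact hw hmem
  · rw [← Submodule.smul_mem_iff _ hd, ← add_sub_cancel_left (c • w) (d • w')] at hw'
    exact hw' (Submodule.sub_mem _ (Submodule.mem_sup_left hmem)
      (Submodule.smul_mem _ _ (Submodule.mem_sup_right (Submodule.mem_span_singleton_self w))))

theorem notMem_of_mem_segment_of_notMem_sup {Y : Type*} [AddCommGroup Y] [Module ℝ Y]
    {L : Submodule ℝ Y} {w w' z : Y} (hw : w ∉ L) (hw' : w' ∉ L ⊔ Submodule.span ℝ {w})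
    (hz : z ∈ segment ℝ w w') : z ∉ L := by
  obtain ⟨s, t, -, -, hst, rfl⟩ := hz
  refine smul_add_smul_notMem hw hw' ?_
  by_contra! h
  linarith

end Hyperplanes

section NormalFans

variable {Y ι J : Type*} [AddCommGroup Y] [Module ℝ Y]

/-- The pairs `(i, j)` with `i ∈ I` such that the `j`-th member of the `i`-th family is maximal at
`y`. These sets label the cones of the common normal fan of the families with index in `I`: two
points lie in the relative interior of the same cone if and only if their pairs agree. -/
def maximizerPairs (g : ι → J → Y →ₗ[ℝ] ℝ) (I : Finset ι) (y : Y) : Set (ι × J) :=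
  {s | s.1 ∈ I ∧ s.2 ∈ maximizers (g s.1) y}

/-- The subspace on which members of the same family with labels in `A` agree. This is the linear
span of the cone of the normal fan that is labelled by `A`. -/
def coneSpan (g : ι → J → Y →ₗ[ℝ] ℝ) (A : Set (ι × J)) : Submodule ℝ Y where
  carrier := {u | ∀ i j j', (i, j) ∈ A → (i, j') ∈ A → g i j u = g i j' u}
  add_mem' := fun hu hv i j j' h h' => by rw [map_add, map_add, hu i j j' h h', hv i j j' h h']
  zero_mem' := fun i j j' _ _ => by rw [map_zero, map_zero]
  smul_mem' := fun c u hu i j j' h h' => by rw [map_smul, map_smul, hu i j j' h h']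

/-- The labels of the cones of dimension `d` in the common normal fan of the families with index
in `I`. -/
def fanCones (g : ι → J → Y →ₗ[ℝ] ℝ) (I : Finset ι) (d : ℤ) : Set (Set (ι × J)) :=
  {A | ∃ y, A = maximizerPairs g I y ∧ (finrank ℝ (coneSpan g A) : ℤ) = d}

/-- The part of `A` that belongs to the families with index in `I`. -/
def restrictPairs (I : Finset ι) (A : Set (ι × J)) : Set (ι × J) := {s | s.1 ∈ I ∧ s ∈ A}

variable {g : ι → J → Y →ₗ[ℝ] ℝ}

theorem coneSpan_anti {A B : Set (ι × J)} (h : A ⊆ B) : coneSpan g B ≤ coneSpan g A :=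
  fun _ hu i j j' hj hj' => hu i j j' (h hj) (h hj')

theorem self_mem_coneSpan (I : Finset ι) (y : Y) : y ∈ coneSpan g (maximizerPairs g I y) :=
  fun _ _ _ h h' => eq_of_mem_maximizers h.2 h'.2

theorem coneSpan_maximizerPairs_eq_top_iff {I : Finset ι} {y : Y} :
    coneSpan g (maximizerPairs g I y) = ⊤ ↔
      ∀ i ∈ I, (g i '' maximizers (g i) y).Subsingleton := by
  refine ⟨?_, fun h => eq_top_iff.2 fun u _ i j j' hj hj' => ?_⟩
  · rintro h i hi _ ⟨j, hj, rfl⟩ _ ⟨j', hj', rfl⟩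
    ext u
    have hu : u ∈ coneSpan g (maximizerPairs g I y) := h ▸ Submodule.mem_top
    exact hu i j j' ⟨hi, hj⟩ ⟨hi, hj'⟩
  · rw [h i hj.1 ⟨j, hj.2, rfl⟩ ⟨j', hj'.2, rfl⟩]

theorem maximizerPairs_smul {t : ℝ} (ht : 0 < t) (I : Finset ι) (y : Y) :
    maximizerPairs g I (t • y) = maximizerPairs g I y := by
  ext s
  simp only [maximizerPairs, maximizers_smul ht]

theorem maximizerPairs_singleton_eq_iff {i : ι} {y z : Y} :
    maximizerPairs g {i} y = maximizerPairs g {i} z ↔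
      maximizers (g i) y = maximizers (g i) z := by
  simp [maximizerPairs, Set.ext_iff, forall_comm (α := ι)]

variable [Fintype ι]

theorem restrictPairs_maximizerPairs (I : Finset ι) (y : Y) :
    restrictPairs I (maximizerPairs g Finset.univ y) = maximizerPairs g I y := by
  ext s
  simp [restrictPairs, maximizerPairs]

theorem maximizerPairs_univ_eq_iff {y z : Y} :
    maximizerPairs g Finset.univ y = maximizerPairs g Finset.univ z ↔
      ∀ i, maximizers (g i) y = maximizers (g i) z := by
  simp [maximizerPairs, Set.ext_iff]

theorem maximizerPairs_univ_subset_iff {y z : Y} :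
    maximizerPairs g Finset.univ y ⊆ maximizerPairs g Finset.univ z ↔
      ∀ i, maximizers (g i) y ⊆ maximizers (g i) z := by
  simp [maximizerPairs, Set.subset_def]

theorem mem_coneSpan_of_subset_directionalMaximizers {z u : Y}
    (h : ∀ i, maximizers (g i) z ⊆ directionalMaximizers (g i) z u) :
    u ∈ coneSpan g (maximizerPairs g Finset.univ z) :=
  fun i _ _ hj hj' => le_antisymm ((h i hj'.2).2 _ hj.2) ((h i hj.2).2 _ hj'.2)

theorem coneSpan_maximizerPairs_univ_eq_top_of_generic {y w : Y}
    (hw : ∀ i j j', g i j w = g i j' w → g i j = g i j') {t : ℝ}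
    (ht : ∀ i, maximizers (g i) (y + t • w) = directionalMaximizers (g i) y w) :
    coneSpan g (maximizerPairs g Finset.univ (y + t • w)) = ⊤ := by
  refine coneSpan_maximizerPairs_eq_top_iff.2 fun i _ => ?_
  rw [ht i]
  rintro _ ⟨j, hj, rfl⟩ _ ⟨j', hj', rfl⟩
  exact hw i j j' (le_antisymm (hj'.2 j hj.1) (hj.2 j' hj'.1))

variable [Finite J]

/-- Among the points with the given labels for `I`, take one with the fewest labels overall: moving
it within the span of its cone for `I` creates no new labels. -/
theorem exists_maximizerPairs_eq_coneSpan_univ_eq (I : Finset ι) (y : Y) :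
    ∃ z, maximizerPairs g I z = maximizerPairs g I y ∧
      coneSpan g (maximizerPairs g Finset.univ z) = coneSpan g (maximizerPairs g I y) := by
  obtain ⟨A, ⟨⟨z, hz, rfl⟩, hmin⟩⟩ := (Set.toFinite (maximizerPairs g Finset.univ ''
    {z | maximizerPairs g I z = maximizerPairs g I y})).exists_minimal ⟨_, y, rfl, rfl⟩
  have hz : maximizerPairs g I z = maximizerPairs g I y := hz
  rw [← hz]
  refine ⟨z, rfl, le_antisymm (coneSpan_anti fun s hs => ⟨Finset.mem_univ _, hs.2⟩)
    fun u hu => ?_⟩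
  obtain ⟨t, ht⟩ := (eventually_all.2 fun i => eventually_maximizers_add (g i) z u).exists
  have hI : maximizerPairs g I (z + t • u) = maximizerPairs g I z := by
    ext ⟨i, j⟩
    refine and_congr_right fun (hi : i ∈ I) => ?_
    change j ∈ maximizers (g i) (z + t • u) ↔ j ∈ maximizers (g i) z
    rw [ht i, directionalMaximizers_eq_maximizers fun j hj j' hj' => hu i j j' ⟨hi, hj⟩ ⟨hi, hj'⟩]
  have hsub : maximizerPairs g Finset.univ z ⊆ maximizerPairs g Finset.univ (z + t • u) :=
    hmin ⟨_, hI.trans hz, rfl⟩ (maximizerPairs_univ_subset_iff.2 fun i => by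
      rw [ht i]; exact fun j hj => hj.1)
  exact mem_coneSpan_of_subset_directionalMaximizers fun i =>
    ht i ▸ maximizerPairs_univ_subset_iff.1 hsub i

theorem fanCones_subset_image_restrictPairs (I : Finset ι) (d : ℤ) :
    fanCones g I d ⊆ restrictPairs I '' fanCones g Finset.univ d := by
  rintro _ ⟨y, rfl, hd⟩
  obtain ⟨z, hz, hspan⟩ := exists_maximizerPairs_eq_coneSpan_univ_eq (g := g) I y
  exact ⟨_, ⟨z, rfl, by rw [hspan, hd]⟩, by rw [restrictPairs_maximizerPairs, hz]⟩

theorem ncard_fanCones_le (I : Finset ι) (d : ℤ) :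
    (fanCones g I d).ncard ≤ (fanCones g Finset.univ d).ncard :=
  (Set.ncard_le_ncard (fanCones_subset_image_restrictPairs I d) (Set.toFinite _)).trans
    (Set.ncard_image_le (Set.toFinite _))

theorem ncard_fanCones_lt_of_subset {I : Finset ι} {d : ℤ} {z : Y}
    (hz : (finrank ℝ (coneSpan g (maximizerPairs g Finset.univ z)) : ℤ) = d)
    (h : fanCones g I d ⊆
      restrictPairs I '' (fanCones g Finset.univ d \ {maximizerPairs g Finset.univ z})) :
    (fanCones g I d).ncard < (fanCones g Finset.univ d).ncard :=
  ((Set.ncard_le_ncard h (Set.toFinite _)).trans (Set.ncard_image_le (Set.toFinite _))).trans_lt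
    (Set.ncard_sdiff_singleton_lt_of_mem ⟨z, rfl, hz⟩ (Set.toFinite _))

theorem ncard_fanCones_lt_of_finrank_ne {I : Finset ι} {d : ℤ} {z : Y}
    (hz : (finrank ℝ (coneSpan g (maximizerPairs g Finset.univ z)) : ℤ) = d)
    (hI : (finrank ℝ (coneSpan g (maximizerPairs g I z)) : ℤ) ≠ d) :
    (fanCones g I d).ncard < (fanCones g Finset.univ d).ncard := by
  refine ncard_fanCones_lt_of_subset hz fun A hA => ?_
  obtain ⟨B, hB, rfl⟩ := fanCones_subset_image_restrictPairs I d hA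
  refine ⟨B, ⟨hB, ?_⟩, rfl⟩
  rintro rfl
  obtain ⟨y, -, hy⟩ := hA
  rw [restrictPairs_maximizerPairs] at hy
  exact hI hy

theorem ncard_fanCones_lt_of_maximizerPairs_ne {I : Finset ι} {d : ℤ} {z z' : Y}
    (hz : (finrank ℝ (coneSpan g (maximizerPairs g Finset.univ z)) : ℤ) = d)
    (hz' : (finrank ℝ (coneSpan g (maximizerPairs g Finset.univ z')) : ℤ) = d)
    (hI : maximizerPairs g I z = maximizerPairs g I z')
    (hne : maximizerPairs g Finset.univ z ≠ maximizerPairs g Finset.univ z') :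
    (fanCones g I d).ncard < (fanCones g Finset.univ d).ncard := by
  refine ncard_fanCones_lt_of_subset hz fun A hA => ?_
  obtain ⟨B, hB, rfl⟩ := fanCones_subset_image_restrictPairs I d hA
  by_cases h : B = maximizerPairs g Finset.univ z
  · refine ⟨_, ⟨⟨z', rfl, hz'⟩, hne.symm⟩, ?_⟩
    rw [h, restrictPairs_maximizerPairs, restrictPairs_maximizerPairs, hI]
  · exact ⟨B, ⟨hB, h⟩, rfl⟩

end NormalFans

section Walls

variable {Y ι J : Type*} [AddCommGroup Y] [Module ℝ Y] {g : ι → J → Y →ₗ[ℝ] ℝ}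
  [Fintype ι] [Finite J]

/-- Otherwise `w` and `-w` could be joined by a path avoiding the span of the cone of `z`, along
which the maximal functionals would not change. -/
theorem finrank_coneSpan_add_one_of_subsingleton_directionalMaximizers [FiniteDimensional ℝ Y]
    {z : Y} (hz : coneSpan g (maximizerPairs g Finset.univ z) ≠ ⊤)
    (hdir : ∀ w ∉ coneSpan g (maximizerPairs g Finset.univ z), ∀ i,
      (g i '' directionalMaximizers (g i) z w).Subsingleton) :
    finrank ℝ (coneSpan g (maximizerPairs g Finset.univ z)) + 1 = finrank ℝ Y := by
  obtain ⟨w, -, hw⟩ := SetLike.exists_of_lt (lt_top_iff_ne_top.2 hz)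
  refine finrank_add_one_of_sup_span_singleton_eq_top hz (w := w) ?_
  by_contra htop
  obtain ⟨w', -, hw'⟩ := SetLike.exists_of_lt (lt_top_iff_ne_top.2 htop)
  have hneg : ∀ x ∈ segment ℝ w' (-w), x ∉ coneSpan g (maximizerPairs g Finset.univ z) :=
    fun x hx => notMem_of_mem_segment_of_notMem_sup (w := -w) (by rwa [neg_mem_iff])
      (by rwa [← Set.neg_singleton, Submodule.span_neg]) (segment_symm ℝ w' (-w) ▸ hx)
  have hmax : ∀ i, ∀ x ∉ coneSpan g (maximizerPairs g Finset.univ z),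
      ((fun q : maximizers (g i) z => g i q) ''
        maximizers (fun q : maximizers (g i) z => g i q) x).Subsingleton := by
    rintro i x hx _ ⟨p, hp, rfl⟩ _ ⟨q, hq, rfl⟩
    exact hdir x hx i ⟨p, ⟨p.2, fun r hr => hp ⟨r, hr⟩⟩, rfl⟩
      ⟨q, ⟨q.2, fun r hr => hq ⟨r, hr⟩⟩, rfl⟩
  refine hw fun i p q hp hq => ?_
  have : Nonempty (maximizers (g i) z) := ⟨p, hp.2⟩
  exact eq_of_subsingleton_maximizers_segment_neg (f := fun r : maximizers (g i) z => g i r)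
    (fun x hx => hmax i x (notMem_of_mem_segment_of_notMem_sup hw hw' hx))
    (fun x hx => hmax i x (hneg x hx)) ⟨p, hp.2⟩ ⟨q, hq.2⟩

variable [Nonempty J]

/-- Moving `y` and `y'` slightly in the same generic direction, close to `-y'`, keeps them in a
common cone for `i`, while `j` stays maximal at `y` and not at `y'`. -/
theorem exists_maximizers_eq_maximizerPairs_ne_coneSpan_eq_top {i l : ι} {y y' : Y} {j : J}
    (hi : maximizers (g i) y = maximizers (g i) y') (hj : j ∈ maximizers (g l) y)
    (hj' : j ∉ maximizers (g l) y') :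
    ∃ a b, maximizers (g i) a = maximizers (g i) b ∧
      maximizerPairs g Finset.univ a ≠ maximizerPairs g Finset.univ b ∧
      coneSpan g (maximizerPairs g Finset.univ a) = ⊤ ∧
      coneSpan g (maximizerPairs g Finset.univ b) = ⊤ := by
  obtain ⟨w₁, hw₁⟩ := exists_eventually_forall_eq_zero_of_apply_eq_zero
    (fun s : ι × J × J => g s.1 s.2.1 - g s.1 s.2.2) (-y')
  have hlt : ∀ m, ∀ᶠ t in 𝓝[>] (0 : ℝ), m ∈ maximizers (g l) y' →
      g l m (-y' + t • w₁) < g l j (-y' + t • w₁) := by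
    intro m
    by_cases hm : m ∈ maximizers (g l) y'
    · have hmj : 0 < g l m y' - g l j y' :=
        sub_pos.2 (lt_of_not_ge fun hle => hj' (mem_maximizers_of_le hm hle))
      filter_upwards [eventually_pos_add_mul hmj (g l j w₁ - g l m w₁)] with t ht _
      simp only [map_add, map_smul, map_neg, smul_eq_mul]
      linarith
    · exact Eventually.of_forall fun t h => absurd h hm
  obtain ⟨t, hgen, hlt⟩ := (hw₁.and (eventually_all.2 hlt)).exists
  set w := -y' + t • w₁
  have hgen : ∀ i j j', g i j w = g i j' w → g i j = g i j' := fun i j j' h =>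
    sub_eq_zero.1 (hgen (i, j, j') (sub_eq_zero.2 h))
  obtain ⟨s, hs, hs'⟩ := ((eventually_all.2 fun i => eventually_maximizers_add (g i) y w).and
    (eventually_all.2 fun i => eventually_maximizers_add (g i) y' w)).exists
  refine ⟨y + s • w, y' + s • w, ?_, fun h => ?_,
    coneSpan_maximizerPairs_univ_eq_top_of_generic hgen hs,
    coneSpan_maximizerPairs_univ_eq_top_of_generic hgen hs'⟩
  · rw [hs, hs', directionalMaximizers, directionalMaximizers, hi]
  · obtain ⟨q, hq⟩ := directionalMaximizers_nonempty (g l) y w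
    have hq' : q ∈ directionalMaximizers (g l) y' w := by
      rwa [← hs', ← maximizerPairs_univ_eq_iff.1 h l, hs]
    exact (hlt q hq'.1).not_ge (hq.2 j hj)

theorem exists_mem_segment_coneSpan_ne_top {a b : Y}
    (hab : maximizerPairs g Finset.univ a ≠ maximizerPairs g Finset.univ b) :
    ∃ z ∈ segment ℝ a b, coneSpan g (maximizerPairs g Finset.univ z) ≠ ⊤ := by
  by_contra! h
  have heq : ∀ i j j', j ∈ maximizers (g i) a → j' ∈ maximizers (g i) b → g i j = g i j' :=
    fun i j j' => eq_of_subsingleton_maximizers_segment fun z hz =>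
      coneSpan_maximizerPairs_eq_top_iff.1 (h z hz) i (Finset.mem_univ i)
  refine hab (maximizerPairs_univ_eq_iff.2 fun i => ?_)
  obtain ⟨p, hp⟩ := maximizers_nonempty (g i) a
  obtain ⟨q, hq⟩ := maximizers_nonempty (g i) b
  ext j
  exact ⟨fun hj => mem_maximizers_of_le hq (heq i j q hj hq ▸ le_rfl),
    fun hj => mem_maximizers_of_le hp (heq i p j hp hj ▸ le_rfl)⟩

theorem exists_coneSpan_singleton_eq_top_finrank_coneSpan_univ_add_one [FiniteDimensional ℝ Y]
    {i : ι} {a b : Y} (hi : maximizers (g i) a = maximizers (g i) b)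
    (hab : maximizerPairs g Finset.univ a ≠ maximizerPairs g Finset.univ b)
    (ha : coneSpan g (maximizerPairs g Finset.univ a) = ⊤) :
    ∃ z, coneSpan g (maximizerPairs g {i} z) = ⊤ ∧
      finrank ℝ (coneSpan g (maximizerPairs g Finset.univ z)) + 1 = finrank ℝ Y := by
  obtain ⟨x, hx, hne⟩ := exists_mem_segment_coneSpan_ne_top hab
  obtain ⟨A, ⟨⟨z, ⟨hzi, hz⟩, rfl⟩, hmin⟩⟩ := (Set.toFinite (maximizerPairs g Finset.univ ''
    {z | maximizers (g i) z = maximizers (g i) a ∧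
      coneSpan g (maximizerPairs g Finset.univ z) ≠ ⊤})).exists_minimal
    ⟨_, _, ⟨maximizers_eq_of_mem_segment hi hx, hne⟩, rfl⟩
  have hia : (g i '' maximizers (g i) z).Subsingleton :=
    hzi ▸ coneSpan_maximizerPairs_eq_top_iff.1 ha i (Finset.mem_univ i)
  refine ⟨z, coneSpan_maximizerPairs_eq_top_iff.2 fun m hm => Finset.mem_singleton.1 hm ▸ hia,
    finrank_coneSpan_add_one_of_subsingleton_directionalMaximizers hz fun w hw l => ?_⟩
  obtain ⟨s, hs⟩ := (eventually_all.2 fun i => eventually_maximizers_add (g i) z w).exists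
  suffices htop : coneSpan g (maximizerPairs g Finset.univ (z + s • w)) = ⊤ from
    hs l ▸ coneSpan_maximizerPairs_eq_top_iff.1 htop l (Finset.mem_univ l)
  by_contra hcon
  have hiw : maximizers (g i) (z + s • w) = maximizers (g i) a := by
    rw [hs, directionalMaximizers_eq_maximizers, hzi]
    exact fun p hp q hq => congrArg (· w) (hia ⟨p, hp, rfl⟩ ⟨q, hq, rfl⟩)
  have hsub : maximizerPairs g Finset.univ z ⊆ maximizerPairs g Finset.univ (z + s • w) :=
    hmin ⟨_, ⟨hiw, hcon⟩, rfl⟩ (maximizerPairs_univ_subset_iff.2 fun i => by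
      rw [hs i]; exact fun j hj => hj.1)
  exact hw (mem_coneSpan_of_subset_directionalMaximizers fun i =>
    hs i ▸ maximizerPairs_univ_subset_iff.1 hsub i)

theorem ncard_fanCones_singleton_lt [FiniteDimensional ℝ Y] {i l : ι} {y y' : Y}
    (hi : maximizers (g i) y = maximizers (g i) y')
    (hl : ¬ maximizers (g l) y ⊆ maximizers (g l) y') {d : ℤ}
    (hd : d = finrank ℝ Y ∨ d = finrank ℝ Y - 1) :
    (fanCones g {i} d).ncard < (fanCones g Finset.univ d).ncard := by
  obtain ⟨j, hj, hj'⟩ := not_subset.1 hl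
  obtain ⟨a, b, hab, hne, ha, hb⟩ :=
    exists_maximizers_eq_maximizerPairs_ne_coneSpan_eq_top hi hj hj'
  rcases hd with rfl | rfl
  · exact ncard_fanCones_lt_of_maximizerPairs_ne (by rw [ha, finrank_top])
      (by rw [hb, finrank_top]) (maximizerPairs_singleton_eq_iff.2 hab) hne
  · obtain ⟨z, hzi, hz⟩ :=
      exists_coneSpan_singleton_eq_top_finrank_coneSpan_univ_add_one hab hne ha
    refine ncard_fanCones_lt_of_finrank_ne (z := z) (by omega) ?_
    rw [hzi, finrank_top]
    omega

end Walls

section PositivelySpanning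

variable {Y ι J M : Type*} [AddCommGroup Y] [Module ℝ Y]

/-- The family `h` of linear functionals is positive somewhere at every nonzero vector; for finite
families this means that `h` positively spans the dual space. -/
def IsPositivelySpanning (h : M → Y →ₗ[ℝ] ℝ) : Prop := ∀ y ≠ 0, ∃ m, 0 < h m y

variable [Fintype ι]

/-- The family of all sums with one summand from each of the families. Its normal fan is the
common refinement of the normal fans of the families. -/
def sumFamily (g : ι → J → Y →ₗ[ℝ] ℝ) (m : ι → J) : Y →ₗ[ℝ] ℝ := ∑ i, g i (m i)

variable {g : ι → J → Y →ₗ[ℝ] ℝ}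

theorem sumFamily_apply (g : ι → J → Y →ₗ[ℝ] ℝ) (m : ι → J) (y : Y) :
    sumFamily g m y = ∑ i, g i (m i) y := by
  rw [sumFamily, LinearMap.sum_apply]

theorem sumFamily_update_apply [DecidableEq ι] (g : ι → J → Y →ₗ[ℝ] ℝ) (m : ι → J) (i : ι) (j : J)
    (y : Y) : sumFamily g (Function.update m i j) y = sumFamily g m y - g i (m i) y + g i j y := by
  have herase : ∑ l ∈ Finset.univ.erase i, g l (Function.update m i j l) y =
      ∑ l ∈ Finset.univ.erase i, g l (m l) y :=
    Finset.sum_congr rfl fun l hl => by rw [Function.update_of_ne (Finset.ne_of_mem_erase hl)]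
  rw [sumFamily_apply, sumFamily_apply, ← Finset.add_sum_erase _ _ (Finset.mem_univ i),
    ← Finset.add_sum_erase _ (fun l => g l (m l) y) (Finset.mem_univ i), Function.update_self,
    herase]
  ring

theorem mem_maximizers_sumFamily {m : ι → J} {y : Y} :
    m ∈ maximizers (sumFamily g) y ↔ ∀ i, m i ∈ maximizers (g i) y := by
  classical
  refine ⟨fun h i j => ?_, fun h m' => ?_⟩
  · have hij := h (Function.update m i j)
    rw [sumFamily_update_apply] at hij
    linarith
  · rw [sumFamily_apply, sumFamily_apply]
    exact Finset.sum_le_sum fun i _ => h i (m' i)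

theorem IsPositivelySpanning.sum_pos (h : IsPositivelySpanning (sumFamily g)) {y : Y} (hy : y ≠ 0)
    {β : ι → J} (hβ : ∀ i, β i ∈ maximizers (g i) y) : 0 < ∑ i, g i (β i) y := by
  obtain ⟨m, hm⟩ := h y hy
  rw [← sumFamily_apply]
  exact hm.trans_le (mem_maximizers_sumFamily.2 hβ m)

theorem IsPositivelySpanning.eq_zero (h : IsPositivelySpanning (sumFamily g)) {u : Y}
    (hu : ∀ i j j', g i j u = g i j' u) : u = 0 := by
  by_contra hne
  obtain ⟨m, hm⟩ := h u hne
  obtain ⟨m', hm'⟩ := h (-u) (neg_ne_zero.2 hne)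
  have hmm' : sumFamily g m u = sumFamily g m' u := by
    rw [sumFamily_apply, sumFamily_apply]
    exact Finset.sum_congr rfl fun i _ => hu i _ _
  rw [map_neg] at hm'
  linarith

theorem exists_forall_mem_maximizers {ι : Type*} [Finite J] [Nonempty J] (g : ι → J → Y →ₗ[ℝ] ℝ)
    (y : Y) : ∃ β : ι → J, ∀ i, β i ∈ maximizers (g i) y :=
  Classical.skolem.1 fun i => maximizers_nonempty (g i) y

theorem maximizers_zero (f : J → Y →ₗ[ℝ] ℝ) : maximizers f 0 = Set.univ := by
  ext j
  simp [maximizers]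

theorem coneSpan_maximizerPairs_univ_zero (hg : IsPositivelySpanning (sumFamily g)) :
    coneSpan g (maximizerPairs g Finset.univ 0) = ⊥ := by
  rw [eq_bot_iff]
  intro u hu
  refine hg.eq_zero fun i j j' => hu i j j' ⟨Finset.mem_univ _, ?_⟩ ⟨Finset.mem_univ _, ?_⟩ <;>
    simp only [maximizers_zero, mem_univ]

theorem ncard_fanCones_univ_zero [FiniteDimensional ℝ Y]
    (hg : IsPositivelySpanning (sumFamily g)) : (fanCones g Finset.univ 0).ncard = 1 := by
  refine Set.ncard_eq_one.2 ⟨maximizerPairs g Finset.univ 0, Set.ext fun A => ⟨?_, ?_⟩⟩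
  · rintro ⟨y, rfl, hd⟩
    have hy := self_mem_coneSpan (g := g) Finset.univ y
    rw [Submodule.finrank_eq_zero.1 (Nat.cast_eq_zero.1 hd), Submodule.mem_bot] at hy
    rw [hy, mem_singleton_iff]
  · rintro rfl
    exact ⟨0, rfl, by rw [coneSpan_maximizerPairs_univ_zero hg, finrank_bot, Nat.cast_zero]⟩

theorem ncard_fanCones_of_neg {ι : Type*} {g : ι → J → Y →ₗ[ℝ] ℝ} (I : Finset ι) {d : ℤ}
    (hd : d < 0) : (fanCones g I d).ncard = 0 := by
  have hempty : fanCones g I d = ∅ := eq_empty_of_forall_notMem fun _ ⟨_, _, h⟩ => by omega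
  rw [hempty, Set.ncard_empty]

theorem eq_of_maximizerPairs_eq {ι : Type*} {g : ι → J → Y →ₗ[ℝ] ℝ} [Finite J] [Nonempty J]
    {I I' : Finset ι} {y y' : Y} (h : maximizerPairs g I y = maximizerPairs g I' y') : I = I' := by
  have hsub : ∀ {I I' : Finset ι} {y y' : Y}, maximizerPairs g I y = maximizerPairs g I' y' →
      I ⊆ I' := by
    intro I I' y y' h i hi
    obtain ⟨j, hj⟩ := maximizers_nonempty (g i) y
    have hij : (i, j) ∈ maximizerPairs g I' y' := h ▸ ⟨hi, hj⟩
    exact hij.1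
  exact (hsub h).antisymm (hsub h.symm)

end PositivelySpanning

/-- Affine coordinates that identify `E` with the product of the hyperplane `∑ cᵢ = 1` of `ι → ℝ`
and `Y`. They are used for `ℝⁿ` with the barycentric coordinates of a simplex, continued to `ℝⁿ`
along a complement, and the quotient by the direction of the simplex. -/
structure Frame (ι E Y : Type*) [AddCommGroup E] [Module ℝ E] [AddCommGroup Y] [Module ℝ Y]
    [Fintype ι] where
  /-- The coordinates in the hyperplane. -/
  bary : ι → E →ᵃ[ℝ] ℝ
  /-- The coordinate in `Y`. -/
  proj : E →ᵃ[ℝ] Y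
  sum_bary : ∀ x, ∑ i, bary i x = 1
  injective : ∀ {x x'}, (∀ i, bary i x = bary i x') → proj x = proj x' → x = x'
  surjective : ∀ (c : ι → ℝ) (y : Y), ∑ i, c i = 1 → ∃ x, (∀ i, bary i x = c i) ∧ proj x = y

namespace Frame

variable {E Y ι : Type*} [AddCommGroup E] [Module ℝ E] [AddCommGroup Y] [Module ℝ Y]
  [Fintype ι] (F : Frame ι E Y)

theorem sum_bary_linear (w : E) : ∑ i, (F.bary i).linear w = 0 := by
  have hw : ∀ i, (F.bary i).linear w = F.bary i w - F.bary i 0 := fun i => by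
    rw [← affineMap_linear_sub, sub_zero]
  simp only [hw, Finset.sum_sub_distrib, F.sum_bary, sub_self]

theorem eq_zero_of_homogenization_eq_zero {x w : E} {s : ℝ}
    (hbary : ∀ i, (F.bary i).linear w + s * F.bary i x = 0)
    (hproj : F.proj.linear w + s • F.proj x = 0) : w = 0 ∧ s = 0 := by
  have hs : s = 0 := by
    have hsum := Finset.sum_eq_zero (s := Finset.univ) fun i _ => hbary i
    rwa [Finset.sum_add_distrib, F.sum_bary_linear, ← Finset.mul_sum, F.sum_bary, zero_add,
      mul_one] at hsum
  subst hs
  simp only [zero_mul, zero_smul, add_zero] at hbary hproj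
  have hxw : x + (1 : ℝ) • w = x := F.injective
    (fun i => by rw [affineMap_add_smul, hbary i, smul_zero, add_zero])
    (by rw [affineMap_add_smul, hproj, smul_zero, add_zero])
  exact ⟨by simpa using hxw, rfl⟩

theorem exists_homogenization_eq (x : E) (c : ι → ℝ) (u : Y) :
    ∃ (w : E) (s : ℝ), (∀ i, (F.bary i).linear w + s * F.bary i x = c i) ∧
      F.proj.linear w + s • F.proj x = u := by
  obtain ⟨z, hz, hz'⟩ := F.surjective (fun i => F.bary i x + (c i - (∑ i, c i) * F.bary i x))
    (F.proj x + (u - (∑ i, c i) • F.proj x)) (by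
      simp only [Finset.sum_add_distrib, Finset.sum_sub_distrib, ← Finset.mul_sum, F.sum_bary,
        mul_one, sub_self, add_zero])
  refine ⟨z - x, ∑ i, c i, fun i => ?_, ?_⟩
  · rw [affineMap_linear_sub, hz]
    ring
  · rw [affineMap_linear_sub, hz']
    abel

/-- The linear map on `E × ℝ` that extends the coordinates with index outside `I` and the coordinate
in `Y`, both regarded as affine functions of `w` on the slice `x + w`. -/
def homogenization (I : Finset ι) (x : E) : E × ℝ →ₗ[ℝ] Y × ({i // i ∉ I} → ℝ) :=
  (F.proj.linear.prod (LinearMap.pi fun i : {i // i ∉ I} => (F.bary i).linear)).coprod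
    (LinearMap.toSpanSingleton ℝ _ (F.proj x, fun i => F.bary i x))

theorem homogenization_apply (I : Finset ι) (x w : E) (s : ℝ) :
    F.homogenization I x (w, s) = (F.proj.linear w + s • F.proj x,
      fun i : {i // i ∉ I} => (F.bary i).linear w + s * F.bary i x) :=
  rfl

end Frame

theorem finrank_submodule_prod {V W : Type*} [AddCommGroup V] [Module ℝ V] [AddCommGroup W]
    [Module ℝ W] [FiniteDimensional ℝ V] [FiniteDimensional ℝ W] (p : Submodule ℝ V)
    (q : Submodule ℝ W) : finrank ℝ (p.prod q) = finrank ℝ p + finrank ℝ q := by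
  have hinj : Function.Injective (p.subtype.prodMap q.subtype) :=
    p.injective_subtype.prodMap q.injective_subtype
  rw [← finrank_prod, ← LinearMap.finrank_range_of_inj hinj, LinearMap.range_prodMap,
    p.range_subtype, q.range_subtype]

section FanPolyhedra

variable {E Y ι J : Type*} [AddCommGroup E] [Module ℝ E] [AddCommGroup Y] [Module ℝ Y]
  [Fintype ι]

/-- The affine functions `cᵢ - gᵢⱼ(y)` in the coordinates `(c, y)` of a frame. -/
def fanConstraint (F : Frame ι E Y) (g : ι → J → Y →ₗ[ℝ] ℝ) (s : ι × J) : E →ᵃ[ℝ] ℝ :=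
  F.bary s.1 - (g s.1 s.2).toAffineMap.comp F.proj

/-- The polyhedron of all `(c, y)` with `cᵢ ≥ gᵢⱼ(y)` for all `i` and `j`, in the coordinates of a
frame. -/
def fanPolyhedron (F : Frame ι E Y) (g : ι → J → Y →ₗ[ℝ] ℝ) : Set E :=
  polyhedron (fanConstraint F g)

open Classical in
/-- The indices `i` for which one of the constraints `cᵢ ≥ gᵢⱼ(y)` is tight at `x`. -/
def tightIndices (F : Frame ι E Y) (g : ι → J → Y →ₗ[ℝ] ℝ) (x : E) : Finset ι :=
  Finset.univ.filter fun i => ∃ j, F.bary i x = g i j (F.proj x)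

variable {F : Frame ι E Y} {g : ι → J → Y →ₗ[ℝ] ℝ} {x : E}

theorem fanConstraint_apply (s : ι × J) (x : E) :
    fanConstraint F g s x = F.bary s.1 x - g s.1 s.2 (F.proj x) :=
  rfl

theorem fanConstraint_linear (s : ι × J) (w : E) :
    (fanConstraint F g s).linear w = (F.bary s.1).linear w - g s.1 s.2 (F.proj.linear w) :=
  rfl

theorem mem_fanPolyhedron : x ∈ fanPolyhedron F g ↔ ∀ i j, g i j (F.proj x) ≤ F.bary i x := by
  simp only [fanPolyhedron, polyhedron, mem_ofPred_eq, fanConstraint_apply, sub_nonneg,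
    Prod.forall]

theorem mem_tightIndices {i : ι} :
    i ∈ tightIndices F g x ↔ ∃ j, F.bary i x = g i j (F.proj x) := by
  simp only [tightIndices, Finset.mem_filter, Finset.mem_univ, true_and]

theorem mem_activeSet_fanConstraint {s : ι × J} :
    s ∈ activeSet (fanConstraint F g) x ↔ F.bary s.1 x = g s.1 s.2 (F.proj x) := by
  rw [activeSet, mem_ofPred_eq, fanConstraint_apply, sub_eq_zero]

theorem bary_eq_of_mem_tightIndices (hx : x ∈ fanPolyhedron F g) {i : ι}
    (hi : i ∈ tightIndices F g x) {j : J} (hj : j ∈ maximizers (g i) (F.proj x)) :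
    F.bary i x = g i j (F.proj x) := by
  obtain ⟨j', h⟩ := mem_tightIndices.1 hi
  exact le_antisymm (h.le.trans (hj j')) (mem_fanPolyhedron.1 hx i j)

theorem activeSet_fanConstraint (hx : x ∈ fanPolyhedron F g) :
    activeSet (fanConstraint F g) x = maximizerPairs g (tightIndices F g x) (F.proj x) := by
  ext ⟨i, j⟩
  rw [mem_activeSet_fanConstraint]
  refine ⟨fun h => ⟨mem_tightIndices.2 ⟨j, h⟩, fun j' => ?_⟩,
    fun h => bary_eq_of_mem_tightIndices hx h.1 h.2⟩
  exact (mem_fanPolyhedron.1 hx i j').trans h.le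

theorem proj_ne_zero_of_tightIndices_eq_univ (h : tightIndices F g x = Finset.univ) :
    F.proj x ≠ 0 := by
  intro h0
  refine zero_ne_one ((Finset.sum_eq_zero fun i _ => ?_).symm.trans (F.sum_bary x))
  obtain ⟨j, hj⟩ := mem_tightIndices.1 (h ▸ Finset.mem_univ i)
  rw [hj, h0, map_zero]

theorem tightIndices_ne_univ_or_proj_ne_zero (F : Frame ι E Y) (g : ι → J → Y →ₗ[ℝ] ℝ)
    (x : E) :
    tightIndices F g x ≠ Finset.univ ∨ F.proj x ≠ 0 :=
  or_iff_not_imp_left.2 fun h => proj_ne_zero_of_tightIndices_eq_univ (not_not.1 h)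

theorem sum_le_one_of_mem_fanPolyhedron (hx : x ∈ fanPolyhedron F g) (m : ι → J) :
    sumFamily g m (F.proj x) ≤ 1 := by
  rw [sumFamily_apply, ← F.sum_bary x]
  exact Finset.sum_le_sum fun i _ => mem_fanPolyhedron.1 hx i (m i)

theorem exists_slack {I : Finset ι} {G : ℝ} (h : I ≠ Finset.univ ∨ 0 < G) :
    ∃ s : ℝ, 0 < s ∧ ∃ d : ι → ℝ, (∀ i, 0 ≤ d i) ∧ (∀ i, d i = 0 ↔ i ∈ I) ∧
      s * G + ∑ i, d i = 1 := by
  classical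
  by_cases hI : I = Finset.univ
  · have hG : 0 < G := h.resolve_left (not_not.2 hI)
    exact ⟨1 / G, by positivity, 0, fun _ => le_rfl, by simp [hI], by simp [hG.ne']⟩
  · obtain ⟨s, hsG, hs⟩ :=
      ((eventually_pos_add_mul one_pos (-G)).and self_mem_nhdsWithin).exists
    have hcard : 0 < (Iᶜ.card : ℝ) := Nat.cast_pos.2
      (Finset.card_pos.2 (Finset.nonempty_iff_ne_empty.2 (Finset.compl_eq_empty_iff I |>.not.2 hI)))
    have hpos : 0 < (1 + s * -G) / Iᶜ.card := div_pos hsG hcard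
    refine ⟨s, hs, fun i => if i ∈ Iᶜ then (1 + s * -G) / Iᶜ.card else 0, fun i => ?_,
      fun i => ?_, ?_⟩
    · dsimp only
      split_ifs
      exacts [hpos.le, le_rfl]
    · simp only [ite_eq_right_iff, Finset.mem_compl]
      exact ⟨fun h' => by_contra fun hi => hpos.ne' (h' hi), fun hi h' => absurd hi h'⟩
    · rw [Finset.sum_ite_mem, Finset.univ_inter, Finset.sum_const, nsmul_eq_mul,
        mul_div_cancel₀ _ hcard.ne']
      ring

theorem mk_mem_linealitySpace_prod_top {w : E} {s : ℝ} :
    (w, s) ∈ (linealitySpace (fanConstraint F g) (activeSet (fanConstraint F g) x)).prod ⊤ ↔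
      ∀ i j, (i, j) ∈ activeSet (fanConstraint F g) x →
        (F.bary i).linear w + s * F.bary i x = g i j (F.proj.linear w + s • F.proj x) := by
  simp only [Submodule.mem_prod, Submodule.mem_top, and_true, mem_linealitySpace, Prod.forall]
  refine forall₂_congr fun i j => imp_congr_right fun hij => ?_
  rw [fanConstraint_linear, sub_eq_zero, map_add, map_smul, smul_eq_mul,
    ← mem_activeSet_fanConstraint.1 hij, add_left_inj]

theorem injective_homogenization_domRestrict :
    Function.Injective ((F.homogenization (tightIndices F g x) x).domRestrict
      ((linealitySpace (fanConstraint F g) (activeSet (fanConstraint F g) x)).prod ⊤)) := by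
  refine (injective_iff_map_eq_zero _).2 fun ⟨⟨w, s⟩, hws⟩ h => ?_
  have h := Prod.ext_iff.1 ((F.homogenization_apply _ x w s).symm.trans h)
  suffices hbary : ∀ i, (F.bary i).linear w + s * F.bary i x = 0 by
    obtain ⟨rfl, rfl⟩ := F.eq_zero_of_homogenization_eq_zero hbary h.1
    rfl
  intro i
  by_cases hi : i ∈ tightIndices F g x
  · obtain ⟨j, hj⟩ := mem_tightIndices.1 hi
    rw [mk_mem_linealitySpace_prod_top.1 hws i j (mem_activeSet_fanConstraint.2 hj),
      show F.proj.linear w + s • F.proj x = 0 from h.1, map_zero]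
  · exact congrFun h.2 ⟨i, hi⟩

variable [Finite J] [Nonempty J]

theorem exists_mem_fanPolyhedron_tightIndices_eq (F : Frame ι E Y)
    (hg : IsPositivelySpanning (sumFamily g)) {I : Finset ι} {y : Y}
    (h : I ≠ Finset.univ ∨ y ≠ 0) :
    ∃ x ∈ fanPolyhedron F g, tightIndices F g x = I ∧ ∃ s : ℝ, 0 < s ∧ F.proj x = s • y := by
  obtain ⟨β, hβ⟩ := exists_forall_mem_maximizers g y
  obtain ⟨s, hs, d, hd, hdI, hsum⟩ := exists_slack (h.imp_right fun hy => hg.sum_pos hy hβ)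
  obtain ⟨x, hx, hxy⟩ := F.surjective (fun i => s * g i (β i) y + d i) (s • y) (by
    rw [Finset.sum_add_distrib, ← Finset.mul_sum, hsum])
  have hle : ∀ i j, g i j (F.proj x) ≤ s * g i (β i) y := fun i j => by
    rw [hxy, map_smul, smul_eq_mul]
    exact mul_le_mul_of_nonneg_left (hβ i j) hs.le
  refine ⟨x, mem_fanPolyhedron.2 fun i j => ?_, ?_, s, hs, hxy⟩
  · rw [hx]
    linarith [hle i j, hd i]
  · ext i
    rw [mem_tightIndices, ← hdI]
    refine ⟨fun ⟨j, hj⟩ => ?_, fun hi => ⟨β i, ?_⟩⟩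
    · rw [hx] at hj
      linarith [hle i j, hd i]
    · rw [hx, hxy, map_smul, smul_eq_mul, hi, add_zero]

theorem exists_mem_fanPolyhedron_activeSet_eq (F : Frame ι E Y)
    (hg : IsPositivelySpanning (sumFamily g)) {I : Finset ι} {y : Y}
    (h : I ≠ Finset.univ ∨ y ≠ 0) :
    ∃ x ∈ fanPolyhedron F g, tightIndices F g x = I ∧
      activeSet (fanConstraint F g) x = maximizerPairs g I y := by
  obtain ⟨x, hx, hI, s, hs, hxy⟩ := exists_mem_fanPolyhedron_tightIndices_eq F hg h
  exact ⟨x, hx, hI, by rw [activeSet_fanConstraint hx, hI, hxy, maximizerPairs_smul hs]⟩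

theorem map_homogenization_linealitySpace_prod_top (hx : x ∈ fanPolyhedron F g) :
    ((linealitySpace (fanConstraint F g) (activeSet (fanConstraint F g) x)).prod ⊤).map
        (F.homogenization (tightIndices F g x) x) =
      (coneSpan g (activeSet (fanConstraint F g) x)).prod ⊤ := by
  classical
  set I := tightIndices F g x
  refine le_antisymm ?_ ?_
  · rintro _ ⟨⟨w, s⟩, hws, rfl⟩
    have hws := mk_mem_linealitySpace_prod_top.1 hws
    exact ⟨fun i j j' hj hj' => (hws i j hj).symm.trans (hws i j' hj'), trivial⟩
  · rintro ⟨u, c⟩ ⟨hu, -⟩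
    obtain ⟨β, hβ⟩ := exists_forall_mem_maximizers g (F.proj x)
    obtain ⟨w, s, hbary, hproj⟩ := F.exists_homogenization_eq x
      (fun i => if hi : i ∈ I then g i (β i) u else c ⟨i, hi⟩) u
    refine ⟨(w, s), mk_mem_linealitySpace_prod_top.2 fun i j hij => ?_, ?_⟩
    · have hi : i ∈ I := mem_tightIndices.2 ⟨j, mem_activeSet_fanConstraint.1 hij⟩
      have hβi : (i, β i) ∈ activeSet (fanConstraint F g) x := by
        rw [activeSet_fanConstraint hx]
        exact ⟨hi, hβ i⟩
      rw [hbary, hproj, dif_pos hi]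
      exact hu i (β i) j hβi hij
    · rw [F.homogenization_apply, hproj]
      exact Prod.ext rfl (funext fun i => (hbary i).trans (dif_neg i.2))

variable [FiniteDimensional ℝ E] [FiniteDimensional ℝ Y]

theorem finrank_linealitySpace_activeSet (hx : x ∈ fanPolyhedron F g) :
    finrank ℝ (linealitySpace (fanConstraint F g) (activeSet (fanConstraint F g) x)) + 1 +
        (tightIndices F g x).card =
      finrank ℝ (coneSpan g (activeSet (fanConstraint F g) x)) + Fintype.card ι := by
  classical
  have hfin := LinearMap.finrank_range_of_inj
    (injective_homogenization_domRestrict (F := F) (g := g) (x := x))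
  rw [LinearMap.range_domRestrict, map_homogenization_linealitySpace_prod_top hx,
    finrank_submodule_prod, finrank_submodule_prod, finrank_top, finrank_top, finrank_self,
    finrank_pi, Fintype.card_subtype_compl, Fintype.card_coe] at hfin
  have hle : (tightIndices F g x).card ≤ Fintype.card ι := Finset.card_le_univ _
  omega

theorem setOf_activeSet_fanConstraint_eq_iUnion (F : Frame ι E Y)
    (hg : IsPositivelySpanning (sumFamily g)) {d : ℤ} (hd : 0 ≤ d) :
    {A | ∃ x ∈ fanPolyhedron F g, activeSet (fanConstraint F g) x = A ∧
      (finrank ℝ (linealitySpace (fanConstraint F g) A) : ℤ) = d} =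
      ⋃ I : Finset ι, fanCones g I (d + 1 - Fintype.card ι + I.card) := by
  ext A
  rw [mem_iUnion]
  constructor
  · rintro ⟨x, hx, rfl, hfin⟩
    refine ⟨tightIndices F g x, F.proj x, activeSet_fanConstraint hx, ?_⟩
    have := finrank_linealitySpace_activeSet hx
    omega
  · rintro ⟨I, y, rfl, hfin⟩
    have hIy : I ≠ Finset.univ ∨ y ≠ 0 := by
      by_contra! hcon
      obtain ⟨rfl, rfl⟩ := hcon
      rw [coneSpan_maximizerPairs_univ_zero hg, finrank_bot, Finset.card_univ] at hfin
      omega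
    obtain ⟨x, hx, hI, hact⟩ := exists_mem_fanPolyhedron_activeSet_eq F hg hIy
    refine ⟨x, hx, hact, ?_⟩
    have := finrank_linealitySpace_activeSet hx
    rw [hact, hI] at this
    omega

theorem fVec_fanPolyhedron [TopologicalSpace E] [IsTopologicalAddGroup E] [ContinuousSMul ℝ E]
    [T2Space E] (F : Frame ι E Y) (hg : IsPositivelySpanning (sumFamily g)) (j : ℤ) :
    fVec (fanPolyhedron F g) j =
      ∑ I : Finset ι, (fanCones g I (j + 1 - Fintype.card ι + I.card)).ncard := by
  have hcard : ∀ I : Finset ι, I ≠ Finset.univ → I.card < Fintype.card ι := fun I hI =>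
    lt_of_le_of_ne (Finset.card_le_univ I) fun h => hI (Finset.card_eq_iff_eq_univ I |>.1 h)
  rcases lt_trichotomy j (-1) with hj | rfl | hj
  · rw [fVec_eq_zero_of_lt_neg_one _ hj, Finset.sum_eq_zero]
    intro I _
    have := Finset.card_le_univ I
    exact ncard_fanCones_of_neg I (by omega)
  · rw [fVec_neg_one, Finset.sum_eq_single_of_mem Finset.univ (Finset.mem_univ _) fun I _ hI =>
      ncard_fanCones_of_neg I (by have := hcard I hI; omega), Finset.card_univ,
      show (-1 : ℤ) + 1 - Fintype.card ι + Fintype.card ι = 0 by ring,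
      ncard_fanCones_univ_zero hg]
  · have hdisj : Pairwise (Function.onFun Disjoint
        fun I : Finset ι => fanCones g I (j + 1 - Fintype.card ι + I.card)) :=
      fun I I' hII' => Set.disjoint_left.2 fun A ⟨_, hA, _⟩ ⟨_, hA', _⟩ =>
        hII' (eq_of_maximizerPairs_eq (hA.symm.trans hA'))
    have hunion := setOf_activeSet_fanConstraint_eq_iUnion F hg (d := j) (by omega)
    rw [fanPolyhedron, fVec_polyhedron _ (by omega), ← finsum_eq_sum_of_fintype,
      ← Set.ncard_iUnion_of_finite (fun I => Set.toFinite _) hdisj, ← hunion]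
    rfl

end FanPolyhedra

section FanComparison

variable {Y ι ι' J J' : Type*} [AddCommGroup Y] [Module ℝ Y] {g : ι → J → Y →ₗ[ℝ] ℝ}

theorem ncard_fanCones_of_const {I : Finset ι}
    (h : ∀ i ∈ I, ∀ j j', g i j = g i j') (d : ℤ) :
    (fanCones g I d).ncard = if d = finrank ℝ Y then 1 else 0 := by
  have hpairs : ∀ y, maximizerPairs g I y = {s | s.1 ∈ I} := fun y =>
    Set.ext fun s => ⟨fun hs => hs.1, fun hs => ⟨hs, fun j' => (h s.1 hs j' s.2 ▸ le_rfl)⟩⟩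
  have htop : coneSpan g {s | s.1 ∈ I} = ⊤ :=
    eq_top_iff.2 fun u _ i j j' hi _ => by rw [h i hi j j']
  have hcones : fanCones g I d = {A | A = {s | s.1 ∈ I} ∧ d = finrank ℝ Y} := by
    ext A
    constructor
    · rintro ⟨y, rfl, hd⟩
      rw [hpairs, htop, finrank_top] at hd
      exact ⟨hpairs y, hd.symm⟩
    · rintro ⟨rfl, rfl⟩
      exact ⟨0, (hpairs 0).symm, by rw [htop, finrank_top]⟩
  rw [hcones]
  split_ifs with hd <;> simp [hd]

variable [Finite J] [Nonempty J]

theorem maximizerPairs_subset_iff {I K : Finset ι} {y z : Y} :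
    maximizerPairs g I y ⊆ maximizerPairs g K z ↔
      ∀ i ∈ I, i ∈ K ∧ maximizers (g i) y ⊆ maximizers (g i) z := by
  refine ⟨fun h i hi => ?_, fun h s hs => ⟨(h _ hs.1).1, (h _ hs.1).2 hs.2⟩⟩
  obtain ⟨j, hj⟩ := maximizers_nonempty (g i) y
  have hij : (i, j) ∈ maximizerPairs g K z := h ⟨hi, hj⟩
  refine ⟨hij.1, fun p hp => ?_⟩
  have hip : (i, p) ∈ maximizerPairs g K z := h ⟨hi, hp⟩
  exact hip.2

theorem mem_coneSpan_maximizerPairs_iff {I : Finset ι} {y u : Y} :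
    u ∈ coneSpan g (maximizerPairs g I y) ↔
      ∃ t : ℝ, 0 < t ∧ maximizerPairs g I y ⊆ maximizerPairs g I (y + t • u) := by
  constructor
  · intro hu
    obtain ⟨t, ht, htpos⟩ := (((Filter.eventually_all_finset I).2 fun i _ =>
      eventually_maximizers_add (g i) y u).and self_mem_nhdsWithin).exists
    refine ⟨t, htpos, maximizerPairs_subset_iff.2 fun i hi => ⟨hi, ?_⟩⟩
    rw [ht i hi, directionalMaximizers_eq_maximizers fun j hj j' hj' =>
      hu i j j' ⟨hi, hj⟩ ⟨hi, hj'⟩]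
  · rintro ⟨t, htpos, ht⟩ i j j' hj hj'
    have hval := eq_of_mem_maximizers (ht hj).2 (ht hj').2
    simp only [map_add, map_smul, smul_eq_mul, eq_of_mem_maximizers hj.2 hj'.2] at hval
    exact mul_left_cancel₀ htpos.ne' (add_left_cancel hval)

/-- The span of a cone is determined by which of its points lie in the closure of which cone. -/
theorem ncard_fanCones_congr [Nonempty J'] [Finite J'] {g' : ι' → J' → Y →ₗ[ℝ] ℝ} {I : Finset ι}
    {I' : Finset ι'} (h : ∀ y z, maximizerPairs g I y ⊆ maximizerPairs g I z ↔
      maximizerPairs g' I' y ⊆ maximizerPairs g' I' z) (d : ℤ) :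
    (fanCones g I d).ncard = (fanCones g' I' d).ncard := by
  have heq : ∀ y z, maximizerPairs g I y = maximizerPairs g I z ↔
      maximizerPairs g' I' y = maximizerPairs g' I' z := fun y z => by
    rw [Subset.antisymm_iff, h, h, ← Subset.antisymm_iff]
  have hspan : ∀ y, coneSpan g (maximizerPairs g I y) = coneSpan g' (maximizerPairs g' I' y) :=
    fun y => by
      ext u
      simp only [mem_coneSpan_maximizerPairs_iff, h]
  refine Set.ncard_congr (fun A hA => maximizerPairs g' I' hA.choose) ?_ ?_ ?_
  · intro A hA
    refine ⟨_, rfl, ?_⟩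
    rw [← hspan, ← hA.choose_spec.1, hA.choose_spec.2]
  · intro A B hA hB hAB
    rw [hA.choose_spec.1, hB.choose_spec.1]
    exact (heq _ _).2 hAB
  · rintro B ⟨y, rfl, hd⟩
    have hA : maximizerPairs g I y ∈ fanCones g I d := ⟨y, rfl, by rw [hspan, hd]⟩
    exact ⟨_, hA, ((heq _ _).1 hA.choose_spec.1).symm⟩

end FanComparison

section ScaledFamilies

variable {Y ι J M M' : Type*} [AddCommGroup Y] [Module ℝ Y]

/-- The families of all multiples `rᵢ • h` of the members of a single family. -/
def scaledFamily (r : ι → ℝ) (h : M → Y →ₗ[ℝ] ℝ) : ι → M → Y →ₗ[ℝ] ℝ := fun i m => r i • h m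

/-- The number of `d`-dimensional cones in the normal fan of a single family. -/
def numCones (h : M → Y →ₗ[ℝ] ℝ) (d : ℤ) : ℕ :=
  (fanCones (fun _ : Unit => h) Finset.univ d).ncard

theorem maximizers_scaledFamily_of_pos {r : ι → ℝ} {i : ι} (hr : 0 < r i) (h : M → Y →ₗ[ℝ] ℝ)
    (y : Y) : maximizers (scaledFamily r h i) y = maximizers h y := by
  ext m
  simp [maximizers, scaledFamily, hr]

theorem maximizers_scaledFamily_of_eq_zero {r : ι → ℝ} {i : ι} (hr : r i = 0)
    (h : M → Y →ₗ[ℝ] ℝ) (y : Y) : maximizers (scaledFamily r h i) y = Set.univ := by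
  ext m
  simp [maximizers, scaledFamily, hr]

theorem numCones_of_finrank_lt [FiniteDimensional ℝ Y] (h : M → Y →ₗ[ℝ] ℝ) {d : ℤ}
    (hd : (finrank ℝ Y : ℤ) < d) : numCones h d = 0 := by
  have hempty : fanCones (fun _ : Unit => h) Finset.univ d = ∅ :=
    eq_empty_of_forall_notMem fun A ⟨_, _, hA⟩ => by
      have := Submodule.finrank_le (coneSpan (fun _ : Unit => h) A)
      omega
  rw [numCones, hempty, Set.ncard_empty]

theorem exists_pos_of_sum_eq_one [Fintype ι] {r : ι → ℝ} (hsum : ∑ i, r i = 1) : ∃ i, 0 < r i := by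
  obtain ⟨i, -, hi⟩ : ∃ i ∈ Finset.univ, 0 < r i :=
    Finset.exists_lt_of_sum_lt (f := fun _ => (0 : ℝ)) (by rw [hsum]; simp)
  exact ⟨i, hi⟩

variable [Finite M] [Nonempty M]

theorem ncard_fanCones_scaledFamily {r : ι → ℝ} (hr : ∀ i, 0 ≤ r i) (h : M → Y →ₗ[ℝ] ℝ)
    {I : Finset ι} (hI : ∃ i ∈ I, 0 < r i) (d : ℤ) :
    (fanCones (scaledFamily r h) I d).ncard = numCones h d := by
  refine ncard_fanCones_congr (fun y z => ?_) d
  obtain ⟨i, hi, hpos⟩ := hI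
  rw [maximizerPairs_subset_iff, maximizerPairs_subset_iff]
  refine ⟨fun hyz _ _ => ⟨Finset.mem_univ _, ?_⟩, fun hyz l hl => ⟨hl, ?_⟩⟩
  · have := (hyz i hi).2
    rwa [maximizers_scaledFamily_of_pos hpos, maximizers_scaledFamily_of_pos hpos] at this
  · rcases (hr l).eq_or_lt with hl | hl
    · rw [maximizers_scaledFamily_of_eq_zero hl.symm, maximizers_scaledFamily_of_eq_zero hl.symm]
    · rw [maximizers_scaledFamily_of_pos hl, maximizers_scaledFamily_of_pos hl]
      exact (hyz () (Finset.mem_univ _)).2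

theorem ncard_fanCones_scaledFamily_le [Finite M'] [Nonempty M'] [Fintype ι] {h : M → Y →ₗ[ℝ] ℝ}
    {h' : M' → Y →ₗ[ℝ] ℝ} {r r' : ι → ℝ} (hr : ∀ i, 0 ≤ r i) (hsum : ∑ i, r i = 1)
    (hr' : ∀ i, 0 < r' i) (hh : ∀ d, numCones h d = numCones h' d) (I : Finset ι) (d : ℤ) :
    (fanCones (scaledFamily r h) I d).ncard ≤ (fanCones (scaledFamily r' h') I d).ncard := by
  rcases I.eq_empty_or_nonempty with rfl | ⟨i, hi⟩
  · rw [ncard_fanCones_of_const (by simp), ncard_fanCones_of_const (by simp)]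
  · obtain ⟨l, hl⟩ := exists_pos_of_sum_eq_one hsum
    rw [ncard_fanCones_scaledFamily (fun i => (hr' i).le) _ ⟨i, hi, hr' i⟩, ← hh,
      ← ncard_fanCones_scaledFamily hr h ⟨l, Finset.mem_univ l, hl⟩]
    exact ncard_fanCones_le I d

variable [Fintype ι] [Finite J] [Nonempty J] {g : ι → J → Y →ₗ[ℝ] ℝ}

theorem maximizers_sumFamily_subset_iff {y z : Y} :
    maximizers (sumFamily g) y ⊆ maximizers (sumFamily g) z ↔
      ∀ i, maximizers (g i) y ⊆ maximizers (g i) z := by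
  classical
  refine ⟨fun h i j hj => ?_, fun h m hm => ?_⟩
  · obtain ⟨β, hβ⟩ := exists_forall_mem_maximizers g y
    have hmem : Function.update β i j ∈ maximizers (sumFamily g) y := by
      refine mem_maximizers_sumFamily.2 fun l => ?_
      by_cases hl : l = i
      · subst hl
        rwa [Function.update_self]
      · rw [Function.update_of_ne hl]
        exact hβ l
    simpa using mem_maximizers_sumFamily.1 (h hmem) i
  · exact mem_maximizers_sumFamily.2 fun i => h i (mem_maximizers_sumFamily.1 hm i)

theorem ncard_fanCones_univ_eq_numCones (g : ι → J → Y →ₗ[ℝ] ℝ) (d : ℤ) :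
    (fanCones g Finset.univ d).ncard = numCones (sumFamily g) d := by
  refine ncard_fanCones_congr (fun y z => ?_) d
  simp only [maximizerPairs_subset_iff, Finset.mem_univ, true_and, forall_const,
    maximizers_sumFamily_subset_iff]

theorem ncard_fanCones_le_scaledFamily {r : ι → ℝ} (hr : ∀ i, 0 ≤ r i)
    (hrg : ∀ i, r i = 0 → ∀ j j', g i j = g i j') (I : Finset ι) (d : ℤ) :
    (fanCones g I d).ncard ≤ (fanCones (scaledFamily r (sumFamily g)) I d).ncard := by
  by_cases hI : ∃ i ∈ I, 0 < r i
  · rw [ncard_fanCones_scaledFamily hr _ hI, ← ncard_fanCones_univ_eq_numCones]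
    exact ncard_fanCones_le I d
  · push Not at hI
    have hzero : ∀ i ∈ I, r i = 0 := fun i hi => le_antisymm (hI i hi) (hr i)
    rw [ncard_fanCones_of_const fun i hi => hrg i (hzero i hi),
      ncard_fanCones_of_const fun i hi m m' => by simp only [scaledFamily, hzero i hi, zero_smul]]

end ScaledFamilies

section ScaledPolyhedra

variable {E Y ι J M : Type*} [AddCommGroup E] [Module ℝ E] [AddCommGroup Y] [Module ℝ Y]

theorem IsPositivelySpanning.sumFamily_scaledFamily [Fintype ι] {r : ι → ℝ} (hsum : ∑ i, r i = 1)
    {h : M → Y →ₗ[ℝ] ℝ} (hh : IsPositivelySpanning h) :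
    IsPositivelySpanning (sumFamily (scaledFamily r h)) := by
  intro y hy
  obtain ⟨m, hm⟩ := hh y hy
  refine ⟨fun _ => m, ?_⟩
  simp only [sumFamily_apply, scaledFamily, LinearMap.smul_apply, smul_eq_mul]
  rwa [← Finset.sum_mul, hsum, one_mul]

theorem IsPositivelySpanning.sumFamily_unit {h : M → Y →ₗ[ℝ] ℝ} (hh : IsPositivelySpanning h) :
    IsPositivelySpanning (sumFamily fun _ : Unit => h) := fun y hy =>
  (hh y hy).imp' (fun m _ => m) fun m hm => by simpa [sumFamily_apply] using hm

theorem fVec_fanPolyhedron_unit [TopologicalSpace E] [IsTopologicalAddGroup E]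
    [ContinuousSMul ℝ E] [T2Space E] [FiniteDimensional ℝ E] [FiniteDimensional ℝ Y] [Finite M]
    [Nonempty M] (F : Frame Unit E Y) {h : M → Y →ₗ[ℝ] ℝ} (hh : IsPositivelySpanning h) (j : ℤ) :
    fVec (fanPolyhedron F fun _ : Unit => h) j =
      (if j = finrank ℝ Y then 1 else 0) + numCones h (j + 1) := by
  rw [fVec_fanPolyhedron F hh.sumFamily_unit, show (Finset.univ : Finset (Finset Unit)) =
    {∅, Finset.univ} from rfl, Finset.sum_pair (by decide), ncard_fanCones_of_const (by simp)]
  simp [numCones]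

variable [Fintype ι] [Finite J] [Nonempty J] {g : ι → J → Y →ₗ[ℝ] ℝ} {r : ι → ℝ}

theorem maximizerPairs_subset_iff_scaledFamily (hr : ∀ i, 0 ≤ r i)
    (hrg : ∀ i, r i = 0 → ∀ j j', g i j = g i j')
    (h : ∀ i, 0 < r i → ∀ y z, maximizers (g i) y ⊆ maximizers (g i) z →
      ∀ l, maximizers (g l) y ⊆ maximizers (g l) z) {I K : Finset ι} {y z : Y} :
    maximizerPairs g I y ⊆ maximizerPairs g K z ↔
      maximizerPairs (scaledFamily r (sumFamily g)) I y ⊆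
        maximizerPairs (scaledFamily r (sumFamily g)) K z := by
  rw [maximizerPairs_subset_iff, maximizerPairs_subset_iff]
  refine forall₂_congr fun i _ => and_congr_right fun _ => ?_
  rcases (hr i).eq_or_lt with hi | hi
  · rw [maximizers_scaledFamily_of_eq_zero hi.symm, maximizers_scaledFamily_of_eq_zero hi.symm]
    exact iff_of_true (fun j _ j' => hrg i hi.symm j' j ▸ le_rfl) subset_rfl
  · rw [maximizers_scaledFamily_of_pos hi, maximizers_scaledFamily_of_pos hi,
      maximizers_sumFamily_subset_iff]
    exact ⟨h i hi y z, fun hall => hall i⟩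

variable [TopologicalSpace E] [IsTopologicalAddGroup E] [ContinuousSMul ℝ E] [T2Space E]
  [FiniteDimensional ℝ E] (F : Frame ι E Y) (hg : IsPositivelySpanning (sumFamily g))
  (hr : ∀ i, 0 ≤ r i) (hsum : ∑ i, r i = 1) (hrg : ∀ i, r i = 0 → ∀ j j', g i j = g i j')

include hg hr hsum hrg

theorem combEquiv_fanPolyhedron_scaledFamily
    (h : ∀ i, 0 < r i → ∀ y z, maximizers (g i) y ⊆ maximizers (g i) z →
      ∀ l, maximizers (g l) y ⊆ maximizers (g l) z) :
    CombEquiv (fanPolyhedron F g) (fanPolyhedron F (scaledFamily r (sumFamily g))) := by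
  set g' := scaledFamily r (sumFamily g)
  have hg' : IsPositivelySpanning (sumFamily g') := hg.sumFamily_scaledFamily hsum
  refine combEquiv_polyhedron (fun x x' => ∃ I y,
    activeSet (fanConstraint F g) x = maximizerPairs g I y ∧
      activeSet (fanConstraint F g') x' = maximizerPairs g' I y) ⟨fun x => ?_, fun x => ?_⟩ ?_
  · obtain ⟨x', hx', -, hact⟩ := exists_mem_fanPolyhedron_activeSet_eq F hg'
      (tightIndices_ne_univ_or_proj_ne_zero F g x)
    exact ⟨⟨x', hx'⟩, _, _, activeSet_fanConstraint x.2, hact⟩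
  · obtain ⟨x', hx', -, hact⟩ := exists_mem_fanPolyhedron_activeSet_eq F hg
      (tightIndices_ne_univ_or_proj_ne_zero F g' x)
    exact ⟨⟨x', hx'⟩, _, _, hact, activeSet_fanConstraint x.2⟩
  · rintro x x' z z' ⟨I, y, hx, hx'⟩ ⟨K, w, hz, hz'⟩
    rw [hx, hx', hz, hz']
    exact maximizerPairs_subset_iff_scaledFamily hr hrg h

end ScaledPolyhedra

section FVectorComparison

variable {Y ι J J' : Type*} [AddCommGroup Y] [Module ℝ Y] [FiniteDimensional ℝ Y]
  [Fintype ι] [Finite J'] {g : ι → J → Y →ₗ[ℝ] ℝ} {g' : ι → J' → Y →ₗ[ℝ] ℝ}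

theorem ncard_fanCones_compl_singleton_zero_eq [DecidableEq ι]
    (hg' : IsPositivelySpanning (sumFamily g'))
    (hle : ∀ I d, (fanCones g I d).ncard ≤ (fanCones g' I d).ncard) {i : ι}
    (hone : 0 < (fanCones g {i}ᶜ 0).ncard) :
    (fanCones g {i}ᶜ 0).ncard = (fanCones g' {i}ᶜ 0).ncard := by
  have hone' : (fanCones g' {i}ᶜ 0).ncard ≤ 1 :=
    (ncard_fanCones_le {i}ᶜ 0).trans (ncard_fanCones_univ_zero hg').le
  exact (hle _ _).antisymm (hone'.trans hone)

variable [Nonempty J'] [Finite J] [Nonempty J] {E E' : Type*}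
  [AddCommGroup E] [Module ℝ E] [TopologicalSpace E] [IsTopologicalAddGroup E]
  [ContinuousSMul ℝ E] [T2Space E] [FiniteDimensional ℝ E]
  [AddCommGroup E'] [Module ℝ E'] [TopologicalSpace E'] [IsTopologicalAddGroup E']
  [ContinuousSMul ℝ E'] [T2Space E'] [FiniteDimensional ℝ E']
  (F : Frame ι E Y) (F' : Frame ι E' Y) (hg : IsPositivelySpanning (sumFamily g))
  (hg' : IsPositivelySpanning (sumFamily g'))
  (hle : ∀ I d, (fanCones g I d).ncard ≤ (fanCones g' I d).ncard)

include hg hg' hle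

theorem fVec_fanPolyhedron_le_of_ncard_fanCones_le (j : ℤ) :
    fVec (fanPolyhedron F g) j ≤ fVec (fanPolyhedron F' g') j := by
  rw [fVec_fanPolyhedron F hg, fVec_fanPolyhedron F' hg']
  exact Finset.sum_le_sum fun I _ => hle I _

theorem fVec_fanPolyhedron_zero_eq_of_ncard_fanCones_le [DecidableEq ι]
    (huniv : ∀ d, (fanCones g Finset.univ d).ncard = (fanCones g' Finset.univ d).ncard)
    (hone : ∀ i, 0 < (fanCones g {i}ᶜ 0).ncard) :
    fVec (fanPolyhedron F g) 0 = fVec (fanPolyhedron F' g') 0 := by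
  rw [fVec_fanPolyhedron F hg, fVec_fanPolyhedron F' hg']
  refine Finset.sum_congr rfl fun I _ => ?_
  by_cases hI : I = Finset.univ
  · rw [hI, huniv]
  have hlt : I.card < Fintype.card ι := (Finset.card_lt_iff_ne_univ I).2 hI
  by_cases hcard : I.card + 1 = Fintype.card ι
  · obtain ⟨i, hi⟩ := Finset.card_eq_one.1 (show Iᶜ.card = 1 by rw [Finset.card_compl]; omega)
    obtain rfl : I = {i}ᶜ := by rw [← hi, compl_compl]
    rw [show (0 + 1 - Fintype.card ι + ({i}ᶜ : Finset ι).card : ℤ) = 0 by omega]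
    exact ncard_fanCones_compl_singleton_zero_eq hg' hle (hone i)
  · rw [ncard_fanCones_of_neg I (by omega), ncard_fanCones_of_neg I (by omega)]

end FVectorComparison

section StrictComparison

variable {Y ι J : Type*} [AddCommGroup Y] [Module ℝ Y] [FiniteDimensional ℝ Y]
  [Fintype ι] [Finite J] [Nonempty J] {g : ι → J → Y →ₗ[ℝ] ℝ}

theorem ncard_fanCones_singleton_lt_of_maximizers_subset {i l : ι} {y z : Y}
    (hi : maximizers (g i) y ⊆ maximizers (g i) z)
    (hl : ¬ maximizers (g l) y ⊆ maximizers (g l) z) {d : ℤ}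
    (hd : d = finrank ℝ Y ∨ d = finrank ℝ Y - 1) :
    (fanCones g {i} d).ncard < (fanCones g Finset.univ d).ncard := by
  obtain ⟨t, hti, htl⟩ :=
    ((eventually_maximizers_add (g i) z y).and (eventually_maximizers_add (g l) z y)).exists
  refine ncard_fanCones_singleton_lt (y := y) (y' := z + t • y) (i := i) (l := l) ?_ ?_ hd
  · rw [hti]
    obtain ⟨q, hq⟩ := maximizers_nonempty (g i) y
    exact Subset.antisymm (fun p hp => ⟨hi hp, fun q' _ => hp q'⟩)
      fun p hp => mem_maximizers_of_le hq (hp.2 q (hi hq))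
  · rw [htl]
    exact fun h => hl fun p hp => (h hp).1

variable {E : Type*} [AddCommGroup E] [Module ℝ E] [TopologicalSpace E] [IsTopologicalAddGroup E]
  [ContinuousSMul ℝ E] [T2Space E] [FiniteDimensional ℝ E] {r : ι → ℝ}

theorem fVec_fanPolyhedron_lt_scaledFamily (F : Frame ι E Y)
    (hg : IsPositivelySpanning (sumFamily g)) (hr : ∀ i, 0 ≤ r i) (hsum : ∑ i, r i = 1)
    (hrg : ∀ i, r i = 0 → ∀ j j', g i j = g i j')
    (hnot : ¬ CombEquiv (fanPolyhedron F g) (fanPolyhedron F (scaledFamily r (sumFamily g))))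
    {j : ℤ} (hj : j + 2 - Fintype.card ι = finrank ℝ Y ∨
      j + 2 - Fintype.card ι = finrank ℝ Y - 1) :
    fVec (fanPolyhedron F g) j < fVec (fanPolyhedron F (scaledFamily r (sumFamily g))) j := by
  have hcoarser := mt (combEquiv_fanPolyhedron_scaledFamily F hg hr hsum hrg) hnot
  push Not at hcoarser
  obtain ⟨i, hi, y, z, hyz, l, hl⟩ := hcoarser
  rw [fVec_fanPolyhedron F hg, fVec_fanPolyhedron F (hg.sumFamily_scaledFamily hsum)]
  refine Finset.sum_lt_sum (fun I _ => ncard_fanCones_le_scaledFamily hr hrg I _)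
    ⟨{i}, Finset.mem_univ _, ?_⟩
  rw [ncard_fanCones_scaledFamily hr _ ⟨i, Finset.mem_singleton_self i, hi⟩,
    ← ncard_fanCones_univ_eq_numCones]
  refine ncard_fanCones_singleton_lt_of_maximizers_subset hyz hl ?_
  rw [Finset.card_singleton]
  omega

end StrictComparison

section FacetRepresentation

variable {E : Type*} [NormedAddCommGroup E] [NormedSpace ℝ E]

/-- The polar dual, with respect to the base point `x₀`, of the convex hull of `s`. -/
def dualBody (s : Set E) (x₀ : E) : Set (StrongDual ℝ E) := {l | ∀ v ∈ s, l (v - x₀) ≤ 1}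

/-- The constraint `0 ≤ 1 - l (x - x₀)` given by a point `l` of a dual body. -/
def dualConstraint (x₀ : E) (l : StrongDual ℝ E) : E →ᵃ[ℝ] ℝ :=
  AffineMap.const ℝ E 1 -
    l.toLinearMap.toAffineMap.comp (AffineMap.id ℝ E - AffineMap.const ℝ E x₀)

@[simp]
theorem dualConstraint_apply (x₀ : E) (l : StrongDual ℝ E) (x : E) :
    dualConstraint x₀ l x = 1 - l (x - x₀) :=
  rfl

variable {s : Set E} {x₀ : E}

theorem convex_dualBody (s : Set E) (x₀ : E) : Convex ℝ (dualBody s x₀) := by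
  intro l hl l' hl' a b ha hb hab v hv
  calc a * l (v - x₀) + b * l' (v - x₀) ≤ a * 1 + b * 1 := by
        gcongr
        exacts [hl v hv, hl' v hv]
    _ = 1 := by rw [mul_one, mul_one, hab]

theorem eventually_add_smul_mem_dualBody (hs : s.Finite) {l w : StrongDual ℝ E}
    (hl : l ∈ dualBody s x₀) (hw : ∀ v ∈ s, l (v - x₀) = 1 → w (v - x₀) = 0) :
    ∀ᶠ t in 𝓝[>] (0 : ℝ), l + t • w ∈ dualBody s x₀ := by
  refine (eventually_all_finite hs).2 fun v hv => ?_
  simp only [_root_.add_apply, _root_.smul_apply, smul_eq_mul]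
  rcases (hl v hv).eq_or_lt with htight | hlt
  · exact Eventually.of_forall fun t => by rw [hw v hv htight, mul_zero, add_zero, htight]
  · filter_upwards [eventually_pos_add_mul (sub_pos.2 hlt) (-(w (v - x₀)))] with t ht
    linarith

theorem eq_zero_of_mem_extremePoints_dualBody (hs : s.Finite) {l w : StrongDual ℝ E}
    (hl : l ∈ (dualBody s x₀).extremePoints ℝ)
    (hw : ∀ v ∈ s, l (v - x₀) = 1 → w (v - x₀) = 0) : w = 0 := by
  obtain ⟨t, ⟨hadd, hsub⟩, htpos⟩ := (((eventually_add_smul_mem_dualBody hs hl.1 hw).and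
    (eventually_add_smul_mem_dualBody hs hl.1 (w := -w) fun v hv h => by
      rw [_root_.neg_apply, hw v hv h, neg_zero])).and self_mem_nhdsWithin).exists
  have heq : l + t • w = l := hl.2 hadd hsub
    ⟨1 / 2, 1 / 2, by norm_num, by norm_num, by norm_num, by module⟩
  exact (smul_eq_zero.1 (add_eq_left.1 heq)).resolve_left (ne_of_gt htpos)

theorem finite_extremePoints_dualBody (hs : s.Finite) (x₀ : E) :
    ((dualBody s x₀).extremePoints ℝ).Finite := by
  refine Set.Finite.of_finite_image (f := fun l => {v | v ∈ s ∧ l (v - x₀) = 1})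
    (hs.finite_subsets.subset ?_) fun l hl l' _ htight => ?_
  · rintro _ ⟨l, -, rfl⟩ v hv
    exact hv.1
  · refine sub_eq_zero.1 (eq_zero_of_mem_extremePoints_dualBody hs hl fun v hv hlv => ?_)
    have hlv' : l' (v - x₀) = 1 := ((Set.ext_iff.1 htight v).1 ⟨hv, hlv⟩).2
    rw [_root_.sub_apply, hlv, hlv', sub_self]

theorem le_one_of_mem_convexHull {l : StrongDual ℝ E} (hl : l ∈ dualBody s x₀) {y : E}
    (hy : y ∈ convexHull ℝ s) : l (y - x₀) ≤ 1 := by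
  have hconv : Convex ℝ {y | l (y - x₀) ≤ 1} := by
    simp only [map_sub, sub_le_iff_le_add]
    exact convex_halfSpace_le l.toLinearMap.isLinear _
  exact convexHull_min (t := {y | l (y - x₀) ≤ 1}) hl hconv hy

theorem norm_le_of_mem_dualBody {l : StrongDual ℝ E} (hl : l ∈ dualBody s x₀) {ε : ℝ} (hε : 0 < ε)
    (hball : Metric.closedBall x₀ ε ⊆ convexHull ℝ s) : ‖l‖ ≤ 1 / ε := by
  have hle : ∀ u : E, ‖u‖ ≤ ε → l u ≤ 1 := fun u hu => by
    simpa using le_one_of_mem_convexHull hl (hball (show x₀ + u ∈ _ by simpa using hu))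
  refine l.opNorm_bound_of_ball_bound hε 1 fun u hu => ?_
  have hu : ‖u‖ ≤ ε := mem_closedBall_zero_iff.1 hu
  exact abs_le'.2 ⟨hle u hu, map_neg l u ▸ hle (-u) (by rwa [norm_neg])⟩

theorem isCompact_dualBody [FiniteDimensional ℝ E] (hx₀ : x₀ ∈ interior (convexHull ℝ s)) :
    IsCompact (dualBody s x₀) := by
  have : ProperSpace (StrongDual ℝ E) := FiniteDimensional.proper ℝ _
  obtain ⟨ε, hε, hball⟩ := Metric.nhds_basis_closedBall.mem_iff.1 (mem_interior_iff_mem_nhds.1 hx₀)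
  refine Metric.isCompact_of_isClosed_isBounded ?_ ?_
  · simp only [dualBody, ofPred_forall]
    exact isClosed_biInter fun v _ => isClosed_le (by fun_prop) continuous_const
  · exact Metric.isBounded_closedBall.subset fun l hl =>
      mem_closedBall_zero_iff.2 (norm_le_of_mem_dualBody hl hε hball)

theorem convexHull_extremePoints_dualBody [FiniteDimensional ℝ E] (hs : s.Finite)
    (hx₀ : x₀ ∈ interior (convexHull ℝ s)) :
    convexHull ℝ ((dualBody s x₀).extremePoints ℝ) = dualBody s x₀ := by
  rw [← ((finite_extremePoints_dualBody hs x₀).isCompact_convexHull ℝ).isClosed.closure_eq]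
  exact closure_convexHull_extremePoints (isCompact_dualBody hx₀) (convex_dualBody s x₀)

theorem mem_convexHull_of_forall_mem_dualBody [FiniteDimensional ℝ E] (hs : s.Finite)
    (hx₀ : x₀ ∈ convexHull ℝ s) {x : E} (hx : ∀ l ∈ dualBody s x₀, l (x - x₀) ≤ 1) :
    x ∈ convexHull ℝ s := by
  by_contra hxs
  obtain ⟨f, u, hf, hu⟩ := geometric_hahn_banach_closed_point (convex_convexHull ℝ s)
    (hs.isCompact_convexHull ℝ).isClosed hxs
  have hpos : 0 < u - f x₀ := sub_pos.2 (hf x₀ hx₀)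
  have hle_iff : ∀ y, ((u - f x₀)⁻¹ • f) (y - x₀) ≤ 1 ↔ f y ≤ u := fun y => by
    rw [_root_.smul_apply, map_sub, smul_eq_mul, inv_mul_le_one₀ hpos, sub_le_sub_iff_right]
  have hmem : (u - f x₀)⁻¹ • f ∈ dualBody s x₀ := fun v hv =>
    (hle_iff v).2 (hf v (subset_convexHull ℝ s hv)).le
  exact ((hle_iff x).1 (hx _ hmem)).not_gt hu

theorem convexHull_eq_polyhedron_dualConstraint [FiniteDimensional ℝ E] (hs : s.Finite)
    (hx₀ : x₀ ∈ interior (convexHull ℝ s)) :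
    convexHull ℝ s =
      polyhedron fun l : (dualBody s x₀).extremePoints ℝ => dualConstraint x₀ l := by
  ext x
  refine ⟨fun hx l => sub_nonneg.2 (le_one_of_mem_convexHull l.2.1 hx), fun hx => ?_⟩
  refine mem_convexHull_of_forall_mem_dualBody hs (interior_subset hx₀) fun l hl => ?_
  rw [← convexHull_extremePoints_dualBody hs hx₀] at hl
  have hconv : Convex ℝ {l : StrongDual ℝ E | l (x - x₀) ≤ 1} := by
    simpa only [dualBody, forall_eq, mem_singleton_iff] using convex_dualBody {x} x₀
  exact convexHull_min (t := {l : StrongDual ℝ E | l (x - x₀) ≤ 1})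
    (fun l hl => sub_nonneg.1 (hx ⟨l, hl⟩)) hconv hl

variable [FiniteDimensional ℝ E] {l : StrongDual ℝ E}

theorem span_tight_eq_top_of_mem_extremePoints_dualBody (hs : s.Finite)
    (hl : l ∈ (dualBody s x₀).extremePoints ℝ) :
    Submodule.span ℝ ((fun v => v - x₀) '' {v | v ∈ s ∧ l (v - x₀) = 1}) = ⊤ := by
  by_contra hne
  obtain ⟨f, hf, hker⟩ := Submodule.exists_le_ker_of_lt_top _ (lt_top_iff_ne_top.2 hne)
  have hzero := eq_zero_of_mem_extremePoints_dualBody hs hl (w := f.toContinuousLinearMap)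
    fun v hv hlv => hker (Submodule.subset_span ⟨v, ⟨hv, hlv⟩, rfl⟩)
  exact hf (by simpa using hzero)

theorem exists_tight_of_mem_extremePoints_dualBody [Nontrivial E] (hs : s.Finite)
    (hl : l ∈ (dualBody s x₀).extremePoints ℝ) : ∃ v ∈ s, l (v - x₀) = 1 := by
  by_contra! hlt
  have hempty : {v | v ∈ s ∧ l (v - x₀) = 1} = ∅ :=
    eq_empty_of_forall_notMem fun v hv => hlt v hv.1 hv.2
  have htop := span_tight_eq_top_of_mem_extremePoints_dualBody hs hl
  rw [hempty, image_empty, Submodule.span_empty] at htop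
  exact bot_ne_top htop

theorem finrank_vectorSpan_tight_add_one [Nontrivial E] (hs : s.Finite)
    (hl : l ∈ (dualBody s x₀).extremePoints ℝ) :
    finrank ℝ (vectorSpan ℝ {x | x ∈ convexHull ℝ s ∧ l (x - x₀) = 1}) + 1 = finrank ℝ E := by
  set T := {x | x ∈ convexHull ℝ s ∧ l (x - x₀) = 1}
  obtain ⟨v₀, hv₀, hlv₀⟩ := exists_tight_of_mem_extremePoints_dualBody hs hl
  have hmem : ∀ v ∈ s, l (v - x₀) = 1 → v ∈ T := fun v hv h => ⟨subset_convexHull ℝ s hv, h⟩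
  refine le_antisymm (Nat.succ_le_of_lt (Submodule.finrank_lt fun htop => ?_)) ?_
  · have hker : vectorSpan ℝ T ≤ LinearMap.ker l.toLinearMap := by
      rw [vectorSpan_def, Submodule.span_le]
      rintro _ ⟨y, hy, z, hz, rfl⟩
      change l (y - z) = 0
      rw [← sub_sub_sub_cancel_right y z x₀, map_sub, hy.2, hz.2, sub_self]
    have hzero : l (v₀ - x₀) = 0 := hker (htop ▸ Submodule.mem_top)
    exact one_ne_zero (hlv₀.symm.trans hzero)
  · have hle : Submodule.span ℝ ((fun v => v - x₀) '' {v | v ∈ s ∧ l (v - x₀) = 1}) ≤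
        vectorSpan ℝ T ⊔ Submodule.span ℝ {v₀ - x₀} := by
      rw [Submodule.span_le]
      rintro _ ⟨v, ⟨hv, hlv⟩, rfl⟩
      change v - x₀ ∈ _
      rw [← sub_add_sub_cancel v v₀ x₀]
      exact Submodule.add_mem_sup (vsub_mem_vectorSpan ℝ (hmem v hv hlv) (hmem v₀ hv₀ hlv₀))
        (Submodule.mem_span_singleton_self _)
    rw [span_tight_eq_top_of_mem_extremePoints_dualBody hs hl] at hle
    calc finrank ℝ E = finrank ℝ (⊤ : Submodule ℝ E) := (finrank_top ℝ E).symm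
      _ ≤ finrank ℝ (vectorSpan ℝ T ⊔ Submodule.span ℝ {v₀ - x₀} : Submodule ℝ E) :=
        Submodule.finrank_mono hle
      _ ≤ finrank ℝ (vectorSpan ℝ T) + finrank ℝ (Submodule.span ℝ {v₀ - x₀}) :=
        Submodule.finrank_add_le_finrank_add_finrank _ _
      _ ≤ finrank ℝ (vectorSpan ℝ T) + 1 := by
        gcongr
        simpa using finrank_span_le_card (R := ℝ) ({v₀ - x₀} : Set E)

theorem tight_mem_facets_of_mem_extremePoints_dualBody [Nontrivial E] (hs : s.Finite)
    (hdim : dim (convexHull ℝ s) = finrank ℝ E) (hl : l ∈ (dualBody s x₀).extremePoints ℝ) :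
    {x | x ∈ convexHull ℝ s ∧ l (x - x₀) = 1} ∈ facets (convexHull ℝ s) := by
  obtain ⟨v₀, hv₀, hlv₀⟩ := exists_tight_of_mem_extremePoints_dualBody hs hl
  refine ⟨?_, ?_⟩
  · simpa only [dualConstraint_apply, sub_eq_zero, eq_comm (a := (1 : ℝ))] using
      setOf_eq_zero_mem_faces (f := dualConstraint x₀ l) fun x hx =>
        sub_nonneg.2 (le_one_of_mem_convexHull hl.1 hx)
  · have hne : {x | x ∈ convexHull ℝ s ∧ l (x - x₀) = 1}.Nonempty :=
      ⟨v₀, subset_convexHull ℝ s hv₀, hlv₀⟩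
    rw [hdim, dim_of_nonempty hne, ← finrank_vectorSpan_tight_add_one hs hl]
    omega

theorem interior_nonempty_of_dim_eq_finrank {P : Set E} (hP : Convex ℝ P)
    (hdim : dim P = finrank ℝ E) : (interior P).Nonempty := by
  have hne : P.Nonempty := by
    by_contra h
    rw [not_nonempty_iff_eq_empty.1 h, dim_empty] at hdim
    omega
  rw [hP.interior_nonempty_iff_affineSpan_eq_top,
    AffineSubspace.affineSpan_eq_top_iff_vectorSpan_eq_top_of_nonempty ℝ _ _ hne]
  rw [dim_of_nonempty hne] at hdim
  exact Submodule.eq_top_of_finrank_eq (by exact_mod_cast hdim)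

theorem exists_facet_representation [Nontrivial E] {P : Set E} (hP : IsPolytope P)
    (hdim : dim P = finrank ℝ E) :
    ∃ (S : Set (StrongDual ℝ E)) (x₀ : E), S.Finite ∧
      P = polyhedron (fun l : S => dualConstraint x₀ l) ∧
      ∀ l ∈ S, {x | x ∈ P ∧ dualConstraint x₀ l x = 0} ∈ facets P := by
  obtain ⟨s, hs, rfl⟩ := hP
  obtain ⟨x₀, hx₀⟩ := interior_nonempty_of_dim_eq_finrank (convex_convexHull ℝ s) hdim
  refine ⟨_, x₀, finite_extremePoints_dualBody hs x₀,
    convexHull_eq_polyhedron_dualConstraint hs hx₀, fun l hl => ?_⟩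
  simpa only [dualConstraint_apply, sub_eq_zero, eq_comm (a := (1 : ℝ))] using
    tight_mem_facets_of_mem_extremePoints_dualBody hs hdim hl

end FacetRepresentation

section FanPolyhedronDimension

variable {E Y ι J : Type*} [AddCommGroup E] [Module ℝ E] [AddCommGroup Y] [Module ℝ Y]

theorem linealitySpace_empty {K : Type*} (a : K → E →ᵃ[ℝ] ℝ) : linealitySpace a ∅ = ⊤ :=
  eq_top_iff.2 fun _ _ => mem_linealitySpace.2 fun _ hk => absurd hk (notMem_empty _)

theorem polyhedronFace_empty {K : Type*} (a : K → E →ᵃ[ℝ] ℝ) :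
    polyhedronFace a ∅ = polyhedron a := by
  simp [polyhedronFace]

theorem maximizerPairs_empty (g : ι → J → Y →ₗ[ℝ] ℝ) (y : Y) : maximizerPairs g ∅ y = ∅ :=
  eq_empty_of_forall_notMem fun _ h => absurd h.1 (Finset.notMem_empty _)

theorem coneSpan_empty (g : ι → J → Y →ₗ[ℝ] ℝ) : coneSpan g ∅ = ⊤ :=
  eq_top_iff.2 fun _ _ _ _ _ h => absurd h (notMem_empty _)

variable [Fintype ι]

theorem Frame.eq_zero_of_linear_eq_zero (F : Frame ι E Y) {w : E}
    (hbary : ∀ i, (F.bary i).linear w = 0) (hproj : F.proj.linear w = 0) : w = 0 :=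
  (F.eq_zero_of_homogenization_eq_zero (x := 0) (s := 0)
    (fun i => by rw [hbary, zero_mul, add_zero]) (by rw [hproj, zero_smul, add_zero])).1

theorem Frame.linear_proj_surjective [Nonempty ι] (F : Frame ι E Y) :
    Function.Surjective F.proj.linear := by
  classical
  refine F.proj.linear_surjective_iff.2 fun y => ?_
  obtain ⟨x, -, hx⟩ := F.surjective (Pi.single (Classical.arbitrary ι) 1) y (by simp)
  exact ⟨x, hx⟩

variable [Finite J] [Nonempty J] [Nonempty ι] {g : ι → J → Y →ₗ[ℝ] ℝ}

theorem exists_mem_fanPolyhedron_activeSet_eq_empty (F : Frame ι E Y)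
    (hg : IsPositivelySpanning (sumFamily g)) :
    ∃ x ∈ fanPolyhedron F g, tightIndices F g x = ∅ ∧ activeSet (fanConstraint F g) x = ∅ := by
  obtain ⟨x, hx, htight, hact⟩ := exists_mem_fanPolyhedron_activeSet_eq F hg (I := ∅) (y := 0)
    (Or.inl Finset.univ_nonempty.ne_empty.symm)
  exact ⟨x, hx, htight, hact.trans (maximizerPairs_empty g 0)⟩

theorem finrank_add_one_eq_of_frame [FiniteDimensional ℝ E] [FiniteDimensional ℝ Y]
    (F : Frame ι E Y) (hg : IsPositivelySpanning (sumFamily g)) :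
    finrank ℝ E + 1 = finrank ℝ Y + Fintype.card ι := by
  obtain ⟨x, hx, htight, hact⟩ := exists_mem_fanPolyhedron_activeSet_eq_empty F hg
  have h := finrank_linealitySpace_activeSet hx
  rwa [hact, htight, linealitySpace_empty, coneSpan_empty, finrank_top, finrank_top,
    Finset.card_empty, add_zero] at h

theorem dim_fanPolyhedron (F : Frame ι E Y) (hg : IsPositivelySpanning (sumFamily g)) :
    dim (fanPolyhedron F g) = (finrank ℝ E : ℤ) := by
  obtain ⟨x, hx, -, hact⟩ := exists_mem_fanPolyhedron_activeSet_eq_empty F hg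
  have h := dim_polyhedronFace_activeSet hx
  rwa [hact, linealitySpace_empty, finrank_top, polyhedronFace_empty] at h

theorem image_proj_fanPolyhedron (F : Frame ι E Y) (g : ι → J → Y →ₗ[ℝ] ℝ) :
    F.proj '' fanPolyhedron F g = {y | ∀ m, sumFamily g m y ≤ 1} := by
  ext y
  constructor
  · rintro ⟨x, hx, rfl⟩
    exact sum_le_one_of_mem_fanPolyhedron hx
  · intro hy
    obtain ⟨β, hβ⟩ := exists_forall_mem_maximizers g y
    have hcard : (0 : ℝ) < Fintype.card ι := Nat.cast_pos.2 Fintype.card_pos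
    have hslack : 0 ≤ (1 - sumFamily g β y) / Fintype.card ι :=
      div_nonneg (sub_nonneg.2 (hy β)) hcard.le
    obtain ⟨x, hx, hxy⟩ := F.surjective
      (fun i => g i (β i) y + (1 - sumFamily g β y) / Fintype.card ι) y (by
        rw [Finset.sum_add_distrib, ← sumFamily_apply, Finset.sum_const, nsmul_eq_mul,
          Finset.card_univ, mul_div_cancel₀ _ hcard.ne', add_sub_cancel])
    refine ⟨x, mem_fanPolyhedron.2 fun i j => ?_, hxy⟩
    rw [hx, hxy]
    linarith [hβ i j]

end FanPolyhedronDimension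

section TightLocus

variable {E Y ι J M : Type*} [AddCommGroup E] [Module ℝ E] [AddCommGroup Y] [Module ℝ Y]
  [Fintype ι]

/-- The points of a fan polyhedron at which constraints of all indices are tight. For a polytope
with a special simplex this is the union of the faces without vertices of the simplex. -/
def tightLocus (F : Frame ι E Y) (g : ι → J → Y →ₗ[ℝ] ℝ) : Set E :=
  {x | x ∈ fanPolyhedron F g ∧ tightIndices F g x = Finset.univ}

variable {F : Frame ι E Y} {g : ι → J → Y →ₗ[ℝ] ℝ}

theorem bary_eq_of_mem_tightLocus {x : E} (hx : x ∈ tightLocus F g) {s : ℝ} (hs : 0 < s) {y : Y}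
    (hxy : F.proj x = s • y) {i : ι} {j : J} (hj : j ∈ maximizers (g i) y) :
    F.bary i x = s * g i j y := by
  have hjx : j ∈ maximizers (g i) (F.proj x) := by rwa [hxy, maximizers_smul hs]
  rw [bary_eq_of_mem_tightIndices hx.1 (hx.2 ▸ Finset.mem_univ i) hjx, hxy, map_smul,
    smul_eq_mul]

variable [Finite J] [Nonempty J]

theorem exists_mem_tightLocus (F : Frame ι E Y) (hg : IsPositivelySpanning (sumFamily g)) {y : Y}
    (hy : y ≠ 0) : ∃ x ∈ tightLocus F g, ∃ s : ℝ, 0 < s ∧ F.proj x = s • y := by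
  obtain ⟨x, hx, htight, hxy⟩ := exists_mem_fanPolyhedron_tightIndices_eq F hg
    (I := Finset.univ) (Or.inr hy)
  exact ⟨x, ⟨hx, htight⟩, hxy⟩

theorem exists_mem_affineSpan_tightLocus_proj_eq_zero (F : Frame ι E Y)
    (hg : IsPositivelySpanning (sumFamily g)) {y : Y} (hy : y ≠ 0) :
    ∃ z ∈ affineSpan ℝ (tightLocus F g), F.proj z = 0 ∧ ∃ t : ℝ, 0 < t ∧
      ∀ i, ∀ j ∈ maximizers (g i) y, ∀ j' ∈ maximizers (g i) (-y),
        F.bary i z = t * (g i j y - g i j' y) := by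
  obtain ⟨x, hx, s, hs, hxs⟩ := exists_mem_tightLocus F hg hy
  obtain ⟨x', hx', s', hs', hxs'⟩ := exists_mem_tightLocus F hg (neg_ne_zero.2 hy)
  refine ⟨AffineMap.lineMap x x' (s / (s + s')),
    AffineMap.lineMap_mem _ (mem_affineSpan ℝ hx) (mem_affineSpan ℝ hx'), ?_,
    s * s' / (s + s'), by positivity, fun i j hj j' hj' => ?_⟩
  · rw [AffineMap.apply_lineMap, hxs, hxs', AffineMap.lineMap_apply_module, smul_smul,
      smul_neg, smul_neg, smul_smul, ← sub_eq_add_neg, ← sub_smul,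
      show (1 - s / (s + s')) * s - s / (s + s') * s' = 0 by field_simp; ring, zero_smul]
  · rw [AffineMap.apply_lineMap, bary_eq_of_mem_tightLocus hx hs hxs hj,
      bary_eq_of_mem_tightLocus hx' hs' hxs' hj', map_neg, AffineMap.lineMap_apply_ring']
    field_simp
    ring

theorem exists_mem_affineSpan_tightLocus_bary_pos (F : Frame ι E Y)
    (hg : IsPositivelySpanning (sumFamily g)) {i : ι} {j j' : J} (hne : g i j ≠ g i j') :
    ∃ z ∈ affineSpan ℝ (tightLocus F g), F.proj z = 0 ∧ (∀ l, 0 ≤ F.bary l z) ∧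
      0 < F.bary i z := by
  obtain ⟨y, hy⟩ : ∃ y, g i j y ≠ g i j' y := DFunLike.ne_iff.1 hne
  have hy0 : y ≠ 0 := fun h => hy (by rw [h, map_zero, map_zero])
  obtain ⟨z, hz, hproj, t, ht, hbary⟩ := exists_mem_affineSpan_tightLocus_proj_eq_zero F hg hy0
  obtain ⟨β, hβ⟩ := exists_forall_mem_maximizers g y
  obtain ⟨β', hβ'⟩ := exists_forall_mem_maximizers g (-y)
  have hmin : ∀ l p, g l (β' l) y ≤ g l p y := fun l p => by
    simpa only [map_neg, neg_le_neg_iff] using hβ' l p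
  refine ⟨z, hz, hproj, fun l => ?_, ?_⟩
  · rw [hbary l _ (hβ l) _ (hβ' l)]
    exact mul_nonneg ht.le (sub_nonneg.2 (hmin l _))
  · rw [hbary i _ (hβ i) _ (hβ' i)]
    refine mul_pos ht (sub_pos.2 ?_)
    rcases lt_or_gt_of_ne hy with h | h
    · exact (hmin i j).trans_lt (h.trans_le (hβ i j'))
    · exact (hmin i j').trans_lt (h.trans_le (hβ i j))

theorem map_proj_vectorSpan_tightLocus (F : Frame ι E Y)
    (hg : IsPositivelySpanning (sumFamily g)) :
    (vectorSpan ℝ (tightLocus F g)).map F.proj.linear = ⊤ := by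
  refine eq_top_iff.2 fun y _ => ?_
  by_cases hy : y = 0
  · exact hy ▸ zero_mem _
  obtain ⟨x, hx, s, hs, hxs⟩ := exists_mem_tightLocus F hg hy
  obtain ⟨x', hx', s', hs', hxs'⟩ := exists_mem_tightLocus F hg (neg_ne_zero.2 hy)
  refine ⟨(1 / (s + s')) • (x - x'),
    Submodule.smul_mem _ _ (vsub_mem_vectorSpan ℝ hx hx'), ?_⟩
  rw [map_smul, affineMap_linear_sub, hxs, hxs', smul_neg, sub_neg_eq_add, ← add_smul,
    smul_smul, one_div_mul_cancel (by positivity), one_smul]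

end TightLocus

section ScaledFamilies

variable {E Y ι M : Type*} [AddCommGroup E] [Module ℝ E] [AddCommGroup Y] [Module ℝ Y]
  [Fintype ι] {F : Frame ι E Y} {r : ι → ℝ} {h : M → Y →ₗ[ℝ] ℝ}

theorem sumFamily_scaledFamily_le_one_iff (hr : ∀ i, 0 ≤ r i) (hsum : ∑ i, r i = 1) {y : Y} :
    (∀ m, sumFamily (scaledFamily r h) m y ≤ 1) ↔ ∀ m, h m y ≤ 1 := by
  simp only [sumFamily_apply, scaledFamily, LinearMap.smul_apply, smul_eq_mul]
  refine ⟨fun hy m => ?_, fun hy m => ?_⟩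
  · have hm := hy fun _ => m
    rwa [← Finset.sum_mul, hsum, one_mul] at hm
  · rw [← hsum]
    exact Finset.sum_le_sum fun i _ => mul_le_of_le_one_right (hr i) (hy (m i))

theorem bary_nonneg_of_mem_fanPolyhedron_scaledFamily [Nonempty M] (hr : ∀ i, 0 ≤ r i)
    (hh : IsPositivelySpanning h) {x : E} (hx : x ∈ fanPolyhedron F (scaledFamily r h)) (i : ι) :
    0 ≤ F.bary i x := by
  obtain ⟨m, hm⟩ : ∃ m, 0 ≤ h m (F.proj x) := by
    by_cases hproj : F.proj x = 0
    · exact ⟨Classical.arbitrary M, by rw [hproj, map_zero]⟩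
    · exact (hh _ hproj).imp fun _ => le_of_lt
  exact (mul_nonneg (hr i) hm).trans (mem_fanPolyhedron.1 hx i m)

theorem proj_eq_zero_of_bary_eq_zero (hh : IsPositivelySpanning h) {x : E}
    (hx : x ∈ fanPolyhedron F (scaledFamily r h)) {i : ι} (hri : 0 < r i)
    (hi : F.bary i x = 0) : F.proj x = 0 := by
  by_contra hproj
  obtain ⟨m, hm⟩ := hh _ hproj
  have hle : r i * h m (F.proj x) ≤ F.bary i x := mem_fanPolyhedron.1 hx i m
  exact (mul_pos hri hm).not_ge (hle.trans_eq hi)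

variable [Finite M] [Nonempty M]

theorem bary_eq_of_mem_tightLocus_scaledFamily (hr : ∀ i, 0 ≤ r i) (hsum : ∑ i, r i = 1) {x : E}
    (hx : x ∈ tightLocus F (scaledFamily r h)) (i : ι) : F.bary i x = r i := by
  obtain ⟨m, hm⟩ := maximizers_nonempty h (F.proj x)
  have hval : ∀ i, F.bary i x = r i * h m (F.proj x) := fun i =>
    bary_eq_of_mem_tightIndices hx.1 (hx.2 ▸ Finset.mem_univ i) fun m' =>
      mul_le_mul_of_nonneg_left (hm m') (hr i)
  have hone := F.sum_bary x
  simp only [hval, ← Finset.sum_mul, hsum, one_mul] at hone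
  rw [hval, hone, mul_one]

theorem finrank_vectorSpan_tightLocus_scaledFamily (F : Frame ι E Y) (hr : ∀ i, 0 ≤ r i)
    (hsum : ∑ i, r i = 1) (hh : IsPositivelySpanning h) :
    finrank ℝ (vectorSpan ℝ (tightLocus F (scaledFamily r h))) = finrank ℝ Y := by
  have hconst : ∀ i, vectorSpan ℝ (tightLocus F (scaledFamily r h)) ≤
      LinearMap.ker (F.bary i).linear := fun i => by
    rw [vectorSpan_def, Submodule.span_le]
    rintro _ ⟨x, hx, z, hz, rfl⟩
    simp only [SetLike.mem_coe, LinearMap.mem_ker]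
    rw [vsub_eq_sub, affineMap_linear_sub, bary_eq_of_mem_tightLocus_scaledFamily hr hsum hx,
      bary_eq_of_mem_tightLocus_scaledFamily hr hsum hz, sub_self]
  have hinj : Function.Injective (F.proj.linear.domRestrict
      (vectorSpan ℝ (tightLocus F (scaledFamily r h)))) :=
    (injective_iff_map_eq_zero _).2 fun w hw =>
      Subtype.ext (F.eq_zero_of_linear_eq_zero (fun i => hconst i w.2) hw)
  rw [← LinearMap.finrank_range_of_inj hinj, LinearMap.range_domRestrict,
    map_proj_vectorSpan_tightLocus F (hh.sumFamily_scaledFamily hsum), finrank_top]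

end ScaledFamilies

section Vertices

variable {E Y ι J : Type*} [AddCommGroup E] [Module ℝ E] [AddCommGroup Y] [Module ℝ Y]

theorem linealitySpace_eq_bot_of_mem_extremePoints {K : Type*} [Finite K] {a : K → E →ᵃ[ℝ] ℝ}
    {x : E} (hx : x ∈ (polyhedron a).extremePoints ℝ) :
    linealitySpace a (activeSet a x) = ⊥ := by
  rw [eq_bot_iff]
  intro w hw
  have hw := mem_linealitySpace.1 hw
  have hplus := eventually_mem_polyhedron (w := w) hx.1 fun k hk => (hw k hk).ge
  have hminus := eventually_mem_polyhedron (w := -w) hx.1 fun k hk => by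
    rw [map_neg, hw k hk, neg_zero]
  obtain ⟨t, ⟨hplus, hminus⟩, ht⟩ := ((hplus.and hminus).and self_mem_nhdsWithin).exists
  have hxt : x + t • w = x :=
    hx.2 hplus hminus ⟨1 / 2, 1 / 2, by norm_num, by norm_num, by norm_num, by module⟩
  exact (Submodule.mem_bot ℝ).2 ((smul_eq_zero.1 (add_eq_left.1 hxt)).resolve_left (ne_of_gt ht))

variable [Fintype ι] [DecidableEq ι]

/-- The points `v i` are the vertices of the simplex `{c ≥ 0, y = 0}` in the coordinates of `F`. -/
structure IsVertexFamily (F : Frame ι E Y) (v : ι → E) : Prop where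
  bary_eq : ∀ i l, F.bary i (v l) = if i = l then 1 else 0
  proj_eq_zero : ∀ l, F.proj (v l) = 0

namespace IsVertexFamily

variable {F : Frame ι E Y} {v : ι → E} {g : ι → J → Y →ₗ[ℝ] ℝ}

theorem vertex_mem_fanPolyhedron (hv : IsVertexFamily F v) (l : ι) : v l ∈ fanPolyhedron F g := by
  rw [SpecialSimplex.mem_fanPolyhedron]
  intro i j
  rw [hv.proj_eq_zero, map_zero, hv.bary_eq]
  split_ifs
  exacts [zero_le_one, le_rfl]

theorem mem_activeSet_iff (hv : IsVertexFamily F v) {l i : ι} {j : J} :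
    (i, j) ∈ activeSet (fanConstraint F g) (v l) ↔ i ≠ l := by
  rw [mem_activeSet_fanConstraint, hv.proj_eq_zero, map_zero, hv.bary_eq]
  exact ite_eq_right_iff.trans (imp_congr_right fun _ => by simp)

theorem tightIndices_eq [Nonempty J] (hv : IsVertexFamily F v) (i : ι) :
    tightIndices F g (v i) = {i}ᶜ := by
  ext l
  simp [mem_tightIndices, hv.proj_eq_zero, hv.bary_eq]

theorem mem_polyhedronFace_iff (hv : IsVertexFamily F v) {x : E} {i : ι} :
    v i ∈ polyhedronFace (fanConstraint F g) (activeSet (fanConstraint F g) x) ↔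
      i ∉ tightIndices F g x := by
  refine ⟨fun hi hix => ?_, fun hi => ⟨hv.vertex_mem_fanPolyhedron i, fun ⟨l, j⟩ hl => ?_⟩⟩
  · obtain ⟨j, hj⟩ := mem_tightIndices.1 hix
    exact hv.mem_activeSet_iff.1 (hi.2 (mem_activeSet_fanConstraint.2 hj)) rfl
  · refine hv.mem_activeSet_iff.2 fun hli => hi (mem_tightIndices.2 ⟨j, ?_⟩)
    rw [← hli]
    exact mem_activeSet_fanConstraint.1 hl

theorem linear_apply (hv : IsVertexFamily F v) (f : E →ᵃ[ℝ] ℝ) (l₀ : ι) {w : E}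
    (hw : F.proj.linear w = 0) :
    f.linear w = ∑ l, (F.bary l).linear w * (f (v l) - f (v l₀)) := by
  have hdecomp : w = ∑ l, (F.bary l).linear w • (v l - v l₀) := by
    refine sub_eq_zero.1 (F.eq_zero_of_linear_eq_zero (fun i => ?_) ?_)
    · rw [map_sub]
      simp only [map_sum, map_smul, affineMap_linear_sub, smul_eq_mul, mul_sub,
        Finset.sum_sub_distrib, ← Finset.sum_mul, F.sum_bary_linear]
      simp [hv.bary_eq]
    · rw [map_sub]
      simp only [map_sum, map_smul, affineMap_linear_sub, hv.proj_eq_zero, hw, sub_self,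
        smul_zero, Finset.sum_const_zero]
  conv_lhs => rw [hdecomp]
  simp only [map_sum, map_smul, affineMap_linear_sub, smul_eq_mul]

theorem exists_linear [Nonempty ι] (hv : IsVertexFamily F v) {f : E →ᵃ[ℝ] ℝ} {i : ι}
    (hf : ∀ l, f (v l) = if i = l then 1 else 0) :
    ∃ γ : Y →ₗ[ℝ] ℝ, ∀ x, f x = F.bary i x - γ (F.proj x) := by
  obtain ⟨ρ, hρ⟩ := LinearMap.exists_rightInverse_of_surjective F.proj.linear
    (LinearMap.range_eq_top.2 F.linear_proj_surjective)
  refine ⟨(F.bary i - f).linear ∘ₗ ρ, fun x => ?_⟩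
  have hvert : ∀ l, (F.bary i - f) (v l) = 0 := fun l => by
    rw [AffineMap.coe_sub, Pi.sub_apply, hv.bary_eq, hf, sub_self]
  have hker : F.proj.linear (x - v i - ρ (F.proj x)) = 0 := by
    rw [map_sub, affineMap_linear_sub, hv.proj_eq_zero, sub_zero,
      show F.proj.linear (ρ (F.proj x)) = F.proj x from LinearMap.congr_fun hρ _, sub_self]
  have hzero := hv.linear_apply (F.bary i - f) i hker
  simp only [hvert, sub_self, mul_zero, Finset.sum_const_zero] at hzero
  rw [map_sub, affineMap_linear_sub, hvert, sub_zero, sub_eq_zero, AffineMap.coe_sub,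
    Pi.sub_apply] at hzero
  rw [LinearMap.comp_apply, ← hzero, sub_sub_cancel]

theorem mem_extremePoints_fanPolyhedron_scaledFamily {M : Type*} [Nonempty M]
    (hv : IsVertexFamily F v) {r : ι → ℝ} (hr : ∀ i, 0 ≤ r i) {h : M → Y →ₗ[ℝ] ℝ}
    (hh : IsPositivelySpanning h) {i l : ι} (hl : l ≠ i) (hrl : 0 < r l) :
    v i ∈ (fanPolyhedron F (scaledFamily r h)).extremePoints ℝ := by
  refine ⟨hv.vertex_mem_fanPolyhedron i, fun x hx x' hx' ⟨a, b, ha, hb, hab, hxx'⟩ => ?_⟩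
  have hbary : ∀ p, p ≠ i → F.bary p x = 0 := by
    intro p hp
    have hcombo := hv.bary_eq p i
    rw [if_neg hp, ← hxx', Convex.combo_affine_apply hab, smul_eq_mul, smul_eq_mul] at hcombo
    have hnonneg :=
      mul_nonneg ha.le (bary_nonneg_of_mem_fanPolyhedron_scaledFamily hr hh hx p)
    have hnonneg' :=
      mul_nonneg hb.le (bary_nonneg_of_mem_fanPolyhedron_scaledFamily hr hh hx' p)
    exact (mul_eq_zero.1 (by linarith : a * F.bary p x = 0)).resolve_left ha.ne'
  refine F.injective (fun p => ?_) ?_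
  · rw [hv.bary_eq]
    split_ifs with hp
    · rw [hp, ← F.sum_bary x, Finset.sum_eq_single i (fun q _ hq => hbary q hq) (by simp)]
    · exact hbary p hp
  · rw [proj_eq_zero_of_bary_eq_zero hh hx hrl (hbary l hl), hv.proj_eq_zero]

section Faces

variable [Finite J]

theorem sUnion_faces_disjoint_range_eq_tightLocus [TopologicalSpace E]
    [IsTopologicalAddGroup E] [ContinuousSMul ℝ E] [T2Space E] [FiniteDimensional ℝ E]
    (hv : IsVertexFamily F v) :
    ⋃₀ {T | T ∈ faces (fanPolyhedron F g) ∧ Disjoint T (range v)} = tightLocus F g := by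
  ext x
  constructor
  · rintro ⟨T, ⟨hT, hdisj⟩, hxT⟩
    obtain ⟨z, -, rfl⟩ := exists_eq_polyhedronFace_activeSet hT ⟨x, hxT⟩
    refine ⟨hxT.1, Finset.eq_univ_iff_forall.2 fun i => ?_⟩
    have hi : i ∈ tightIndices F g z := by
      by_contra hi
      exact Set.disjoint_left.1 hdisj (hv.mem_polyhedronFace_iff.2 hi) ⟨i, rfl⟩
    obtain ⟨j, hj⟩ := mem_tightIndices.1 hi
    have hij : (i, j) ∈ activeSet (fanConstraint F g) z := mem_activeSet_fanConstraint.2 hj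
    exact mem_tightIndices.2 ⟨j, mem_activeSet_fanConstraint.1 (hxT.2 hij)⟩
  · rintro ⟨hx, htight⟩
    refine ⟨_, ⟨polyhedronFace_mem_faces _ _, ?_⟩, mem_polyhedronFace_activeSet hx⟩
    rw [Set.disjoint_right]
    rintro _ ⟨i, rfl⟩
    rw [hv.mem_polyhedronFace_iff, htight, not_not]
    exact Finset.mem_univ i

variable [Nonempty J]

theorem coneSpan_eq_bot [FiniteDimensional ℝ E] [FiniteDimensional ℝ Y]
    (hv : IsVertexFamily F v) {i : ι} (hx : v i ∈ (fanPolyhedron F g).extremePoints ℝ) :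
    coneSpan g (maximizerPairs g {i}ᶜ 0) = ⊥ := by
  have hmem : v i ∈ fanPolyhedron F g := hv.vertex_mem_fanPolyhedron i
  have hfin := finrank_linealitySpace_activeSet hmem
  rw [linealitySpace_eq_bot_of_mem_extremePoints hx, finrank_bot, activeSet_fanConstraint hmem,
    hv.tightIndices_eq, hv.proj_eq_zero, Finset.card_compl, Finset.card_singleton] at hfin
  have : 0 < Fintype.card ι := Fintype.card_pos_iff.2 ⟨i⟩
  exact Submodule.finrank_eq_zero.1 (by omega)

theorem ncard_fanCones_compl_singleton_zero_pos [FiniteDimensional ℝ E] [FiniteDimensional ℝ Y]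
    (hv : IsVertexFamily F v) {i : ι} (hx : v i ∈ (fanPolyhedron F g).extremePoints ℝ) :
    0 < (fanCones g {i}ᶜ 0).ncard :=
  (Set.ncard_pos (Set.toFinite _)).2
    ⟨_, 0, rfl, by rw [hv.coneSpan_eq_bot hx, finrank_bot, Nat.cast_zero]⟩

theorem exists_forall_mem_facet_iff [TopologicalSpace E] [FiniteDimensional ℝ E]
    [FiniteDimensional ℝ Y] [Nonempty ι] (hv : IsVertexFamily F v)
    (hg : IsPositivelySpanning (sumFamily g)) (hpos : 0 < finrank ℝ E) {T : Set E}
    (hT : T ∈ facets (fanPolyhedron F g)) :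
    ∃ i, ∀ l, v l ∈ T ↔ l ≠ i := by
  obtain ⟨hT, hdim⟩ := hT
  rw [dim_fanPolyhedron F hg] at hdim
  have hne : T.Nonempty := by
    rw [nonempty_iff_ne_empty, Ne, ← dim_eq_neg_one_iff]
    omega
  obtain ⟨x, hx, rfl⟩ := exists_eq_polyhedronFace_activeSet hT hne
  rw [dim_polyhedronFace_activeSet hx] at hdim
  have hfin := finrank_linealitySpace_activeSet hx
  have hframe := finrank_add_one_eq_of_frame F hg
  have hle := Submodule.finrank_le (coneSpan g (activeSet (fanConstraint F g) x))
  have htight : (tightIndices F g x).card ≠ 0 := by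
    rw [Ne, Finset.card_eq_zero]
    intro h
    rw [activeSet_fanConstraint hx, h, maximizerPairs_empty, linealitySpace_empty,
      finrank_top] at hdim
    omega
  obtain ⟨i, hi⟩ := Finset.card_eq_one.1 (by omega : (tightIndices F g x).card = 1)
  exact ⟨i, fun l => by rw [hv.mem_polyhedronFace_iff, hi, Finset.mem_singleton]⟩

end Faces

end IsVertexFamily

end Vertices

section Bounded

variable {E Y ι J : Type*} [NormedAddCommGroup E] [NormedSpace ℝ E] [AddCommGroup Y] [Module ℝ Y]
  [Fintype ι]

theorem eq_zero_of_forall_add_smul_mem {S : Set E} (hS : Bornology.IsBounded S) {x w : E}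
    (h : ∀ s : ℝ, 0 ≤ s → x + s • w ∈ S) : w = 0 := by
  obtain ⟨R, hR⟩ := hS.exists_norm_le
  by_contra hw
  obtain ⟨N, hN⟩ := exists_lt_nsmul (norm_pos_iff.2 hw) (R + ‖x‖)
  have hdiff := norm_sub_le (x + (N : ℝ) • w) x
  rw [add_sub_cancel_left, Nat.cast_smul_eq_nsmul, ← Nat.cast_smul_eq_nsmul ℝ,
    norm_smul, Real.norm_natCast, ← nsmul_eq_mul] at hdiff
  linarith [hR _ (h N N.cast_nonneg)]

theorem exists_apply_ne_zero_of_isBounded {K : Type*} {a : K → E →ᵃ[ℝ] ℝ}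
    (hb : Bornology.IsBounded (polyhedron a)) {x p : E} (hx : x ∈ polyhedron a) (hxp : x ≠ p) :
    ∃ k, a k p ≠ 0 := by
  by_contra! hzero
  refine hxp (sub_eq_zero.1 (eq_zero_of_forall_add_smul_mem hb (x := p) fun s hs k => ?_))
  rw [affineMap_add_smul, affineMap_linear_sub, hzero, sub_zero, zero_add]
  exact mul_nonneg hs (hx k)

theorem isPositivelySpanning_of_isBounded [Nonempty ι] [Finite J] [Nonempty J] {F : Frame ι E Y}
    {g : ι → J → Y →ₗ[ℝ] ℝ} (hb : Bornology.IsBounded (fanPolyhedron F g)) :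
    IsPositivelySpanning (sumFamily g) := by
  intro y hy
  by_contra! hle
  obtain ⟨β, hβ⟩ := exists_forall_mem_maximizers g y
  obtain ⟨x, hx, hxy⟩ := F.surjective (fun _ => (Fintype.card ι : ℝ)⁻¹) 0 (by simp)
  obtain ⟨w, s, hbary, hproj⟩ := F.exists_homogenization_eq x (fun i => g i (β i) y) y
  rw [hxy, smul_zero, add_zero] at hproj
  have hs : s ≤ 0 := by
    have hsum := Finset.sum_congr rfl fun i (_ : i ∈ Finset.univ) => hbary i
    rw [Finset.sum_add_distrib, F.sum_bary_linear, ← Finset.mul_sum, F.sum_bary, zero_add,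
      mul_one, ← sumFamily_apply] at hsum
    exact hsum.trans_le (hle β)
  have hw : w = 0 := eq_zero_of_forall_add_smul_mem hb (x := x) fun t ht =>
    mem_fanPolyhedron.2 fun i j => by
      have hcard : (0 : ℝ) ≤ (Fintype.card ι : ℝ)⁻¹ := by positivity
      have hgrow : g i j y ≤ (F.bary i).linear w := by
        rw [eq_sub_of_add_eq (hbary i), hx]
        linarith [hβ i j, mul_nonpos_of_nonpos_of_nonneg hs hcard]
      rw [affineMap_add_smul, affineMap_add_smul, hx, hxy, hproj, zero_add, map_smul]
      exact (mul_le_mul_of_nonneg_left hgrow ht).trans (le_add_of_nonneg_left hcard)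
  exact hy (by rw [← hproj, hw, map_zero])

theorem IsVertexFamily.exists_forall_nonneg_iff [DecidableEq ι] [Nonempty ι] {F : Frame ι E Y}
    {v : ι → E} (hv : IsVertexFamily F v) {f : E →ᵃ[ℝ] ℝ} {i : ι} (hpos : 0 < f (v i))
    (hf : ∀ l ≠ i, f (v l) = 0) :
    ∃ γ : Y →ₗ[ℝ] ℝ, ∀ x, 0 ≤ f x ↔ γ (F.proj x) ≤ F.bary i x := by
  obtain ⟨γ, hγ⟩ := hv.exists_linear (f := (f (v i))⁻¹ • f) (i := i) fun l => by
    rw [AffineMap.coe_smul, Pi.smul_apply, smul_eq_mul]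
    split_ifs with hl
    · rw [← hl, inv_mul_cancel₀ hpos.ne']
    · rw [hf l (Ne.symm hl), mul_zero]
  refine ⟨γ, fun x => ?_⟩
  rw [← sub_nonneg (a := F.bary i x), ← hγ, AffineMap.coe_smul, Pi.smul_apply, smul_eq_mul,
    mul_nonneg_iff_of_pos_left (inv_pos.2 hpos)]

theorem IsVertexFamily.exists_eq_fanPolyhedron [DecidableEq ι] [Nonempty ι] {F : Frame ι E Y}
    {v : ι → E} (hv : IsVertexFamily F v) {K : Type*} {a : K → E →ᵃ[ℝ] ℝ}
    (hb : Bornology.IsBounded (polyhedron a)) (hne : ∀ i, ∃ x ∈ polyhedron a, x ≠ v i)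
    (hmem : ∀ i, v i ∈ polyhedron a) (ha : ∀ k, ∃ i, ∀ l, a k (v l) = 0 ↔ l ≠ i) :
    Nonempty K ∧ ∃ g : ι → K → Y →ₗ[ℝ] ℝ, polyhedron a = fanPolyhedron F g := by
  choose missed hmissed using ha
  have hpos : ∀ k, 0 < a k (v (missed k)) := fun k =>
    lt_of_le_of_ne (hmem _ k) fun h => (hmissed k _).1 h.symm rfl
  choose γ hγ using fun k => hv.exists_forall_nonneg_iff (hpos k) fun l hl => (hmissed k l).2 hl
  have hsurj : ∀ i, ∃ k, missed k = i := fun i => by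
    obtain ⟨x, hx, hxi⟩ := hne i
    obtain ⟨k, hk⟩ := exists_apply_ne_zero_of_isBounded hb hx hxi
    exact ⟨k, by_contra fun h => hk ((hmissed k i).2 (Ne.symm h))⟩
  choose κ hκ using hsurj
  refine ⟨⟨κ (Classical.arbitrary ι)⟩, fun i k => if missed k = i then γ k else γ (κ i), ?_⟩
  ext x
  rw [mem_fanPolyhedron]
  constructor
  · intro hx i k
    split_ifs with hk
    · exact hk ▸ (hγ k x).1 (hx k)
    · simpa only [hκ] using (hγ (κ i) x).1 (hx (κ i))
  · intro hx k
    have hk := hx (missed k) k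
    rw [if_pos rfl] at hk
    exact (hγ k x).2 hk

theorem exists_pos_add_smul_mem_of_mem_intrinsicInterior {S : Set E} {x z : E}
    (hx : x ∈ intrinsicInterior ℝ S) (hz : z ∈ S) : ∃ t : ℝ, 0 < t ∧ x + t • (x - z) ∈ S := by
  obtain ⟨y, hy, rfl⟩ := mem_intrinsicInterior.1 hx
  let ray : ℝ → affineSpan ℝ S := fun t =>
    ⟨AffineMap.lineMap (y : E) z (-t), AffineMap.lineMap_mem _ y.2 (subset_affineSpan ℝ S hz)⟩
  have hray : Continuous ray := by
    refine Continuous.subtype_mk ?_ _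
    simp only [AffineMap.lineMap_apply, vsub_eq_sub, vadd_eq_add]
    fun_prop
  have hray_zero : ray 0 = y := Subtype.ext (by simp [ray])
  have hev : ∀ᶠ t in 𝓝 (0 : ℝ), ray t ∈ interior ((↑) ⁻¹' S : Set (affineSpan ℝ S)) :=
    hray.continuousAt.eventually_mem (by rw [hray_zero]; exact isOpen_interior.mem_nhds hy)
  obtain ⟨t, ht, hpos⟩ := ((hev.filter_mono nhdsWithin_le_nhds).and
    (self_mem_nhdsWithin (s := Ioi (0 : ℝ)))).exists
  have hmem : (ray t : E) ∈ S := interior_subset (s := ((↑) ⁻¹' S : Set (affineSpan ℝ S))) ht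
  have heq : (ray t : E) = y + t • ((y : E) - z) := by
    simp only [ray, AffineMap.lineMap_apply, vsub_eq_sub, vadd_eq_add]
    module
  exact ⟨t, hpos, heq ▸ hmem⟩

end Bounded

section Hulls

variable {E Y ι J M : Type*} [AddCommGroup E] [Module ℝ E] [AddCommGroup Y] [Module ℝ Y]
  [Fintype ι]

theorem IsVertexFamily.convexHull_range_eq [DecidableEq ι] {F : Frame ι E Y} {v : ι → E}
    (hv : IsVertexFamily F v) :
    convexHull ℝ (range v) = {x | F.proj x = 0 ∧ ∀ i, 0 ≤ F.bary i x} := by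
  apply Subset.antisymm
  · refine convexHull_min ?_ fun x hx z hz a b ha hb hab => ⟨?_, fun i => ?_⟩
    · rintro _ ⟨l, rfl⟩
      refine ⟨hv.proj_eq_zero l, fun i => ?_⟩
      rw [hv.bary_eq]
      split_ifs <;> norm_num
    · rw [Convex.combo_affine_apply hab, hx.1, hz.1, smul_zero, smul_zero, add_zero]
    · rw [Convex.combo_affine_apply hab]
      exact add_nonneg (mul_nonneg ha (hx.2 i)) (mul_nonneg hb (hz.2 i))
  · rintro x ⟨hx, hpos⟩
    have hcombo : x = ∑ l, F.bary l x • v l := by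
      refine F.injective (fun i => ?_) ?_
      · simp [affineMap_sum_smul _ (F.sum_bary x), hv.bary_eq]
      · simp [affineMap_sum_smul _ (F.sum_bary x), hv.proj_eq_zero, hx]
    rw [hcombo]
    exact (convex_convexHull ℝ _).sum_mem (fun i _ => hpos i) (F.sum_bary x)
      fun i _ => subset_convexHull ℝ _ ⟨i, rfl⟩

theorem IsPositivelySpanning.exists_smul_eq [Finite M] [Nonempty M] {h : M → Y →ₗ[ℝ] ℝ}
    (hh : IsPositivelySpanning h) (y : Y) :
    ∃ m, 0 ≤ h m y ∧ ∃ y', h m y • y' = y ∧ ∀ m', h m' y' ≤ 1 := by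
  obtain ⟨m, hm⟩ := maximizers_nonempty h y
  by_cases hy : y = 0
  · exact ⟨m, by simp [hy], 0, by simp [hy], fun m' => by simp⟩
  · obtain ⟨m', hm'⟩ := hh y hy
    have hpos : 0 < h m y := hm'.trans_le (hm m')
    refine ⟨m, hpos.le, (h m y)⁻¹ • y, smul_inv_smul₀ hpos.ne' y, fun m' => ?_⟩
    rw [map_smul, smul_eq_mul, inv_mul_le_one₀ hpos]
    exact hm m'

theorem exists_stdSimplex_eq_mul_add_mul {r c : ι → ℝ} (hr : r ∈ stdSimplex ℝ ι)
    (hc : ∑ i, c i = 1) {γ : ℝ} (hle : ∀ i, γ * r i ≤ c i) :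
    γ ≤ 1 ∧ ∃ s ∈ stdSimplex ℝ ι, ∀ i, c i = γ * r i + (1 - γ) * s i := by
  have hγ : γ ≤ 1 := by
    have hsum := Finset.sum_le_sum fun i (_ : i ∈ Finset.univ) => hle i
    rwa [← Finset.mul_sum, hr.2, hc, mul_one] at hsum
  refine ⟨hγ, ?_⟩
  rcases hγ.eq_or_lt with rfl | hlt
  · simp only [one_mul] at hle
    have heq := (Finset.sum_eq_sum_iff_of_le fun i _ => hle i).1 (hr.2.trans hc.symm)
    exact ⟨r, hr, fun i => by rw [← heq i (Finset.mem_univ i)]; ring⟩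
  · have hpos : 0 < 1 - γ := sub_pos.2 hlt
    refine ⟨fun i => (1 - γ)⁻¹ * (c i - γ * r i), ⟨fun i => ?_, ?_⟩, fun i => ?_⟩
    · exact mul_nonneg (inv_nonneg.2 hpos.le) (sub_nonneg.2 (hle i))
    · rw [← Finset.mul_sum, Finset.sum_sub_distrib, ← Finset.mul_sum, hc, hr.2, mul_one,
        inv_mul_cancel₀ hpos.ne']
    · rw [mul_inv_cancel_left₀ hpos.ne', add_sub_cancel]

theorem exists_eq_combo_of_mem_fanPolyhedron_scaledFamily [Finite M] [Nonempty M]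
    {F : Frame ι E Y} {r : ι → ℝ} (hr : r ∈ stdSimplex ℝ ι) {h : M → Y →ₗ[ℝ] ℝ}
    (hh : IsPositivelySpanning h) {x : E} (hx : x ∈ fanPolyhedron F (scaledFamily r h)) :
    ∃ γ : ℝ, 0 ≤ γ ∧ γ ≤ 1 ∧ ∃ u s, ((∀ i, F.bary i u = r i) ∧ ∀ m, h m (F.proj u) ≤ 1) ∧
      ((∀ i, 0 ≤ F.bary i s) ∧ F.proj s = 0) ∧ x = γ • u + (1 - γ) • s := by
  obtain ⟨m, hγ, y, hy, hle⟩ := hh.exists_smul_eq (F.proj x)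
  obtain ⟨hγ', s, hs, hcombo⟩ := exists_stdSimplex_eq_mul_add_mul hr (F.sum_bary x)
    fun i => (mul_comm _ _).trans_le (mem_fanPolyhedron.1 hx i m)
  obtain ⟨u, hu, rfl⟩ := F.surjective r y hr.2
  obtain ⟨z, hz, hz_proj⟩ := F.surjective s 0 hs.2
  refine ⟨_, hγ, hγ', u, z, ⟨hu, hle⟩, ⟨fun i => (hz i).symm ▸ hs.1 i, hz_proj⟩,
    F.injective (fun i => ?_) ?_⟩
  · rw [Convex.combo_affine_apply (add_sub_cancel _ _), hu, hz, hcombo, smul_eq_mul, smul_eq_mul]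
  · rw [Convex.combo_affine_apply (add_sub_cancel _ _), hz_proj, smul_zero, add_zero, hy]

theorem IsVertexFamily.convexHull_image_union_range [DecidableEq ι] [Finite J] [Nonempty J]
    [Nonempty ι] {F : Frame ι E Y} {v : ι → E} (hv : IsVertexFamily F v)
    {g : ι → J → Y →ₗ[ℝ] ℝ} (hg : IsPositivelySpanning (sumFamily g)) {V : Set E}
    (hV : fanPolyhedron F g = convexHull ℝ V) {r : ι → ℝ} (hr : r ∈ stdSimplex ℝ ι)
    {φ : E →ᵃ[ℝ] E} (hbary : ∀ x i, F.bary i (φ x) = r i) (hproj : ∀ x, F.proj (φ x) = F.proj x) :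
    convexHull ℝ (φ '' (V \ range v) ∪ range v) =
      fanPolyhedron F (scaledFamily r (sumFamily g)) := by
  apply Subset.antisymm
  · refine convexHull_min ?_ (convex_polyhedron _)
    rintro _ (⟨x, ⟨hx, -⟩, rfl⟩ | ⟨i, rfl⟩)
    · refine mem_fanPolyhedron.2 fun i m => ?_
      rw [hbary, hproj]
      exact mul_le_of_le_one_right (hr.1 i)
        (sum_le_one_of_mem_fanPolyhedron (hV ▸ subset_convexHull ℝ V hx) m)
    · exact hv.vertex_mem_fanPolyhedron i
  · set S := convexHull ℝ (φ '' (V \ range v) ∪ range v)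
    have hsimplex : ∀ s, (∀ i, 0 ≤ F.bary i s) → F.proj s = 0 → s ∈ S := fun s hs hs_proj =>
      convexHull_mono subset_union_right (hv.convexHull_range_eq ▸ ⟨hs_proj, hs⟩)
    have himage : fanPolyhedron F g ⊆ φ ⁻¹' S := by
      rw [hV]
      refine convexHull_min (fun z hz => ?_) ((convex_convexHull ℝ _).affine_preimage φ)
      by_cases hzv : z ∈ range v
      · obtain ⟨l, rfl⟩ := hzv
        exact hsimplex _ (fun i => (hbary _ i).symm ▸ hr.1 i) ((hproj _).trans (hv.proj_eq_zero l))
      · exact subset_convexHull ℝ _ (Or.inl ⟨z, ⟨hz, hzv⟩, rfl⟩)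
    intro x hx
    obtain ⟨γ, hγ, hγ', u, s, ⟨hu, hle⟩, ⟨hs, hs_proj⟩, rfl⟩ :=
      exists_eq_combo_of_mem_fanPolyhedron_scaledFamily hr hg hx
    obtain ⟨x₁, hx₁, hx₁u⟩ : F.proj u ∈ F.proj '' fanPolyhedron F g := by
      rwa [image_proj_fanPolyhedron]
    have hφ : φ x₁ = u :=
      F.injective (fun i => (hbary _ i).trans (hu i).symm) ((hproj _).trans hx₁u)
    exact convex_convexHull ℝ _ (hφ ▸ himage hx₁) (hsimplex s hs hs_proj) hγ (sub_nonneg.2 hγ')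
      (add_sub_cancel _ _)

/-- The frame of a product whose first factor carries the barycentric coordinates of an affine
basis; it presents direct sums with a simplex as fan polyhedra. -/
def basisFrame (b : AffineBasis ι ℝ E) (Y : Type*) [AddCommGroup Y] [Module ℝ Y] :
    Frame ι (E × Y) Y where
  bary i := (b.coord i).comp (LinearMap.fst ℝ E Y).toAffineMap
  proj := (LinearMap.snd ℝ E Y).toAffineMap
  sum_bary x := b.sum_coord_apply_eq_one x.1
  injective {x x'} h hy := by
    refine Prod.ext ?_ hy
    rw [← b.linear_combination_coord_eq_self x.1, ← b.linear_combination_coord_eq_self x'.1]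
    exact Finset.sum_congr rfl fun i _ => congrArg (· • b i) (h i)
  surjective c y hc := by
    classical
    refine ⟨(∑ i, c i • b i, y), fun i => ?_, rfl⟩
    change b.coord i (∑ i, c i • b i) = c i
    simp [affineMap_sum_smul _ hc, b.coord_apply]

/-- The frame induced by a frame along an affine equivalence. -/
def Frame.pullback {E' : Type*} [AddCommGroup E'] [Module ℝ E'] (F : Frame ι E Y)
    (e : E' ≃ᵃ[ℝ] E) : Frame ι E' Y where
  bary i := (F.bary i).comp e
  proj := F.proj.comp e
  sum_bary x := F.sum_bary (e x)
  injective h hy := e.injective (F.injective h hy)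
  surjective c y hc := by
    obtain ⟨x, hx, hxy⟩ := F.surjective c y hc
    exact ⟨e.symm x, by simpa using hx, by simpa using hxy⟩

/-- The frame over a single index, with `q` as the origin of the second factor; it presents an
arbitrary full-dimensional polyhedron with interior point `q` as a fan polyhedron. -/
def unitFrame (q : Y) : Frame Unit Y Y where
  bary _ := AffineMap.const ℝ Y 1
  proj := AffineMap.id ℝ Y - AffineMap.const ℝ Y q
  sum_bary x := by simp
  injective _ hy := sub_left_injective hy
  surjective c y hc := ⟨y + q, fun i => by simpa using hc.symm, add_sub_cancel_right y q⟩

theorem fanPolyhedron_unitFrame (q : Y) (h : M → Y →ₗ[ℝ] ℝ) :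
    fanPolyhedron (unitFrame q) (fun _ => h) = {y | ∀ m, h m (y - q) ≤ 1} := by
  ext y
  rw [mem_fanPolyhedron]
  exact ⟨fun hy m => hy () m, fun hy _ m => hy m⟩

theorem directSum_convexHull_eq_fanPolyhedron [Finite M] [Nonempty M] (b : AffineBasis ι ℝ E)
    (hb : ∀ i, 0 ≤ b.coord i 0) {h : M → Y →ₗ[ℝ] ℝ} (hh : IsPositivelySpanning h) :
    directSum (convexHull ℝ (range b)) {y | ∀ m, h m y ≤ 1} =
      fanPolyhedron (basisFrame b Y) (scaledFamily (fun i => b.coord i 0) h) := by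
  rw [AffineBasis.convexHull_eq_nonneg_coord]
  apply Subset.antisymm
  · rintro _ ⟨v, hv, w, hw, s, t, hs, ht, hst, rfl⟩
    refine mem_fanPolyhedron.2 fun i m => ?_
    change b.coord i 0 * h m (t • w) ≤ b.coord i (s • v)
    have hbound : h m (t • w) ≤ 1 - s := by
      rw [map_smul, smul_eq_mul]
      linarith [mul_le_mul_of_nonneg_left (hw m) ht]
    rw [affineMap_smul, smul_eq_mul, smul_eq_mul]
    linarith [mul_nonneg hs (hv i), mul_le_mul_of_nonneg_left hbound (hb i)]
  · intro x hx
    obtain ⟨γ, hγ, hγ', u, s, ⟨hu, hle⟩, ⟨hs, hs_proj⟩, rfl⟩ :=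
      exists_eq_combo_of_mem_fanPolyhedron_scaledFamily ⟨hb, b.sum_coord_apply_eq_one 0⟩ hh hx
    have hu_eq : u = (0, u.2) := (basisFrame b Y).injective hu rfl
    have hs_eq : s = (s.1, 0) := Prod.ext rfl hs_proj
    refine ⟨s.1, hs, u.2, hle, 1 - γ, γ, sub_nonneg.2 hγ', hγ, (sub_add_cancel 1 γ).le, ?_⟩
    rw [hu_eq, hs_eq]
    simp

end Hulls

section SimplexFrame

/-- The splitting of a space into a subspace `V` and the quotient by `V` that a linear complement
of `V` induces, with `p` as the origin. -/
def complCoordinates {E : Type*} [AddCommGroup E] [Module ℝ E] {V W : Submodule ℝ E}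
    (hVW : IsCompl V W) (p : E) : E ≃ᵃ[ℝ] V × (E ⧸ V) :=
  (AffineEquiv.vaddConst ℝ p).symm.trans
    (LinearMap.equivProdOfSurjectiveOfIsCompl (V.projectionOnto W hVW) V.mkQ
      (Submodule.range_projectionOnto hVW) V.range_mkQ
      (by rw [Submodule.ker_projectionOnto, Submodule.ker_mkQ]; exact hVW.symm)).toAffineEquiv

variable {n k : ℕ} (σ : Affine.Simplex ℝ (EucSp n) k)

theorem finrank_simplexDir : finrank ℝ (simplexDir σ) = k :=
  σ.independent.finrank_vectorSpan (by simp)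

theorem finrank_quotient_simplexDir_add : finrank ℝ (EucSp n ⧸ simplexDir σ) + k = n := by
  have hcodim := (simplexDir σ).finrank_quotient_add_finrank
  rwa [finrank_simplexDir, finrank_euclideanSpace, Fintype.card_fin] at hcodim

theorem vsub_mem_simplexDir {p : EucSp n} (hp : p ∈ simplexBody σ) (i : Fin (k + 1)) :
    σ.points i -ᵥ p ∈ simplexDir σ := by
  rw [simplexDir, ← direction_affineSpan]
  exact AffineSubspace.vsub_mem_direction (mem_affineSpan ℝ (mem_range_self i))
    (convexHull_subset_affineSpan _ hp)

/-- The vertices of the simplex, relative to a base point in it, as an affine basis of the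
direction of the simplex. -/
def simplexBasis {p : EucSp n} (hp : p ∈ simplexBody σ) :
    AffineBasis (Fin (k + 1)) ℝ (simplexDir σ) :=
  have hind : AffineIndependent ℝ fun i =>
      (⟨σ.points i -ᵥ p, vsub_mem_simplexDir σ hp i⟩ : simplexDir σ) :=
    AffineIndependent.of_comp (simplexDir σ).subtype.toAffineMap
      ((AffineEquiv.vaddConst ℝ p).symm.affineIndependent_iff.2 σ.independent)
  { toFun := fun i => ⟨σ.points i -ᵥ p, vsub_mem_simplexDir σ hp i⟩
    ind' := hind
    tot' := hind.affineSpan_eq_top_iff_card_eq_finrank_add_one.2 (by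
      rw [finrank_simplexDir, Fintype.card_fin]) }

/-- The barycentric coordinates of the simplex, extended to the whole space along `W`, together with
the quotient map. -/
def simplexFrame {W : Submodule ℝ (EucSp n)} (hW : IsCompl W (simplexDir σ)) {p : EucSp n}
    (hp : p ∈ simplexBody σ) : Frame (Fin (k + 1)) (EucSp n) (EucSp n ⧸ simplexDir σ) :=
  (basisFrame (simplexBasis σ hp) _).pullback (complCoordinates hW.symm p)

variable {W : Submodule ℝ (EucSp n)} (hW : IsCompl W (simplexDir σ)) {p : EucSp n}
  (hp : p ∈ simplexBody σ)

theorem simplexFrame_bary (i : Fin (k + 1)) (x : EucSp n) : (simplexFrame σ hW hp).bary i x =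
    (simplexBasis σ hp).coord i ((simplexDir σ).projectionOnto W hW.symm (x - p)) := rfl

theorem simplexFrame_proj (x : EucSp n) :
    (simplexFrame σ hW hp).proj x = (simplexDir σ).mkQ (x - p) := rfl

theorem isVertexFamily_simplexFrame : IsVertexFamily (simplexFrame σ hW hp) σ.points where
  bary_eq i l := by
    have hvertex : (simplexDir σ).projectionOnto W hW.symm (σ.points l - p) = simplexBasis σ hp l :=
      Submodule.projectionOnto_apply_left hW.symm ⟨_, vsub_mem_simplexDir σ hp l⟩
    rw [simplexFrame_bary, hvertex, AffineBasis.coord_apply]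
  proj_eq_zero l := by
    rw [simplexFrame_proj, Submodule.mkQ_apply, Submodule.Quotient.mk_eq_zero]
    exact vsub_mem_simplexDir σ hp l

theorem basisPolytope_fanPolyhedron {J : Type*} [Finite J] [Nonempty J]
    (g : Fin (k + 1) → J → (EucSp n ⧸ simplexDir σ) →ₗ[ℝ] ℝ) :
    basisPolytope (fanPolyhedron (simplexFrame σ hW hp) g) σ =
      {y | ∀ m, sumFamily g m (y - (simplexDir σ).mkQ p) ≤ 1} := by
  have himage := image_proj_fanPolyhedron (simplexFrame σ hW hp) g
  have hproj : ⇑(simplexFrame σ hW hp).proj =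
      (fun y => y - (simplexDir σ).mkQ p) ∘ (simplexDir σ).mkQ :=
    funext fun x => map_sub (simplexDir σ).mkQ x p
  rw [hproj, image_comp] at himage
  ext y
  rw [← sub_left_injective.mem_set_image (a := y), basisPolytope, himage]
  rfl

end SimplexFrame

section Polytopes

variable {E : Type*} [NormedAddCommGroup E] [NormedSpace ℝ E] {P : Set E}

theorem IsPolytope.finite_vertices (hP : IsPolytope P) : (vertices P).Finite := by
  obtain ⟨s, hs, rfl⟩ := hP
  exact hs.subset extremePoints_convexHull_subset

theorem IsPolytope.isCompact (hP : IsPolytope P) : IsCompact P := by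
  obtain ⟨s, hs, rfl⟩ := hP
  exact hs.isCompact_convexHull ℝ

theorem IsPolytope.convex (hP : IsPolytope P) : Convex ℝ P := by
  obtain ⟨s, -, rfl⟩ := hP
  exact convex_convexHull ℝ s

theorem IsPolytope.convexHull_vertices (hP : IsPolytope P) : convexHull ℝ (vertices P) = P := by
  rw [← (hP.finite_vertices.isCompact_convexHull ℝ).isClosed.closure_eq]
  exact closure_convexHull_extremePoints hP.isCompact hP.convex

end Polytopes

section SpecialSimplices

variable {n k : ℕ} {P : Set (EucSp n)} {σ : Affine.Simplex ℝ (EucSp n) k}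

theorem ncard_simplexVertices_inter_eq_iff (T : Set (EucSp n)) :
    (simplexVertices σ ∩ T).ncard = k ↔ ∃ i, ∀ l, σ.points l ∈ T ↔ l ≠ i := by
  have hinter : simplexVertices σ ∩ T = σ.points '' (σ.points ⁻¹' T) := by
    rw [image_preimage_eq_inter_range, inter_comm, simplexVertices]
  have hcompl := Set.ncard_add_ncard_compl (σ.points ⁻¹' T)
  rw [Nat.card_eq_fintype_card, Fintype.card_fin] at hcompl
  rw [hinter, Set.ncard_image_of_injective _ σ.independent.injective,
    show (σ.points ⁻¹' T).ncard = k ↔ (σ.points ⁻¹' T)ᶜ.ncard = 1 by omega, Set.ncard_eq_one]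
  refine exists_congr fun i => Set.ext_iff.trans (forall_congr' fun l => ?_)
  simp only [mem_compl_iff, mem_preimage, mem_singleton_iff]
  tauto

theorem isSpecialSimplex_fanPolyhedron {M : Type*} [Finite M] [Nonempty M] (hn : 0 < n)
    {W : Submodule ℝ (EucSp n)} (hW : IsCompl W (simplexDir σ)) {p : EucSp n}
    (hp : p ∈ simplexBody σ) {g : Fin (k + 1) → M → (EucSp n ⧸ simplexDir σ) →ₗ[ℝ] ℝ}
    (hg : IsPositivelySpanning (sumFamily g))
    (hext : simplexVertices σ ⊆ vertices (fanPolyhedron (simplexFrame σ hW hp) g)) :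
    IsSpecialSimplex (fanPolyhedron (simplexFrame σ hW hp) g) σ :=
  ⟨hext, fun T hT => (ncard_simplexVertices_inter_eq_iff T).2 <|
    (isVertexFamily_simplexFrame σ hW hp).exists_forall_mem_facet_iff hg (by simpa using hn) hT⟩

theorem IsSpecialSimplex.exists_eq_fanPolyhedron (hσ : IsSpecialSimplex P σ) (hP : IsPolytope P)
    (hdim : dim P = n) {z : EucSp n} (hzP : z ∈ P) (hz : z ∉ simplexVertices σ)
    {W : Submodule ℝ (EucSp n)} (hW : IsCompl W (simplexDir σ)) {p : EucSp n}
    (hp : p ∈ simplexBody σ) :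
    ∃ (K : Type) (_ : Finite K) (_ : Nonempty K)
      (g : Fin (k + 1) → K → (EucSp n ⧸ simplexDir σ) →ₗ[ℝ] ℝ),
      P = fanPolyhedron (simplexFrame σ hW hp) g ∧ IsPositivelySpanning (sumFamily g) := by
  have hmem : ∀ i, σ.points i ∈ P := fun i => (hσ.1 ⟨i, rfl⟩).1
  have hne : ∀ i, z ≠ σ.points i := fun i h => hz ⟨i, h.symm⟩
  have : Nontrivial (EucSp n) := ⟨z, _, hne 0⟩
  obtain ⟨S, x₀, hS, hrep, hfacets⟩ := exists_facet_representation hP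
    (by rw [hdim, finrank_euclideanSpace, Fintype.card_fin])
  have hbounded : Bornology.IsBounded (polyhedron fun l : S => dualConstraint x₀ (l : _)) :=
    hrep ▸ hP.isCompact.isBounded
  obtain ⟨hK, g, hg⟩ := (isVertexFamily_simplexFrame σ hW hp).exists_eq_fanPolyhedron hbounded
    (fun i => ⟨z, hrep ▸ hzP, hne i⟩) (fun i => hrep ▸ hmem i) fun l => by
      obtain ⟨i, hi⟩ := (ncard_simplexVertices_inter_eq_iff _).1 (hσ.2 _ (hfacets l l.2))
      exact ⟨i, fun m => (and_iff_right (hmem m)).symm.trans (hi m)⟩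
  have : Finite S := hS
  exact ⟨S, this, hK, g, hrep.trans hg, isPositivelySpanning_of_isBounded (hg ▸ hbounded)⟩

end SpecialSimplices

section Placements

variable {n k : ℕ} {P : Set (EucSp n)} {σ : Affine.Simplex ℝ (EucSp n) k} (c : Placement P σ)

theorem Placement.mem_simplexBody : c.p ∈ simplexBody σ :=
  (intrinsicInterior_subset c.mem).2

/-- The coordinates in which the vertex projection is constant on the barycentric part and the
identity on the quotient. -/
def Placement.frame : Frame (Fin (k + 1)) (EucSp n) (EucSp n ⧸ simplexDir σ) :=
  simplexFrame σ c.isCompl c.mem_simplexBody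

/-- The barycentric coordinates of the base point `p` with respect to the simplex. -/
def Placement.weights (i : Fin (k + 1)) : ℝ := c.frame.bary i c.p

theorem Placement.isVertexFamily_frame : IsVertexFamily c.frame σ.points :=
  isVertexFamily_simplexFrame σ c.isCompl c.mem_simplexBody

theorem Placement.simplexBody_eq :
    simplexBody σ = {x | c.frame.proj x = 0 ∧ ∀ i, 0 ≤ c.frame.bary i x} :=
  c.isVertexFamily_frame.convexHull_range_eq

theorem Placement.weights_mem_stdSimplex : c.weights ∈ stdSimplex ℝ (Fin (k + 1)) :=
  ⟨(c.simplexBody_eq ▸ c.mem_simplexBody : c.p ∈ {x | _ ∧ ∀ i, 0 ≤ c.frame.bary i x}).2,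
    c.frame.sum_bary c.p⟩

theorem Placement.bary_vertexProjection (i : Fin (k + 1)) (x : EucSp n) :
    c.frame.bary i (vertexProjection c x) = c.weights i := by
  rw [Placement.weights, Placement.frame, simplexFrame_bary, simplexFrame_bary, vertexProjection,
    add_sub_cancel_left, sub_self, map_zero, (Submodule.projectionOnto_apply_eq_zero_iff _).2]
  exact (c.W.projectionOnto _ c.isCompl _).2

theorem Placement.proj_vertexProjection (x : EucSp n) :
    c.frame.proj (vertexProjection c x) = c.frame.proj x := by
  rw [Placement.frame, simplexFrame_proj, simplexFrame_proj, vertexProjection, add_sub_cancel_left,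
    Submodule.mkQ_apply, Submodule.mkQ_apply, eq_comm, Submodule.Quotient.eq]
  exact Submodule.sub_projection_mem c.isCompl _

theorem Placement.nonempty_sUnion_residualComplex (c : Placement P σ) :
    (⋃₀ residualComplex P σ).Nonempty :=
  (affineSpan_nonempty ℝ).1 ⟨c.p, (intrinsicInterior_subset c.mem).1⟩

theorem Placement.exists_mem_notMem_simplexVertices (c : Placement P σ) :
    ∃ x ∈ P, x ∉ simplexVertices σ := by
  obtain ⟨x, T, ⟨hT, hdisjoint⟩, hx⟩ := c.nonempty_sUnion_residualComplex
  exact ⟨x, hT.subset hx, Set.disjoint_left.1 hdisjoint hx⟩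

theorem Placement.sUnion_residualComplex_fanPolyhedron {J : Type*} [Finite J] [Nonempty J]
    (g : Fin (k + 1) → J → (EucSp n ⧸ simplexDir σ) →ₗ[ℝ] ℝ) :
    ⋃₀ residualComplex (fanPolyhedron c.frame g) σ = tightLocus c.frame g :=
  c.isVertexFamily_frame.sUnion_faces_disjoint_range_eq_tightLocus

theorem Placement.projectedPolytope_eq_fanPolyhedron (hP : IsPolytope P) {J : Type*} [Finite J]
    [Nonempty J] {g : Fin (k + 1) → J → (EucSp n ⧸ simplexDir σ) →ₗ[ℝ] ℝ}
    (hPg : P = fanPolyhedron c.frame g) (hg : IsPositivelySpanning (sumFamily g)) :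
    projectedPolytope c = fanPolyhedron c.frame (scaledFamily c.weights (sumFamily g)) := by
  let φ : EucSp n →ᵃ[ℝ] EucSp n := (AffineEquiv.vaddConst ℝ c.p).toAffineMap.comp
    ((c.W.projection (simplexDir σ) c.isCompl).toAffineMap.comp
      (AffineEquiv.vaddConst ℝ c.p).symm.toAffineMap)
  have hφ : ⇑φ = vertexProjection c := funext fun x => add_comm _ _
  rw [projectedPolytope, ← hφ]
  exact c.isVertexFamily_frame.convexHull_image_union_range hg
    (hPg.symm.trans hP.convexHull_vertices.symm) c.weights_mem_stdSimplex
    (fun x i => by rw [hφ, c.bary_vertexProjection]) fun x => by rw [hφ, c.proj_vertexProjection]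

theorem Placement.weights_pos {J : Type*} [Finite J] [Nonempty J]
    {g : Fin (k + 1) → J → (EucSp n ⧸ simplexDir σ) →ₗ[ℝ] ℝ}
    (hPg : P = fanPolyhedron c.frame g) (hg : IsPositivelySpanning (sumFamily g))
    {i : Fin (k + 1)} {j j' : J} (hne : g i j ≠ g i j') : 0 < c.weights i := by
  obtain ⟨z, hz, hz_proj, hz_nonneg, hz_pos⟩ :=
    exists_mem_affineSpan_tightLocus_bary_pos c.frame hg hne
  rw [← c.sUnion_residualComplex_fanPolyhedron, ← hPg] at hz
  obtain ⟨t, ht, -, hbeyond⟩ := exists_pos_add_smul_mem_of_mem_intrinsicInterior c.mem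
    (⟨hz, c.simplexBody_eq ▸ ⟨hz_proj, hz_nonneg⟩⟩ :
      z ∈ (residualSpan P σ : Set (EucSp n)) ∩ simplexBody σ)
  rw [c.simplexBody_eq] at hbeyond
  have hnonneg := hbeyond.2 i
  rw [affineMap_add_smul, affineMap_linear_sub] at hnonneg
  change 0 ≤ c.weights i + t * (c.weights i - c.frame.bary i z) at hnonneg
  nlinarith [mul_pos ht hz_pos]

theorem Placement.exists_eq_fanPolyhedron (hP : IsPolytope P) (hdim : dim P = n)
    (hσ : IsSpecialSimplex P σ) :
    ∃ (K : Type) (_ : Finite K) (_ : Nonempty K)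
      (g : Fin (k + 1) → K → (EucSp n ⧸ simplexDir σ) →ₗ[ℝ] ℝ),
      IsPositivelySpanning (sumFamily g) ∧ P = fanPolyhedron c.frame g ∧
      projectedPolytope c = fanPolyhedron c.frame (scaledFamily c.weights (sumFamily g)) ∧
      ∀ i, c.weights i = 0 → ∀ j j', g i j = g i j' := by
  obtain ⟨z, hzP, hz⟩ := c.exists_mem_notMem_simplexVertices
  obtain ⟨K, hK, hK', g, hPg, hg⟩ :=
    hσ.exists_eq_fanPolyhedron hP hdim hzP hz c.isCompl c.mem_simplexBody
  exact ⟨K, hK, hK', g, hg, hPg, c.projectedPolytope_eq_fanPolyhedron hP hPg hg, fun i hi j j' =>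
    by_contra fun hne => (c.weights_pos hPg hg hne).ne' hi⟩

end Placements

section Counting

theorem sum_finset_eq_sum_Ico {ι : Type*} [Fintype ι] {k : ℕ} (hk : Fintype.card ι = k + 1)
    (f : ℤ → ℕ) :
    ∑ I : Finset ι, (if I.card = 0 then 0 else f (k - I.card)) =
      ∑ l ∈ Finset.Ico (-1 : ℤ) k, f l * (k + 1).choose (l + 1).toNat := by
  have hcard := Finset.sum_powerset_apply_card (fun m : ℕ => if m = 0 then 0 else f (k - m))
    (x := (Finset.univ : Finset ι))
  rw [Finset.powerset_univ, Finset.card_univ, hk] at hcard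
  rw [hcard, Finset.sum_range_succ', if_pos rfl, smul_zero, add_zero]
  refine Finset.sum_bij' (fun m _ => (k : ℤ) - (m + 1 : ℕ)) (fun l _ => (k - 1 - l).toNat)
    (fun m hm => ?_) (fun l hl => ?_) (fun m _ => ?_) (fun l hl => ?_) fun m hm => ?_
  · rw [Finset.mem_range] at hm
    rw [Finset.mem_Ico]
    omega
  · rw [Finset.mem_Ico] at hl
    rw [Finset.mem_range]
    omega
  · omega
  · rw [Finset.mem_Ico] at hl
    omega
  · rw [Finset.mem_range] at hm
    rw [if_neg m.succ_ne_zero, smul_eq_mul, mul_comm, ← Nat.choose_symm (by omega)]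
    congr 2
    omega

theorem sum_sum_ite_add_eq {R S : Finset ℤ} {f g : ℤ → ℕ} (hf : ∀ r ∉ R, f r = 0) (m : ℤ) :
    ∑ r ∈ R, ∑ l ∈ S, (if r + l = m then f r * g l else 0) = ∑ l ∈ S, f (m - l) * g l := by
  rw [Finset.sum_comm]
  refine Finset.sum_congr rfl fun l _ => ?_
  simp only [← eq_sub_iff_add_eq, Finset.sum_ite_eq']
  split_ifs with hr
  · rfl
  · rw [hf _ hr, zero_mul]

end Counting

theorem dim_setOf_le_one {Y M : Type*} [AddCommGroup Y] [Module ℝ Y] [FiniteDimensional ℝ Y]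
    [Finite M] [Nonempty M] {h : M → Y →ₗ[ℝ] ℝ} (hh : IsPositivelySpanning h) (q : Y) :
    dim {y | ∀ m, h m (y - q) ≤ 1} = finrank ℝ Y := by
  rw [← fanPolyhedron_unitFrame, dim_fanPolyhedron _ hh.sumFamily_unit]

section Translation

variable {Y M : Type*} [AddCommGroup Y] [Module ℝ Y] [TopologicalSpace Y] [IsTopologicalAddGroup Y]
  [ContinuousSMul ℝ Y] {h : M → Y →ₗ[ℝ] ℝ}

theorem lt_one_of_mem_interior {q₀ q : Y} (hq : q ∈ interior {y | ∀ m, h m (y - q₀) ≤ 1}) (m : M) :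
    h m (q - q₀) < 1 := by
  refine lt_of_le_of_ne (interior_subset hq m) fun hone => ?_
  have hray : Continuous fun t : ℝ => q + t • (q - q₀) := by fun_prop
  have hev : ∀ᶠ t in 𝓝 (0 : ℝ), q + t • (q - q₀) ∈ interior {y | ∀ m, h m (y - q₀) ≤ 1} :=
    hray.continuousAt.eventually_mem (by
      rw [zero_smul, add_zero]
      exact isOpen_interior.mem_nhds hq)
  obtain ⟨t, ht, hpos⟩ := ((hev.filter_mono nhdsWithin_le_nhds).and
    (self_mem_nhdsWithin (s := Ioi (0 : ℝ)))).exists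
  have hle : h m (q + t • (q - q₀) - q₀) ≤ 1 := interior_subset ht m
  rw [show q + t • (q - q₀) - q₀ = (1 + t) • (q - q₀) by module, map_smul, hone, smul_eq_mul,
    mul_one] at hle
  exact hle.not_gt (lt_add_of_pos_right 1 hpos)

theorem IsPositivelySpanning.exists_setOf_le_one_eq (hh : IsPositivelySpanning h) {q₀ q : Y}
    (hq : q ∈ interior {y | ∀ m, h m (y - q₀) ≤ 1}) :
    ∃ h' : M → Y →ₗ[ℝ] ℝ, IsPositivelySpanning h' ∧
      {y | ∀ m, h m (y - q₀) ≤ 1} = {y | ∀ m, h' m (y - q) ≤ 1} := by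
  have hpos : ∀ m, 0 < 1 - h m (q - q₀) := fun m => sub_pos.2 (lt_one_of_mem_interior hq m)
  refine ⟨fun m => (1 - h m (q - q₀))⁻¹ • h m, fun y hy => ?_, ?_⟩
  · exact (hh y hy).imp fun m hm => mul_pos (inv_pos.2 (hpos m)) hm
  · ext y
    refine forall_congr' fun m => ?_
    rw [LinearMap.smul_apply, smul_eq_mul, inv_mul_le_one₀ (hpos m), le_sub_iff_add_le, ← map_add,
      sub_add_sub_cancel]

variable [T2Space Y] [FiniteDimensional ℝ Y] [Finite M] [Nonempty M]

theorem numCones_eq_ite (q : Y) (hh : IsPositivelySpanning h) (d : ℤ) :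
    numCones h d =
      if d - 1 < finrank ℝ Y then fVec {y | ∀ m, h m (y - q) ≤ 1} (d - 1) else 0 := by
  rw [← fanPolyhedron_unitFrame, fVec_fanPolyhedron_unit _ hh, sub_add_cancel]
  split_ifs with hlt heq
  · omega
  · rw [zero_add]
  · exact numCones_of_finrank_lt h (by omega)

theorem numCones_eq_of_setOf_le_one_eq {M' : Type*} [Finite M'] [Nonempty M']
    {h' : M' → Y →ₗ[ℝ] ℝ} (hh : IsPositivelySpanning h) (hh' : IsPositivelySpanning h') {q q' : Y}
    (hQ : {y | ∀ m, h m (y - q) ≤ 1} = {y | ∀ m, h' m (y - q') ≤ 1}) (d : ℤ) :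
    numCones h d = numCones h' d := by
  rw [numCones_eq_ite q hh, numCones_eq_ite q' hh', hQ]

end Translation

section DirectSum

variable {E Y ι M : Type*} [AddCommGroup E] [Module ℝ E] [AddCommGroup Y] [Module ℝ Y]
  [FiniteDimensional ℝ Y] [Fintype ι] [Finite M] [Nonempty M] {h : M → Y →ₗ[ℝ] ℝ}

section

variable [TopologicalSpace E] [IsTopologicalAddGroup E] [ContinuousSMul ℝ E] [T2Space E]
  [FiniteDimensional ℝ E]

theorem fVec_fanPolyhedron_scaledFamily_of_pos (F : Frame ι E Y) {k : ℕ}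
    (hk : Fintype.card ι = k + 1) {r : ι → ℝ} (hr : ∀ i, 0 < r i) (hsum : ∑ i, r i = 1)
    (hh : IsPositivelySpanning h) {j : ℤ} (hj : j < k + finrank ℝ Y) :
    fVec (fanPolyhedron F (scaledFamily r h)) j =
      ∑ d ∈ Finset.Ico (-1 : ℤ) (finrank ℝ Y), ∑ l ∈ Finset.Ico (-1 : ℤ) k,
        if d + l = j - 1 then numCones h (d + 1) * (k + 1).choose (l + 1).toNat else 0 := by
  have hsupport : ∀ d ∉ Finset.Ico (-1 : ℤ) (finrank ℝ Y), numCones h (d + 1) = 0 := fun d hd => by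
    rw [Finset.mem_Ico] at hd
    by_cases hneg : d < -1
    · exact ncard_fanCones_of_neg _ (by omega)
    · exact numCones_of_finrank_lt h (by omega)
  rw [sum_sum_ite_add_eq (f := fun d => numCones h (d + 1)) hsupport,
    ← sum_finset_eq_sum_Ico hk fun l => numCones h (j - 1 - l + 1),
    fVec_fanPolyhedron F (hh.sumFamily_scaledFamily hsum)]
  refine Finset.sum_congr rfl fun I _ => ?_
  rw [hk]
  split_ifs with hI
  · rw [Finset.card_eq_zero.1 hI, ncard_fanCones_of_const (by simp), if_neg]
    simp only [Finset.card_empty]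
    omega
  · obtain ⟨i, hi⟩ := Finset.card_ne_zero.1 hI
    rw [ncard_fanCones_scaledFamily (fun i => (hr i).le) _ ⟨i, hi, hr i⟩]
    congr 1
    push_cast
    ring

end

variable [TopologicalSpace Y] [IsTopologicalAddGroup Y] [ContinuousSMul ℝ Y] [T2Space Y]

theorem exists_directSum_eq_fanPolyhedron {b : AffineBasis ι ℝ E} (hb : ∀ i, 0 < b.coord i 0)
    (hh : IsPositivelySpanning h) {q₀ q : Y} (hq : q ∈ interior {y | ∀ m, h m (y - q₀) ≤ 1}) :
    ∃ h' : M → Y →ₗ[ℝ] ℝ, IsPositivelySpanning h' ∧ (∀ d, numCones h d = numCones h' d) ∧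
      directSum (convexHull ℝ (range b)) ((fun x => x - q) '' {y | ∀ m, h m (y - q₀) ≤ 1}) =
        fanPolyhedron (basisFrame b Y) (scaledFamily (fun i => b.coord i 0) h') := by
  obtain ⟨h', hh', hQ⟩ := hh.exists_setOf_le_one_eq hq
  refine ⟨h', hh', numCones_eq_of_setOf_le_one_eq hh hh' hQ, ?_⟩
  rw [hQ, ← directSum_convexHull_eq_fanPolyhedron b (fun i => (hb i).le) hh']
  congr 1
  ext y
  rw [show y = y + q - q by abel, sub_left_injective.mem_set_image]
  rfl

variable [TopologicalSpace E] [IsTopologicalAddGroup E] [ContinuousSMul ℝ E] [T2Space E]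
  [FiniteDimensional ℝ E] {b : AffineBasis ι ℝ E} {q₀ q : Y}

theorem fVec_directSum_eq (hb : ∀ i, 0 < b.coord i 0) (hh : IsPositivelySpanning h)
    (hq : q ∈ interior {y | ∀ m, h m (y - q₀) ≤ 1}) {k : ℕ} (hk : Fintype.card ι = k + 1) {j : ℤ}
    (hj : j < k + finrank ℝ Y) :
    fVec (directSum (convexHull ℝ (range b))
        ((fun x => x - q) '' {y | ∀ m, h m (y - q₀) ≤ 1})) j =
      ∑ d ∈ Finset.Ico (-1 : ℤ) (finrank ℝ Y), ∑ l ∈ Finset.Ico (-1 : ℤ) k,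
        if d + l = j - 1 then
          fVec {y | ∀ m, h m (y - q₀) ≤ 1} d * (k + 1).choose (l + 1).toNat
        else 0 := by
  obtain ⟨h', hh', hnum, hsum⟩ := exists_directSum_eq_fanPolyhedron hb hh hq
  rw [hsum, fVec_fanPolyhedron_scaledFamily_of_pos _ hk hb (b.sum_coord_apply_eq_one 0) hh' hj]
  refine Finset.sum_congr rfl fun d hd => ?_
  rw [← hnum, numCones_eq_ite q₀ hh, add_sub_cancel_right, if_pos (Finset.mem_Ico.1 hd).2]

variable {E' : Type*} [AddCommGroup E'] [Module ℝ E'] [TopologicalSpace E']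
  [IsTopologicalAddGroup E'] [ContinuousSMul ℝ E'] [T2Space E'] [FiniteDimensional ℝ E']
  (F : Frame ι E' Y) {r : ι → ℝ}

theorem fVec_fanPolyhedron_scaledFamily_le_directSum (hr : r ∈ stdSimplex ℝ ι)
    (hb : ∀ i, 0 < b.coord i 0) (hh : IsPositivelySpanning h)
    (hq : q ∈ interior {y | ∀ m, h m (y - q₀) ≤ 1}) (j : ℤ) :
    fVec (fanPolyhedron F (scaledFamily r h)) j ≤
      fVec (directSum (convexHull ℝ (range b))
        ((fun x => x - q) '' {y | ∀ m, h m (y - q₀) ≤ 1})) j := by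
  obtain ⟨h', hh', hnum, hsum⟩ := exists_directSum_eq_fanPolyhedron hb hh hq
  rw [hsum]
  exact fVec_fanPolyhedron_le_of_ncard_fanCones_le F _ (hh.sumFamily_scaledFamily hr.2)
    (hh'.sumFamily_scaledFamily (b.sum_coord_apply_eq_one 0))
    (ncard_fanCones_scaledFamily_le hr.1 hr.2 hb hnum) j

theorem fVec_fanPolyhedron_scaledFamily_zero_eq_directSum [DecidableEq ι] (hr : r ∈ stdSimplex ℝ ι)
    (hb : ∀ i, 0 < b.coord i 0) (hh : IsPositivelySpanning h)
    (hq : q ∈ interior {y | ∀ m, h m (y - q₀) ≤ 1})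
    (hone : ∀ i, 0 < (fanCones (scaledFamily r h) {i}ᶜ 0).ncard) :
    fVec (fanPolyhedron F (scaledFamily r h)) 0 =
      fVec (directSum (convexHull ℝ (range b))
        ((fun x => x - q) '' {y | ∀ m, h m (y - q₀) ≤ 1})) 0 := by
  obtain ⟨h', hh', hnum, hsum⟩ := exists_directSum_eq_fanPolyhedron hb hh hq
  obtain ⟨i, hi⟩ := exists_pos_of_sum_eq_one hr.2
  rw [hsum]
  refine fVec_fanPolyhedron_zero_eq_of_ncard_fanCones_le F _ (hh.sumFamily_scaledFamily hr.2)
    (hh'.sumFamily_scaledFamily (b.sum_coord_apply_eq_one 0))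
    (ncard_fanCones_scaledFamily_le hr.1 hr.2 hb hnum) (fun d => ?_) hone
  rw [ncard_fanCones_scaledFamily hr.1 h ⟨i, Finset.mem_univ i, hi⟩, hnum,
    ncard_fanCones_scaledFamily (fun i => (hb i).le) h' ⟨i, Finset.mem_univ i, hb i⟩]

end DirectSum

section ProjectedPolytope

variable {n k : ℕ} {P : Set (EucSp n)} {σ : Affine.Simplex ℝ (EucSp n) k} (c : Placement P σ)

theorem Placement.isPolytope_projectedPolytope (hP : IsPolytope P) :
    IsPolytope (projectedPolytope c) :=
  ⟨_, (hP.finite_vertices.sdiff.image _).union (Set.finite_range _), rfl⟩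

theorem Placement.basisPolytope_eq {J : Type*} [Finite J] [Nonempty J]
    {g : Fin (k + 1) → J → (EucSp n ⧸ simplexDir σ) →ₗ[ℝ] ℝ} (hPg : P = fanPolyhedron c.frame g) :
    basisPolytope P σ = {y | ∀ m, sumFamily g m (y - (simplexDir σ).mkQ c.p) ≤ 1} := by
  conv_lhs => rw [hPg]
  exact basisPolytope_fanPolyhedron σ c.isCompl c.mem_simplexBody g

variable (hP : IsPolytope P) (hdim : dim P = n) (hσ : IsSpecialSimplex P σ)

include c hP hdim hσ

theorem Placement.dim_basisPolytope :
    dim (basisPolytope P σ) = finrank ℝ (EucSp n ⧸ simplexDir σ) := by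
  obtain ⟨K, _, _, g, hg, hPg, -⟩ := c.exists_eq_fanPolyhedron hP hdim hσ
  rw [c.basisPolytope_eq hPg, dim_setOf_le_one hg]

theorem Placement.nontrivial_quotient : Nontrivial (EucSp n ⧸ simplexDir σ) := by
  obtain ⟨K, _, _, g, -, hPg, -⟩ := c.exists_eq_fanPolyhedron hP hdim hσ
  obtain ⟨x, hx⟩ := c.nonempty_sUnion_residualComplex
  have hx' : x ∈ tightLocus c.frame g := by
    rwa [← c.sUnion_residualComplex_fanPolyhedron, ← hPg]
  exact nontrivial_of_ne _ 0 (proj_ne_zero_of_tightIndices_eq_univ hx'.2)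

theorem Placement.dim_projectedPolytope : dim (projectedPolytope c) = n := by
  obtain ⟨K, _, _, g, hg, -, hP', -⟩ := c.exists_eq_fanPolyhedron hP hdim hσ
  rw [hP', dim_fanPolyhedron _ (hg.sumFamily_scaledFamily c.weights_mem_stdSimplex.2),
    finrank_euclideanSpace, Fintype.card_fin]

theorem Placement.basisPolytope_projectedPolytope :
    basisPolytope (projectedPolytope c) σ = basisPolytope P σ := by
  obtain ⟨K, _, _, g, -, hPg, hP', -⟩ := c.exists_eq_fanPolyhedron hP hdim hσ
  rw [c.basisPolytope_eq hPg, hP', Placement.frame, basisPolytope_fanPolyhedron]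
  exact Set.ext fun y => sumFamily_scaledFamily_le_one_iff c.weights_mem_stdSimplex.1
    c.weights_mem_stdSimplex.2

theorem Placement.exists_ne_weights_pos (i : Fin (k + 1)) : ∃ l ≠ i, 0 < c.weights l := by
  obtain ⟨K, _, _, g, -, hPg, -, hconst⟩ := c.exists_eq_fanPolyhedron hP hdim hσ
  have := c.nontrivial_quotient hP hdim hσ
  by_contra! hle
  have hbot := c.isVertexFamily_frame.coneSpan_eq_bot (hPg ▸ hσ.1 ⟨i, rfl⟩)
  refine bot_ne_top (hbot.symm.trans (coneSpan_maximizerPairs_eq_top_iff.2 fun l hl => ?_))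
  have hzero : c.weights l = 0 :=
    (hle l (by simpa using hl)).antisymm (c.weights_mem_stdSimplex.1 l)
  rintro _ ⟨j, -, rfl⟩ _ ⟨j', -, rfl⟩
  exact hconst l hzero j j'

theorem Placement.simplexVertices_subset_vertices_projectedPolytope :
    simplexVertices σ ⊆ vertices (projectedPolytope c) := by
  obtain ⟨K, _, _, g, hg, -, hP', -⟩ := c.exists_eq_fanPolyhedron hP hdim hσ
  rintro _ ⟨i, rfl⟩
  obtain ⟨l, hl, hpos⟩ := c.exists_ne_weights_pos hP hdim hσ i
  rw [hP']
  exact c.isVertexFamily_frame.mem_extremePoints_fanPolyhedron_scaledFamily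
    c.weights_mem_stdSimplex.1 hg hl hpos

theorem Placement.isSpecialSimplex_projectedPolytope :
    IsSpecialSimplex (projectedPolytope c) σ := by
  obtain ⟨K, _, _, g, hg, -, hP', -⟩ := c.exists_eq_fanPolyhedron hP hdim hσ
  have hext := c.simplexVertices_subset_vertices_projectedPolytope hP hdim hσ
  have hpos : 0 < n := by
    have := c.nontrivial_quotient hP hdim hσ
    have hcodim := finrank_quotient_simplexDir_add σ
    have hquot := finrank_pos (R := ℝ) (M := EucSp n ⧸ simplexDir σ)
    omega
  rw [hP'] at hext ⊢
  exact isSpecialSimplex_fanPolyhedron hpos c.isCompl c.mem_simplexBody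
    (hg.sumFamily_scaledFamily c.weights_mem_stdSimplex.2) hext

theorem Placement.isMeek_projectedPolytope : IsMeek (projectedPolytope c) σ := by
  obtain ⟨K, _, _, g, hg, -, hP', -⟩ := c.exists_eq_fanPolyhedron hP hdim hσ
  have := c.nontrivial_quotient hP hdim hσ
  obtain ⟨y, hy⟩ := exists_ne (0 : EucSp n ⧸ simplexDir σ)
  obtain ⟨x, hx, -⟩ := exists_mem_tightLocus c.frame
    (hg.sumFamily_scaledFamily c.weights_mem_stdSimplex.2) hy
  rw [IsMeek, c.basisPolytope_projectedPolytope hP hdim hσ, c.dim_basisPolytope hP hdim hσ,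
    residualSpan, hP', c.sUnion_residualComplex_fanPolyhedron,
    dim_of_nonempty ⟨x, subset_affineSpan ℝ _ hx⟩, ← AffineSubspace.direction,
    direction_affineSpan, finrank_vectorSpan_tightLocus_scaledFamily c.frame
      c.weights_mem_stdSimplex.1 c.weights_mem_stdSimplex.2 hg]

end ProjectedPolytope

section FVectors

variable {n k : ℕ} {P : Set (EucSp n)} {σ : Affine.Simplex ℝ (EucSp n) k} (c : Placement P σ)
  (hP : IsPolytope P) (hdim : dim P = n) (hσ : IsSpecialSimplex P σ)

include c hP hdim hσ

theorem Placement.fVec_le_projectedPolytope (i : ℤ) : fVec P i ≤ fVec (projectedPolytope c) i := by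
  obtain ⟨K, _, _, g, hg, hPg, hP', hconst⟩ := c.exists_eq_fanPolyhedron hP hdim hσ
  calc fVec P i = fVec (fanPolyhedron c.frame g) i := congrArg (fVec · i) hPg
    _ ≤ _ := fVec_fanPolyhedron_le_of_ncard_fanCones_le c.frame c.frame hg
      (hg.sumFamily_scaledFamily c.weights_mem_stdSimplex.2)
      (ncard_fanCones_le_scaledFamily c.weights_mem_stdSimplex.1 hconst) i
    _ = fVec (projectedPolytope c) i := by rw [hP']

theorem Placement.fVec_zero_eq_projectedPolytope : fVec P 0 = fVec (projectedPolytope c) 0 := by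
  obtain ⟨K, _, _, g, hg, hPg, hP', hconst⟩ := c.exists_eq_fanPolyhedron hP hdim hσ
  obtain ⟨i, hi⟩ := exists_pos_of_sum_eq_one c.weights_mem_stdSimplex.2
  calc fVec P 0 = fVec (fanPolyhedron c.frame g) 0 := congrArg (fVec · 0) hPg
    _ = _ := fVec_fanPolyhedron_zero_eq_of_ncard_fanCones_le c.frame c.frame hg
      (hg.sumFamily_scaledFamily c.weights_mem_stdSimplex.2)
      (ncard_fanCones_le_scaledFamily c.weights_mem_stdSimplex.1 hconst)
      (fun d => by rw [ncard_fanCones_univ_eq_numCones,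
        ncard_fanCones_scaledFamily c.weights_mem_stdSimplex.1 _ ⟨i, Finset.mem_univ i, hi⟩])
      fun l => c.isVertexFamily_frame.ncard_fanCones_compl_singleton_zero_pos
        (hPg ▸ hσ.1 ⟨l, rfl⟩)
    _ = fVec (projectedPolytope c) 0 := by rw [hP']

theorem Placement.fVec_lt_projectedPolytope (hnot : ¬ CombEquiv P (projectedPolytope c)) {i : ℤ}
    (hi : i = n - 2 ∨ i = n - 1) : fVec P i < fVec (projectedPolytope c) i := by
  obtain ⟨K, _, _, g, hg, hPg, hP', hconst⟩ := c.exists_eq_fanPolyhedron hP hdim hσ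
  have hnot' : ¬ CombEquiv (fanPolyhedron c.frame g)
      (fanPolyhedron c.frame (scaledFamily c.weights (sumFamily g))) := by rwa [← hPg, ← hP']
  have hcodim := finrank_quotient_simplexDir_add σ
  calc fVec P i = fVec (fanPolyhedron c.frame g) i := congrArg (fVec · i) hPg
    _ < _ := fVec_fanPolyhedron_lt_scaledFamily c.frame hg c.weights_mem_stdSimplex.1
      c.weights_mem_stdSimplex.2 hconst hnot' (by rw [Fintype.card_fin]; omega)
    _ = fVec (projectedPolytope c) i := by rw [hP']

end FVectors

section DirectSums

/-- The vertices of a `k`-simplex in `ℝᵏ` as an affine basis. -/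
def simplexAffineBasis {k : ℕ} (τ : Affine.Simplex ℝ (EucSp k) k) :
    AffineBasis (Fin (k + 1)) ℝ (EucSp k) where
  toFun := τ.points
  ind' := τ.independent
  tot' := τ.independent.affineSpan_eq_top_iff_card_eq_finrank_add_one.2 (by simp)

theorem coord_simplexAffineBasis_pos {k : ℕ} {τ : Affine.Simplex ℝ (EucSp k) k} {x : EucSp k}
    (hx : x ∈ interior (simplexBody τ)) (i : Fin (k + 1)) :
    0 < (simplexAffineBasis τ).coord i x :=
  ((simplexAffineBasis τ).interior_convexHull.subset hx) i

variable {n k : ℕ}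

instance isClosed_simplexDir (σ : Affine.Simplex ℝ (EucSp n) k) :
    IsClosed (simplexDir σ : Set (EucSp n)) :=
  (simplexDir σ).closed_of_finiteDimensional

variable {P : Set (EucSp n)} {σ : Affine.Simplex ℝ (EucSp n) k} (c : Placement P σ)
  (hP : IsPolytope P) (hdim : dim P = n) (hσ : IsSpecialSimplex P σ)
  {τ : Affine.Simplex ℝ (EucSp k) k} (hτ : 0 ∈ interior (simplexBody τ))
  {q : EucSp n ⧸ simplexDir σ} (hq : q ∈ interior (basisPolytope P σ))

include c hP hdim hσ hτ hq

theorem Placement.fVec_projectedPolytope_le_directSum (i : ℤ) : fVec (projectedPolytope c) i ≤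
    fVec (directSum (simplexBody τ) ((fun x => x - q) '' basisPolytope P σ)) i := by
  obtain ⟨K, _, _, g, hg, hPg, hP', -⟩ := c.exists_eq_fanPolyhedron hP hdim hσ
  rw [c.basisPolytope_eq hPg] at hq ⊢
  rw [hP']
  exact fVec_fanPolyhedron_scaledFamily_le_directSum c.frame c.weights_mem_stdSimplex
    (coord_simplexAffineBasis_pos hτ) hg hq i

theorem Placement.fVec_projectedPolytope_zero_eq_directSum : fVec (projectedPolytope c) 0 =
    fVec (directSum (simplexBody τ) ((fun x => x - q) '' basisPolytope P σ)) 0 := by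
  obtain ⟨K, _, _, g, hg, hPg, hP', -⟩ := c.exists_eq_fanPolyhedron hP hdim hσ
  have hext := c.simplexVertices_subset_vertices_projectedPolytope hP hdim hσ
  rw [c.basisPolytope_eq hPg] at hq ⊢
  rw [hP'] at hext ⊢
  have hone : ∀ i, 0 < (fanCones (scaledFamily c.weights (sumFamily g)) {i}ᶜ 0).ncard := fun i =>
    c.isVertexFamily_frame.ncard_fanCones_compl_singleton_zero_pos (hext ⟨i, rfl⟩)
  exact fVec_fanPolyhedron_scaledFamily_zero_eq_directSum (b := simplexAffineBasis τ) c.frame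
    c.weights_mem_stdSimplex (coord_simplexAffineBasis_pos hτ) hg hq hone

theorem Placement.fVec_directSum_basisPolytope {j : ℤ} (hj : j ≤ n - 1) :
    fVec (directSum (simplexBody τ) ((fun x => x - q) '' basisPolytope P σ)) j =
      ∑ r ∈ Finset.Ico (-1 : ℤ) (dim (basisPolytope P σ)), ∑ l ∈ Finset.Ico (-1 : ℤ) k,
        if r + l = j - 1 then fVec (basisPolytope P σ) r * (k + 1).choose (l + 1).toNat else 0 := by
  obtain ⟨K, _, _, g, hg, hPg, -⟩ := c.exists_eq_fanPolyhedron hP hdim hσ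
  have hcodim := finrank_quotient_simplexDir_add σ
  rw [c.dim_basisPolytope hP hdim hσ]
  rw [c.basisPolytope_eq hPg] at hq ⊢
  exact fVec_directSum_eq (coord_simplexAffineBasis_pos hτ) hg hq (Fintype.card_fin _) (by omega)

end DirectSums

end SpecialSimplex

end

theorem mainTheorem4_general (n k : ℕ) (P : Set (EucSp n)) (hP : IsPolytope P) (hn : dim P = n)
    (σ : Affine.Simplex ℝ (EucSp n) k) (hσ : IsSpecialSimplex P σ) (c : Placement P σ) :
    (IsPolytope (projectedPolytope c) ∧ dim (projectedPolytope c) = n ∧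
      IsSpecialSimplex (projectedPolytope c) σ ∧ IsMeek (projectedPolytope c) σ ∧
      basisPolytope (projectedPolytope c) σ = basisPolytope P σ) ∧
    fVec P 0 = fVec (projectedPolytope c) 0 ∧
    (¬ CombEquiv P (projectedPolytope c) →
      ∀ i : ℤ, i = n - 2 ∨ i = n - 1 → fVec P i < fVec (projectedPolytope c) i) ∧
    (∀ i : ℤ, fVec P i ≤ fVec (projectedPolytope c) i) ∧
    (∀ τ : Affine.Simplex ℝ (EucSp k) k, (0 : EucSp k) ∈ interior (simplexBody τ) →
      ∀ q ∈ interior (basisPolytope P σ),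
        (∀ i : ℤ, fVec (projectedPolytope c) i ≤
          fVec (directSum (simplexBody τ) ((fun x => x - q) '' basisPolytope P σ)) i) ∧
        (fVec (projectedPolytope c) 0 =
          fVec (directSum (simplexBody τ) ((fun x => x - q) '' basisPolytope P σ)) 0) ∧
        (∀ j : ℤ, j ≤ n - 1 →
          fVec (directSum (simplexBody τ) ((fun x => x - q) '' basisPolytope P σ)) j =
            ∑ r ∈ Finset.Ico (-1 : ℤ) (dim (basisPolytope P σ)), ∑ l ∈ Finset.Ico (-1 : ℤ) k,
              if r + l = j - 1 then
                fVec (basisPolytope P σ) r * (k + 1).choose (l + 1).toNat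
              else 0)) :=
  ⟨⟨c.isPolytope_projectedPolytope hP, c.dim_projectedPolytope hP hn hσ,
      c.isSpecialSimplex_projectedPolytope hP hn hσ, c.isMeek_projectedPolytope hP hn hσ,
      c.basisPolytope_projectedPolytope hP hn hσ⟩,
    c.fVec_zero_eq_projectedPolytope hP hn hσ,
    fun hnot _ => c.fVec_lt_projectedPolytope hP hn hσ hnot,
    c.fVec_le_projectedPolytope hP hn hσ,
    fun _ hτ _ hq =>
      ⟨c.fVec_projectedPolytope_le_directSum hP hn hσ hτ hq,
        c.fVec_projectedPolytope_zero_eq_directSum hP hn hσ hτ hq,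
        fun _ => c.fVec_directSum_basisPolytope hP hn hσ hτ hq⟩⟩

theorem mainTheorem4 (n k : ℕ) (P : Set (EucSp n)) (hP : IsPolytope P) (hn : dim P = n)
    (σ : Affine.Simplex ℝ (EucSp n) k) (hσ : IsSpecialSimplex P σ) (hwild : IsWild P σ)
    (c : Placement P σ) :
    -- `P'` is a meek `n`-polytope with special simplex `Σ` and basis polytope `Q`
    (IsPolytope (projectedPolytope c) ∧ dim (projectedPolytope c) = n ∧
      IsSpecialSimplex (projectedPolytope c) σ ∧ IsMeek (projectedPolytope c) σ ∧
      basisPolytope (projectedPolytope c) σ = basisPolytope P σ) ∧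
    -- comparison of the `f`-vectors of `P` and `P'`
    fVec P 0 = fVec (projectedPolytope c) 0 ∧
    (∀ i : ℤ, i = n - 2 ∨ i = n - 1 → fVec P i < fVec (projectedPolytope c) i) ∧
    (∀ i : ℤ, fVec P i ≤ fVec (projectedPolytope c) i) ∧
    -- comparison with `Σ ⊕ Q`, for every `k`-simplex `τ` and every translate `Q - q` of `Q` that
    -- contain the origin in their interiors, and the `f`-vector of `Σ ⊕ Q`
    (∀ τ : Affine.Simplex ℝ (EucSp k) k, (0 : EucSp k) ∈ interior (simplexBody τ) →
      ∀ q ∈ interior (basisPolytope P σ),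
        (∀ i : ℤ, fVec (projectedPolytope c) i ≤
          fVec (directSum (simplexBody τ) ((fun x => x - q) '' basisPolytope P σ)) i) ∧
        (fVec (projectedPolytope c) 0 =
          fVec (directSum (simplexBody τ) ((fun x => x - q) '' basisPolytope P σ)) 0) ∧
        (∀ j : ℤ, 0 ≤ j → j ≤ n - 1 →
          fVec (directSum (simplexBody τ) ((fun x => x - q) '' basisPolytope P σ)) j =
            ∑ r ∈ Finset.Ico (-1 : ℤ) (dim (basisPolytope P σ)), ∑ l ∈ Finset.Ico (-1 : ℤ) k,
              if r + l = j - 1 then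
                fVec (basisPolytope P σ) r * (k + 1).choose (l + 1).toNat
              else 0)) :=
  have ⟨hP', h0, hlt, hle, hsum⟩ := mainTheorem4_general n k P hP hn σ hσ c
  ⟨hP', h0, hlt (hwild.2 c), hle, fun τ hτ q hq =>
    (hsum τ hτ q hq).imp_right (.imp_right fun hj j _ => hj j)⟩
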